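/- **String-net data.** Let $L$ be a finite set of string types with a type $0$ (no string), an involution $i\mapsto i^*$ with $0^*=0$, a symmetric branching rule $\delta_{ijk}\in\{0,1\}$ with $\delta_{ij^*0}=\delta_{ij}$, and a tensor $F^{ijm}_{kln}\in\mathbb C$ such that, with $d_i=1/F^{ii^*0}_{ii^*0}$ (where $F^{ii^*0}_{ii^*0}\neq0$) and fixed square roots $v_i=v_{i^*}$ of $d_i$ (so that $\sqrt{d_md_n/(d_jd_l)}$ means $v_mv_n/(v_jv_l)$), the following hold for all indices: - physicality: $F^{ijm}_{kln}=F^{ijm}_{kln}\delta_{ijm}\delta_{klm^*}=F^{ijm}_{kln}\delta_{iln}\delta_{jkn^*}$; - pentagon: $\sum_nF^{mlq}_{kpn}F^{jip^*}_{mns}F^{jsn}_{lkr}=F^{jip^*}_{q^*kr}F^{r^*iq^*}_{mls}$; - unitarity: $\overline{F^{ijm}_{kln}}=F^{i^*j^*m^*}_{k^*l^*n^*}$; - tetrahedral symmetry: $F^{ijm}_{kln}=F^{jim}_{lkn^*}=F^{lkm^*}_{jin}=F^{imj}_{k^*nl}\,\frac{v_mv_n}{v_jv_l}$; - normalization: $F^{ii^*0}_{j^*jk}=\frac{v_k}{v_iv_j}\delta_{ijk}$.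 **Model.** Let $\mathcal G$ be a finite trivalent graph (loops and multiple edges allowed) embedded in a closed oriented surface so that all complementary regions (plaquettes) are discs. Let $\mathcal H_{\mathcal G}=\bigotimes_e\mathbb C^{L}$ with its orthonormal basis of labelings of the directed edges (reversing an edge replaces $i$ by $i^*$). For a vertex $w$, $Q_w$ is the projection onto the labelings with an allowed triple at $w$. For a plaquette $q$, $B_q=\sum_id_iB_q^i/\sum_id_i^2$, where $B_q^i$ adds a counterclockwise loop of type $i$ around a puncture in $q$ and reduces the result to the basis of $\mathcal H_{\mathcal G}$. Explicitly: the loop is fused into the sides of $q$ one after another (an edge with $q$ on both sides is fused twice, through an intermediate label that is summed over, in any order of fusion coming from an orientation of the edges without sources and sinks). Each corner of $q$ contributes a factor $F^{abc}_{i^*c'b'}$, where $a$ is the label of the third edge at the corner when the corner is resolved, the loop arrives along the edge labeled $c$ and leaves along the edge labeled $b$, all labels are read into the vertex, and primes denote labels after the fusion. Let $H_{\mathcal G}=-\sum_wQ_w-\sum_qB_q$; a ground state is a nonzero eigenvector for its lowest eigenvalue. **Tadpole.** Suppose $\mathcal G$ contains a tadpole: a self-loop $e_1$ that is the whole boundary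 of a plaquette $p$, joined by an edge $e_2$ to a vertex $v$ at which $e_2$ meets two further distinct edges $e_3$ (directed into $v$) and $e_4$ (directed out of $v$). Let $q$ be the plaquette on the other side of $e_1$. Let $\mathcal G'$ be obtained by deleting $e_1$, $e_2$ and their two vertices and replacing $e_3,e_4$ by a single edge $e'$, and let $q'$ be the plaquette of $\mathcal G'$ that $q$ becomes. Put $|\Phi\rangle=\big(\sum_id_i^2\big)^{-1/2}\sum_id_i|i\rangle$ and $$Z_p=\langle\Phi|_{e_1}\otimes\langle0|_{e_2}\otimes\sum_i|i\rangle_{e'}\langle ii|_{e_3e_4}\otimes\mathrm{id}_{\mathcal G\setminus\{e_1,\dots,e_4\}}:\ \mathcal H_{\mathcal G}\to\mathcal H_{\mathcal G'} .$$ **Lemma.** For every choice of the orders of fusion in $\mathcal G$ and in $\mathcal G'$: 1. $|\Phi\rangle$ is a unit vector and $B_p=|\Phi\rangle\langle\Phi|_{e_1}\otimes|0\rangle\langle0|_{e_2}\otimes\mathrm{id}_{\mathcal G\setminus\{e_1,e_2\}}$, a projection of rank one on $e_1,e_2$. 2. $B_qQ_vB_p=Z_p^\dagger B_{q'}Z_p$.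 3. Every ground state $|\Psi\rangle$ of $H_{\mathcal G}$ is a product state $$|\Psi\rangle=Z_p^\dagger|\Psi'\rangle=|\Phi\rangle_{e_1}\otimes|0\rangle_{e_2}\otimes\Big(\sum_i|ii\rangle_{e_3e_4}\langle i|_{e'}\Big)|\Psi'\rangle ,$$ where $|\Psi'\rangle$ is a ground state of $H_{\mathcal G'}$. -/

import Mathlib

open scoped Matrix

/-- The algebraic data of a string-net model with string types `L`: the absence `zero` of a string,
reversal `star` of the direction of a string, the branching rule `allowed` (an unordered triple of
types, all pointing into a vertex) and the tensor `F i j m k l n` (upper indices `i j m`, lower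
indices `k l n`). With `d i = 1 / F i (star i) zero i (star i) zero`, the numbers `v i` are the
square roots of the `d i`, so that `sqrt (d m * d n / (d j * d l))` is `v m * v n / (v j * v l)`;
if all `d i` are positive, this is the usual square root, and negative `d i` are covered too. -/
structure StringNetData (L : Type*) [Fintype L] where
  zero : L
  star : L → L
  star_star : ∀ i, star (star i) = i
  star_zero : star zero = zero
  allowed : L → L → L → Prop
  allowed_swap : ∀ i j k, allowed i j k → allowed j i k
  allowed_rotate : ∀ i j k, allowed i j k → allowed j k i
  allowed_zero : ∀ i j, allowed i (star j) zero ↔ i = j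
  F : L → L → L → L → L → L → ℂ
  v : L → ℂ
  F_ne_zero : ∀ i, F i (star i) zero i (star i) zero ≠ 0
  v_sq : ∀ i, v i ^ 2 = (F i (star i) zero i (star i) zero)⁻¹
  v_star : ∀ i, v (star i) = v i
  physicality : ∀ i j m k l n, F i j m k l n ≠ 0 →
    (allowed i j m ∧ allowed k l (star m)) ∧ (allowed i l n ∧ allowed j k (star n))
  pentagon : ∀ i j k l m p q r s,
    ∑ n, F m l q k p n * F j i (star p) m n s * F j s n l k r
      = F j i (star p) (star q) k r * F (star r) i (star q) m l s
  unitarity : ∀ i j m k l n,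
    starRingEnd ℂ (F i j m k l n) = F (star i) (star j) (star m) (star k) (star l) (star n)
  tetrahedral_one : ∀ i j m k l n, F i j m k l n = F j i m l k (star n)
  tetrahedral_two : ∀ i j m k l n, F i j m k l n = F l k (star m) j i n
  tetrahedral_three : ∀ i j m k l n,
    F i j m k l n = F i m j (star k) n l * (v m * v n / (v j * v l))
  normalization_of_allowed : ∀ i j k, allowed i j k →
    F i (star i) zero (star j) j k = v k / (v i * v j)
  normalization_of_not_allowed : ∀ i j k, ¬ allowed i j k →
    F i (star i) zero (star j) j k = 0

/-- A finite trivalent graph embedded in a closed oriented surface so that the complementary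
regions are discs, given by its rotation system. `D` is the set of darts (directed edges), each
placed at the vertex it leaves; `rev` reverses a dart; `next` is the next dart, counterclockwise,
at the same vertex. Loops and multiple edges are allowed. -/
structure TrivalentMap (D : Type*) where
  rev : Equiv.Perm D
  next : Equiv.Perm D
  rev_rev : ∀ d, rev (rev d) = d
  rev_ne : ∀ d, rev d ≠ d
  next_next_next : ∀ d, next (next (next d)) = d
  next_ne : ∀ d, next d ≠ d

namespace StringNetData

variable {L : Type*} [Fintype L] (M : StringNetData L)

/-- The number `d i`. -/
noncomputable def d (i : L) : ℂ := (M.F i (M.star i) M.zero i (M.star i) M.zero)⁻¹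

/-- The coefficients of the one-edge vector `|Φ⟩`. -/
noncomputable def Phi (i : L) : ℂ := M.d i / (∑ j, M.d j ^ 2) ^ (1 / 2 : ℂ)

end StringNetData

namespace TrivalentMap

variable {D : Type*} (G : TrivalentMap D)

/-- Vertices are the orbits of `next`. -/
abbrev Vertex : Type _ := Quotient (Equiv.Perm.SameCycle.setoid G.next)

/-- The vertex that a dart leaves. -/
def vertex (a : D) : G.Vertex := Quotient.mk _ a

/-- One step along the boundary of the region to the left of a dart. -/
def facePerm : Equiv.Perm D := G.next⁻¹ * G.rev

/-- Plaquettes are the orbits of `facePerm`; the orbit runs counterclockwise around the plaquette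
and consists of its sides, so an edge with the same plaquette on both sides gives two of them. -/
abbrev Face : Type _ := Quotient (Equiv.Perm.SameCycle.setoid G.facePerm)

/-- The plaquette to the left of a dart. It contains the corner between `a` and `next a`. -/
def face (a : D) : G.Face := Quotient.mk _ a

section Model

variable {L : Type*} [Fintype L] (M : StringNetData L)

/-- String-net configurations: `x a` is the type of the string along the edge of `a`, read in the
direction of `a`. Choosing a direction for every edge identifies them with the labelings of the
edges, and they index the standard basis of the Hilbert space `⨂ₑ ℂ^(N+1)`. Operators are given by
their matrices in this orthonormal basis. -/
def Config : Type _ := {x : D → L // ∀ a, x (G.rev a) = M.star (x a)}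

noncomputable instance [Fintype D] : Fintype (G.Config M) :=
  haveI : Finite (G.Config M) := inferInstanceAs (Finite {_x : D → L // _})
  Fintype.ofFinite _

noncomputable instance [Fintype D] : Fintype G.Vertex := Fintype.ofFinite _

noncomputable instance [Fintype D] : Fintype G.Face := Fintype.ofFinite _

open scoped Classical in
/-- The vertex projection `Q_w`: the types that arrive at `w` form an allowed triple. -/
noncomputable def vertexOp (w : G.Vertex) : Matrix (G.Config M) (G.Config M) ℂ :=
  Matrix.diagonal fun x =>
    if ∀ a, G.vertex a = w →
      M.allowed (x.1 (G.rev a)) (x.1 (G.rev (G.next a))) (x.1 (G.rev (G.next (G.next a))))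
    then 1 else 0

end Model

/-- An order in which a loop drawn along the boundary of a plaquette is fused into the edges: for
each edge it tells which of its two sides is treated first (this matters only where both sides
belong to the plaquette). At no vertex all three, or none, of the outgoing darts are first, that
is, the directed edges have neither a source nor a sink; hence the corners at a vertex are not
ordered cyclically. -/
structure FusionOrder where
  first : D → Bool
  first_rev : ∀ a, first (G.rev a) = !first a
  mixed : ∀ a, ¬ (first a = first (G.next a) ∧ first (G.next a) = first (G.next (G.next a)))

/-- Two fixed-point-free involutions of a finite set admit a two-coloring that both reverse. -/
theorem exists_coloring {X : Type*} [Finite X] (f g : Equiv.Perm X)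
    (hf : ∀ x, f (f x) = x) (hg : ∀ x, g (g x) = x) (hf' : ∀ x, f x ≠ x) (hg' : ∀ x, g x ≠ x) :
    ∃ c : X → Bool, (∀ x, c (f x) = !c x) ∧ ∀ x, c (g x) = !c x := by
  classical
  set π : Equiv.Perm X := g * f with hπ
  have ff : f * f = 1 := by ext x; simp [hf]
  have gg : g * g = 1 := by ext x; simp [hg]
  have fi : f⁻¹ = f := by rw [inv_eq_iff_mul_eq_one, ff]
  have gi : g⁻¹ = g := by rw [inv_eq_iff_mul_eq_one, gg]
  have conj : f * π * f⁻¹ = π⁻¹ := by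
    rw [hπ, mul_inv_rev, gi, fi, mul_assoc, mul_assoc, ff, mul_one]
  have conjz : ∀ n : ℤ, f * π ^ n * f⁻¹ = π ^ (-n) := fun n => by
    rw [← conj_zpow, conj, inv_zpow, zpow_neg]
  have conjx : ∀ (n : ℤ) x, f ((π ^ n) x) = (π ^ (-n)) (f x) := fun n x => by
    rw [← conjz]; simp
  have key : ∀ x, ¬ π.SameCycle x (f x) := by
    rintro x ⟨n, hn⟩
    rcases Int.even_or_odd' n with ⟨m, rfl | rfl⟩
    · apply hf' ((π ^ m) x)
      rw [conjx, ← hn, ← Equiv.Perm.mul_apply, ← zpow_add]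
      congr 2; ring
    · apply hg' (f ((π ^ m) x))
      have h1 : f ((π ^ m) x) = (π ^ (m + 1)) x := by
        rw [conjx, ← hn, ← Equiv.Perm.mul_apply, ← zpow_add]
        congr 2; ring
      calc g (f ((π ^ m) x)) = (π ^ (1 + m)) x := by rw [zpow_add]; simp [hπ]
        _ = f ((π ^ m) x) := by rw [h1, add_comm]
  let Y := Quotient (Equiv.Perm.SameCycle.setoid π)
  have hmap : ∀ a b, π.SameCycle a b → π.SameCycle (f a) (f b) := by
    rintro a b ⟨n, rfl⟩
    exact ⟨-n, (conjx n a).symm⟩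
  let fbar : Y → Y := Quotient.map f hmap
  have hbar : ∀ x, fbar (Quotient.mk _ x) = Quotient.mk _ (f x) := fun x => rfl
  obtain ⟨r, hr⟩ : ∃ r : LinearOrder Y, True := ⟨linearOrderOfSTO WellOrderingRel, trivial⟩
  have hcf : ∀ x, decide (r.lt (Quotient.mk _ (f x)) (Quotient.mk _ (f (f x)))) =
      !decide (r.lt (Quotient.mk _ x : Y) (Quotient.mk _ (f x))) := by
    intro x
    have hne : (Quotient.mk _ x : Y) ≠ Quotient.mk _ (f x) := fun h => key x (Quotient.exact h)
    rw [hf]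
    rcases lt_trichotomy (Quotient.mk _ x : Y) (Quotient.mk _ (f x)) with h | h | h
    · have h' := lt_asymm h
      change r.lt _ _ at h
      change ¬ r.lt _ _ at h'
      simp [h, h']
    · exact absurd h hne
    · have h' := lt_asymm h
      change r.lt _ _ at h
      change ¬ r.lt _ _ at h'
      simp [h, h']
  refine ⟨fun x => decide (r.lt (Quotient.mk _ x : Y) (Quotient.mk _ (f x))), hcf, fun x => ?_⟩
  have h1 : (Quotient.mk _ (g x) : Y) = Quotient.mk _ (f x) := by
    refine Quotient.sound (Equiv.Perm.SameCycle.symm ⟨1, ?_⟩)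
    simp [hπ, hf]
  have h2 : (Quotient.mk _ (f (g x)) : Y) = Quotient.mk _ (f (f x)) := by
    rw [← hbar, ← hbar, h1]
  change decide (r.lt _ _) = _
  rw [h1, h2]
  exact hcf x

theorem eq_of_vertex_eq {a b : D} (h : G.vertex a = G.vertex b) :
    b = a ∨ b = G.next a ∨ b = G.next (G.next a) := by
  obtain ⟨n, rfl⟩ : G.next.SameCycle a b := Quotient.exact h
  have h3 : G.next ^ (3 : ℤ) = 1 := by
    ext x
    have : G.next ^ (3 : ℤ) = G.next * G.next * G.next := by
      rw [show (3 : ℤ) = 1 + 1 + 1 by norm_num, zpow_add, zpow_add, zpow_one]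
    rw [this]
    exact G.next_next_next x
  have hn : (G.next ^ n) = G.next ^ (n % 3) := by
    conv_lhs => rw [← Int.emod_add_mul_ediv n 3, zpow_add, zpow_mul, h3, one_zpow, mul_one]
  rw [hn]
  have h0 := Int.emod_nonneg n (show (3 : ℤ) ≠ 0 by norm_num)
  have h1 := Int.emod_lt_of_pos n (show (0 : ℤ) < 3 by norm_num)
  interval_cases h : n % 3
  · left; simp
  · right; left; simp
  · right; right
    rw [show (2 : ℤ) = 1 + 1 by norm_num, zpow_add, zpow_one]; rfl

theorem vertex_next (a : D) : G.vertex (G.next a) = G.vertex a :=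
  Quotient.sound (Equiv.Perm.SameCycle.symm ⟨1, by simp⟩)

/-- Every finite trivalent graph has an admissible order. -/
theorem nonempty_fusionOrder [Finite D] : Nonempty G.FusionOrder := by
  classical
  let r : D → D := fun a => (G.vertex a).out
  have hrv : ∀ a, G.vertex (r a) = G.vertex a := fun a => Quotient.out_eq _
  have hrn : ∀ a, r (G.next a) = r a := fun a => by simp only [r, G.vertex_next]
  have hr3 : ∀ a, a = r a ∨ a = G.next (r a) ∨ a = G.next (G.next (r a)) := fun a =>
    G.eq_of_vertex_eq (hrv a)
  have hrr : ∀ a, r (r a) = r a := fun a => by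
    change (G.vertex (r a)).out = _
    rw [hrv]
  have n2 : ∀ a, G.next (G.next a) ≠ a := fun a h => by
    have h3 := G.next_next_next a
    rw [h] at h3
    exact G.next_ne a h3
  have n3 : ∀ a, G.next (G.next a) ≠ G.next a := fun a => G.next_ne _
  let mu : D × Bool → D × Bool := fun p =>
    if p.1 = r p.1 then (p.1, !p.2)
    else if p.1 = G.next (r p.1) then (G.next p.1, p.2) else (G.next (G.next p.1), p.2)
  have mu0 : ∀ a s, mu (r a, s) = (r a, !s) := fun a s => by simp [mu, hrr]
  have mu1 : ∀ a s, mu (G.next (r a), s) = (G.next (G.next (r a)), s) := fun a s => by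
    simp [mu, hrr, hrn, G.next_ne]
  have mu2 : ∀ a s, mu (G.next (G.next (r a)), s) = (G.next (r a), s) := fun a s => by
    simp [mu, hrr, hrn, G.next_ne, n2, G.next_next_next]
  have hmu : ∀ p, mu (mu p) = p := by
    rintro ⟨a, s⟩
    rcases hr3 a with h | h | h <;> rw [h] <;> simp [mu0, mu1, mu2]
  have hmu' : ∀ p, mu p ≠ p := by
    rintro ⟨a, s⟩
    rcases hr3 a with h | h | h <;> rw [h]
    · simp [mu0]
    · simp [mu1, G.next_ne]
    · rw [mu2]
      intro h
      exact n3 _ (Prod.ext_iff.1 h).1.symm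
  obtain ⟨c, hc1, hc2⟩ := exists_coloring
    (Function.Involutive.toPerm (fun p : D × Bool => (G.rev p.1, p.2))
      (fun p => Prod.ext (G.rev_rev p.1) rfl))
    (Function.Involutive.toPerm mu hmu) (fun p => Prod.ext (G.rev_rev p.1) rfl) hmu
    (fun p h => G.rev_ne p.1 (Prod.ext_iff.1 h).1) hmu'
  refine ⟨⟨fun a => c (a, true), fun a => hc1 (a, true), fun a h => ?_⟩⟩
  have h2 : c (G.next (r a), true) = !c (G.next (G.next (r a)), true) := by
    rw [← mu2]; exact hc2 _
  rcases hr3 a with e | e | e <;> rw [e] at h <;> (try simp only [G.next_next_next] at h) <;>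
    grind

section Operators

variable {L : Type*} [Fintype L] {M : StringNetData L} {G}

/-- The labels before the loop is fused into the side `s`, when `x` are the labels before anything
is fused, `y` those after the first side of each edge, and `z` those after both sides. -/
def FusionOrder.before (o : G.FusionOrder) (x y : G.Config M) (s : D) : G.Config M :=
  if o.first s then x else y

/-- The labels after the loop is fused into the side `s`. -/
def FusionOrder.after (o : G.FusionOrder) (y z : G.Config M) (s : D) : G.Config M :=
  if o.first s then y else z

/-- The labels of the third leg at the corner between `a` and `next a` when this corner is
resolved. Both other corners at the vertex come later in the first case and earlier in the second;
in the remaining cases one comes earlier and one later. -/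
def FusionOrder.leg (o : G.FusionOrder) (x y z : G.Config M) (a : D) : G.Config M :=
  match o.first a, o.first (G.next a) with
  | true, false => x
  | false, true => z
  | _, _ => y

/-- The factor `F^{abc}_{i* c' b'}` for a corner, between the darts `s` and `next s`, at which a
loop of type `i` arrives along `rev (next s)` and leaves along `s`. All of `a`, `b`, `c`, `b'`, `c'`
are read into the vertex: `a` on the third leg, `b`, `b'` on `s` and `c`, `c'` on `next s` before
and after the fusion. -/
def FusionOrder.cornerFactor (o : G.FusionOrder) (i : L) (x y z : G.Config M) (s : D) : ℂ :=
  let inB := G.rev s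
  let inC := G.rev (G.next s)
  let inA := G.rev (G.next (G.next s))
  M.F ((o.leg x y z s).1 inA) ((o.before x y s).1 inB) ((o.before x y inC).1 inC)
    (M.star i) ((o.after y z inC).1 inC) ((o.after y z s).1 inB)

open scoped Classical in
/-- The operator `B_q^i`: a counterclockwise loop of type `i` is added around the puncture of the
plaquette `q` and reduced to the standard basis by the local rules. It is fused into the sides of
`q` one after another, and then the triangles at the corners are removed, which gives one factor
for each corner of `q`; nothing happens at sides of other plaquettes. If no edge has `q` on both
sides, `y` is determined by `x` and `z`, and this is the usual product formula. -/
noncomputable def FusionOrder.loopOp [Fintype D] (o : G.FusionOrder) (M : StringNetData L)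
    (q : G.Face) (i : L) : Matrix (G.Config M) (G.Config M) ℂ :=
  fun z x => ∑ y : G.Config M,
    if ∀ s, G.face s ≠ q → (o.before x y s).1 s = (o.after y z s).1 s then
      ∏ s ∈ Finset.univ.filter (fun s => G.face s = q), o.cornerFactor i x y z s
    else 0

/-- The plaquette operator `B_q = ∑ᵢ dᵢ B_q^i / ∑ᵢ dᵢ²`. -/
noncomputable def FusionOrder.plaquetteOp [Fintype D] (o : G.FusionOrder) (M : StringNetData L)
    (q : G.Face) : Matrix (G.Config M) (G.Config M) ℂ :=
  (∑ i, M.d i ^ 2)⁻¹ • ∑ i, M.d i • o.loopOp M q i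

/-- The Hamiltonian `H_G = - ∑ Q_w - ∑ B_q`. -/
noncomputable def FusionOrder.hamiltonian [Fintype D] (o : G.FusionOrder) (M : StringNetData L) :
    Matrix (G.Config M) (G.Config M) ℂ :=
  - ∑ w, G.vertexOp M w - ∑ q, o.plaquetteOp M q

end Operators

/-- A tadpole: the edge `e₁` is the self-loop `loop`, whose left side is the whole boundary of a
plaquette `p`; it is attached by the edge `e₂` (`stem`) to a vertex `v`, at which `e₂` meets two
further edges `e₃` and `e₄`, distinct from each other. -/
structure Tadpole where
  loop : D
  facePerm_loop : G.facePerm loop = loop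
  rev_left_ne_right :
    G.rev (G.next (G.rev (G.next (G.rev loop)))) ≠
      G.next (G.next (G.rev (G.next (G.rev loop))))

namespace Tadpole

variable {G} (T : G.Tadpole)

/-- The dart of `e₂` that leaves the vertex of the self-loop. -/
def stem : D := G.next (G.rev T.loop)

/-- The dart of `e₂` that leaves `v`. -/
def foot : D := G.rev T.stem

/-- The dart of `e₃` that leaves `v`. -/
def left : D := G.next T.foot

/-- The dart of `e₄` that leaves `v`. -/
def right : D := G.next T.left

/-- The darts that remain when the tadpole is removed: all except those at its two vertices. -/
def Survives (a : D) : Prop := G.vertex a ≠ G.vertex T.loop ∧ G.vertex a ≠ G.vertex T.foot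

theorem next_loop : G.next T.loop = G.rev T.loop := by
  have h := T.facePerm_loop
  rw [facePerm, Equiv.Perm.mul_apply, Equiv.Perm.inv_eq_iff_eq] at h
  exact h.symm

theorem eq_of_vertex_loop {a : D} (h : G.vertex a = G.vertex T.loop) :
    a = T.loop ∨ a = G.rev T.loop ∨ a = T.stem := by
  have := G.eq_of_vertex_eq h.symm
  rwa [T.next_loop] at this

theorem eq_of_vertex_foot {a : D} (h : G.vertex a = G.vertex T.foot) :
    a = T.foot ∨ a = T.left ∨ a = T.right :=
  G.eq_of_vertex_eq h.symm

theorem vertex_rev_loop : G.vertex (G.rev T.loop) = G.vertex T.loop := by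
  rw [← T.next_loop, G.vertex_next]

theorem vertex_stem : G.vertex T.stem = G.vertex T.loop := by
  rw [stem, G.vertex_next, T.vertex_rev_loop]

theorem vertex_left : G.vertex T.left = G.vertex T.foot := G.vertex_next _

theorem vertex_right : G.vertex T.right = G.vertex T.foot := by
  rw [right, G.vertex_next, T.vertex_left]

theorem vertex_foot_ne : G.vertex T.foot ≠ G.vertex T.loop := by
  intro h
  have hs : ∀ b, T.foot = b → T.stem = G.rev b := fun b hb => by
    rw [← hb, foot, G.rev_rev]
  rcases T.eq_of_vertex_loop h with h | h | h
  · exact G.next_ne _ (hs _ h)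
  · have h1 := hs _ h
    rw [G.rev_rev] at h1
    have h2 := congrArg G.next h1
    rw [stem, ← T.next_loop, G.next_next_next] at h2
    exact G.next_ne _ h2.symm
  · exact G.rev_ne _ h

theorem survives_next {a : D} : T.Survives (G.next a) ↔ T.Survives a := by
  rw [Survives, Survives, G.vertex_next]

theorem survives_rev {a : D} (h : T.Survives a) (h3 : a ≠ G.rev T.left)
    (h4 : a ≠ G.rev T.right) : T.Survives (G.rev a) := by
  have hs : ∀ b, G.rev a = b → a = G.rev b := fun b hb => by rw [← hb, G.rev_rev]
  refine ⟨fun e => ?_, fun e => ?_⟩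
  · rcases T.eq_of_vertex_loop e with e | e | e
    · exact h.1 (by rw [hs _ e, T.vertex_rev_loop])
    · exact h.1 (by rw [hs _ e, G.rev_rev])
    · exact h.2 (by rw [hs _ e]; rfl)
  · rcases T.eq_of_vertex_foot e with e | e | e
    · exact h.1 (by rw [hs _ e, foot, G.rev_rev, T.vertex_stem])
    · exact h3 (hs _ e)
    · exact h4 (hs _ e)

theorem survives_rev_aux {a : D} (ha : G.vertex a = G.vertex T.foot) (hf : a ≠ T.foot)
    (hl : G.rev a ≠ T.left) (hr : G.rev a ≠ T.right) : T.Survives (G.rev a) := by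
  have hs : ∀ b, G.rev a = b → a = G.rev b := fun b hb => by rw [← hb, G.rev_rev]
  refine ⟨fun e => ?_, fun e => ?_⟩
  · rcases T.eq_of_vertex_loop e with e | e | e
    · exact T.vertex_foot_ne (by rw [← ha, hs _ e, T.vertex_rev_loop])
    · exact T.vertex_foot_ne (by rw [← ha, hs _ e, G.rev_rev])
    · exact hf (hs _ e)
  · rcases T.eq_of_vertex_foot e with e | e | e
    · exact T.vertex_foot_ne (by rw [← ha, hs _ e, foot, G.rev_rev, T.vertex_stem])
    · exact hl e
    · exact hr e

theorem survives_rev_left : T.Survives (G.rev T.left) :=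
  T.survives_rev_aux T.vertex_left (G.next_ne _) (G.rev_ne _) T.rev_left_ne_right

theorem survives_rev_right : T.Survives (G.rev T.right) := by
  refine T.survives_rev_aux T.vertex_right (fun h => ?_) (fun h => ?_) (G.rev_ne _)
  · have h1 := congrArg G.next h
    rw [right, left, G.next_next_next] at h1
    exact G.next_ne _ h1.symm
  · exact T.rev_left_ne_right (by
      change G.rev T.left = T.right
      rw [← h, G.rev_rev])

open scoped Classical in
/-- Reversal after the removal: the outer ends of `e₃` and `e₄` form the new edge `e'`. -/
noncomputable def revFun (a : {a : D // T.Survives a}) : {a : D // T.Survives a} :=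
  if h3 : a.1 = G.rev T.left then ⟨G.rev T.right, T.survives_rev_right⟩
  else if h4 : a.1 = G.rev T.right then ⟨G.rev T.left, T.survives_rev_left⟩
  else ⟨G.rev a.1, T.survives_rev a.2 h3 h4⟩

theorem rev_left_ne_rev_right : G.rev T.left ≠ G.rev T.right := fun h =>
  G.next_ne _ (G.rev.injective h).symm

theorem revFun_revFun : Function.Involutive T.revFun := by
  intro a
  have hne := T.rev_left_ne_rev_right
  by_cases h3 : a.1 = G.rev T.left
  · apply Subtype.ext
    simp [revFun, h3, hne.symm]
  · by_cases h4 : a.1 = G.rev T.right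
    · apply Subtype.ext
      simp [revFun, h4, hne.symm]
    · have h5 : G.rev a.1 ≠ G.rev T.left := fun h =>
        a.2.2 (by rw [G.rev.injective h, T.vertex_left])
      have h6 : G.rev a.1 ≠ G.rev T.right := fun h =>
        a.2.2 (by rw [G.rev.injective h, T.vertex_right])
      apply Subtype.ext
      simp [revFun, h3, h4, h5, h6, G.rev_rev]

/-- The graph `G'`: the tadpole is deleted and `e₃`, `e₄` are replaced by a single edge `e'`. -/
noncomputable def removed : TrivalentMap {a : D // T.Survives a} where
  rev := T.revFun_revFun.toPerm
  next := G.next.subtypePerm fun _ => T.survives_next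
  rev_rev := T.revFun_revFun
  rev_ne a := by
    have hne := T.rev_left_ne_rev_right
    change T.revFun a ≠ a
    intro h
    have h := congrArg Subtype.val h
    unfold revFun at h
    split_ifs at h with h3 h4
    · exact hne (h3 ▸ h.symm)
    · exact hne (h4 ▸ h)
    · exact G.rev_ne _ h
  next_next_next a := Subtype.ext (G.next_next_next a.1)
  next_ne a h := G.next_ne a.1 (congrArg Subtype.val h)

noncomputable instance [Fintype D] : Fintype {a : D // T.Survives a} := Fintype.ofFinite _

/-- The dart of `e'` that takes the place of `e₃` directed into `v` followed by `e₄` directed out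
of `v`. -/
def newDart : {a : D // T.Survives a} := ⟨G.rev T.left, T.survives_rev_left⟩

/-- The plaquette around which the tadpole loops. -/
def head : G.Face := G.face T.loop

/-- The plaquette in which the tadpole lies. -/
def outer : G.Face := G.face (G.rev T.loop)

/-- The plaquette of `G'` that `outer` becomes when the tadpole is removed. -/
noncomputable def outerRemoved : T.removed.Face := T.removed.face T.newDart

section Operators

variable {L : Type*} [Fintype L] (M : StringNetData L)

/-- `x` has no string on `e₂` and the same string through `e₃` and `e₄`, that through `e'` in the
configuration `x'` of `G'`, and `x` and `x'` agree on all other edges outside the tadpole. -/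
def Matches (x' : T.removed.Config M) (x : G.Config M) : Prop :=
  x.1 T.stem = M.zero ∧ x.1 (G.rev T.left) = x.1 T.right ∧ ∀ a, x'.1 a = x.1 a.1

open scoped Classical in
/-- The operator `Z_p = ⟨Φ|_{e₁} ⊗ ⟨0|_{e₂} ⊗ (∑ᵢ |i⟩_{e'} ⟨ii|_{e₃e₄}) ⊗ id`. -/
noncomputable def Z : Matrix (T.removed.Config M) (G.Config M) ℂ :=
  fun x' x => if T.Matches M x' x then starRingEnd ℂ (M.Phi (x.1 T.loop)) else 0

open scoped Classical in
/-- The operator `|Φ⟩⟨Φ|_{e₁} ⊗ |0⟩⟨0|_{e₂} ⊗ id`. -/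
noncomputable def projector : Matrix (G.Config M) (G.Config M) ℂ :=
  fun z x =>
    if z.1 T.stem = M.zero ∧ x.1 T.stem = M.zero ∧
        ∀ a, a ≠ T.loop → a ≠ G.rev T.loop → a ≠ T.stem → a ≠ T.foot → z.1 a = x.1 a then
      M.Phi (z.1 T.loop) * starRingEnd ℂ (M.Phi (x.1 T.loop))
    else 0

end Operators

end Tadpole

end TrivalentMap

/-- A ground state of `H`: an eigenvector for the least (real) eigenvalue. -/
def IsGroundState {X : Type*} [Fintype X] (H : Matrix X X ℂ) (ψ : X → ℂ) : Prop :=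
  ∃ E : ℝ, H *ᵥ ψ = (E : ℂ) • ψ ∧ ψ ≠ 0 ∧
    ∀ (E' : ℝ) (φ : X → ℂ), φ ≠ 0 → H *ᵥ φ = (E' : ℂ) • φ → E ≤ E'

/-! The sum of loops of all types, weighted by `d`, in the head of a tadpole forces the stem to be
empty: this is orthogonality of the `6j`-symbols (`sum_d_mul_F`) and gives the formula for `B_p`.
With an empty stem, the branching rule at `v` says that `e₃` and `e₄` carry the same string. Hence
`Z† Z = Q_v B_p` and `Z Z† = 1` (`conjTranspose_mul_Z`, `Z_mul_conjTranspose`).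

A loop in the outer plaquette runs along the tadpole and back. Between states with empty stem, the
corners at the two vertices of the tadpole contribute only `1 / d k` on allowed triples, where `k`
is the type of the loop that passes them (`multiLoop_extend`). Averaging over `Φ` turns this into
`1`, because `d` is a character of the fusion rules (`sum_d_allowed`). So `Z B Z† = B'` for each
plaquette of `G'`. As `B` and `B'` are orthogonal projections and `Z Z† = 1`, this compression
identity improves to `B Z† = Z† B'` (`plaquetteOp_mul_Z`), and the second claim follows on
multiplication by `Z`.

For the third claim the ground states must be the common fixed vectors of all `Q_w` and `B_q`
(`isGroundState_hamiltonian_iff`), which needs one nonzero common fixed vector. Weighted loops in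
all plaquettes, applied to the vacuum, give it; its vacuum component is positive. Since `d` may take
negative values, positivity uses that the Euler characteristic of a closed oriented surface is even.
A ground state `ψ` then satisfies `ψ = Q_v B_p ψ = Z† (Z ψ)`, and `Z ψ` is fixed by all projections
of `G'`.

The bulk of the work shows that `B_q` is an orthogonal projection independent of the order of
fusion, although a plaquette may lie on both sides of an edge. The loop operators are generalized to
loops in all plaquettes at once (`multiLoop`) and written as products over corners. The pentagon
exchanges successive corners at a vertex at the cost of a change of basis of one label per dart. The
changes at the two ends of an edge are inverse to each other by orthogonality, so they disappear in
the sum over edge labels (`sum_config_gauge`). This mechanism gives independence of the order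
(`multiLoop_order`) as well as the fusion of two operators (`multiLoop_mul`). -/

namespace StringNetData

variable {L : Type*} [Fintype L] (M : StringNetData L)

-- Consequences of the axioms: quantum dimensions, `6j`-symbols, recoupling coefficients.

attribute [simp] star_star star_zero v_star

theorem star_injective : Function.Injective M.star := fun i j h => by
  rw [← M.star_star i, h, M.star_star]

theorem star_eq_iff {i j : L} : M.star i = j ↔ i = M.star j :=
  ⟨fun h => by rw [← h, M.star_star], fun h => by rw [h, M.star_star]⟩

@[simp] theorem star_inj {i j : L} : M.star i = M.star j ↔ i = j := M.star_injective.eq_iff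

@[simp] theorem star_eq_zero {i : L} : M.star i = M.zero ↔ i = M.zero := by
  rw [star_eq_iff, M.star_zero]

theorem allowed_swap_iff {i j k : L} : M.allowed i j k ↔ M.allowed j i k :=
  ⟨M.allowed_swap _ _ _, M.allowed_swap _ _ _⟩

theorem allowed_rotate_iff {i j k : L} : M.allowed i j k ↔ M.allowed j k i :=
  ⟨M.allowed_rotate _ _ _, fun h => M.allowed_rotate _ _ _ (M.allowed_rotate _ _ _ h)⟩

theorem allowed_zero_right {i j : L} : M.allowed i j M.zero ↔ j = M.star i := by
  rw [← M.star_star j, M.allowed_zero, star_inj]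
  exact eq_comm

theorem allowed_zero_left {i j : L} : M.allowed M.zero i j ↔ j = M.star i := by
  rw [allowed_rotate_iff, allowed_zero_right]

theorem allowed_zero_mid {i j : L} : M.allowed i M.zero j ↔ j = M.star i := by
  rw [allowed_swap_iff, allowed_zero_left]

theorem v_ne_zero (i : L) : M.v i ≠ 0 := fun h => by
  have := M.v_sq i
  rw [h] at this
  exact inv_ne_zero (M.F_ne_zero i) (by rw [← this]; norm_num)

theorem d_eq (i : L) : M.d i = M.v i ^ 2 := (M.v_sq i).symm

theorem d_ne_zero (i : L) : M.d i ≠ 0 := inv_ne_zero (M.F_ne_zero i)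

@[simp] theorem d_star (i : L) : M.d (M.star i) = M.d i := by simp [d_eq]

-- Normalization gives `1 / v 0` for the symbol with all labels zero, whose inverse is `v 0 ^ 2`;
-- hence `v 0 ^ 2 = v 0`.
@[simp] theorem v_zero : M.v M.zero = 1 := by
  have h1 := M.normalization_of_allowed M.zero M.zero M.zero (by simp [allowed_zero_right])
  have h2 := M.v_sq M.zero
  simp only [M.star_zero] at h1 h2
  rw [h1] at h2
  have h3 := M.v_ne_zero M.zero
  field_simp at h2
  exact h2

@[simp] theorem d_zero : M.d M.zero = 1 := by simp [d_eq]

/-- Unitarity reverses all labels and the first tetrahedral symmetry undoes this. So `d i` is real,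
but it may be negative. -/
theorem conj_d (i : L) : starRingEnd ℂ (M.d i) = M.d i := by
  rw [d, map_inv₀, M.unitarity]
  congr 1
  have := M.tetrahedral_one i (M.star i) M.zero i (M.star i) M.zero
  simpa using this.symm

theorem exists_real_d (i : L) : ∃ r : ℝ, r ≠ 0 ∧ M.d i = r := by
  obtain ⟨r, hr⟩ := Complex.conj_eq_iff_real.1 (M.conj_d i)
  exact ⟨r, fun h => M.d_ne_zero i (by rw [hr, h, Complex.ofReal_zero]), hr⟩

/-- The square of the total quantum dimension. -/
noncomputable def totalDim : ℂ := ∑ i, M.d i ^ 2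

theorem exists_real_totalDim : ∃ r : ℝ, 0 < r ∧ M.totalDim = r := by
  choose r hr h using M.exists_real_d
  refine ⟨∑ i, r i ^ 2, ?_, by simp [totalDim, h]⟩
  exact Finset.sum_pos (fun i _ => by have := hr i; positivity) ⟨M.zero, Finset.mem_univ _⟩

theorem totalDim_ne_zero : M.totalDim ≠ 0 := by
  obtain ⟨r, hr, h⟩ := M.exists_real_totalDim
  rw [h]
  exact_mod_cast hr.ne'

theorem conj_totalDim : starRingEnd ℂ M.totalDim = M.totalDim := by
  simp [totalDim, conj_d]

/-- The `6j`-symbol with full tetrahedral symmetry. -/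
noncomputable def sixj (i j m k l n : L) : ℂ := M.F i j m k l n / (M.v m * M.v n)

theorem F_eq (i j m k l n : L) : M.F i j m k l n = M.sixj i j m k l n * (M.v m * M.v n) := by
  have := M.v_ne_zero
  rw [sixj, div_mul_cancel₀]
  exact mul_ne_zero (this _) (this _)

theorem sixj_one (i j m k l n : L) : M.sixj i j m k l n = M.sixj j i m l k (M.star n) := by
  rw [sixj, sixj, M.tetrahedral_one, v_star]

theorem sixj_two (i j m k l n : L) : M.sixj i j m k l n = M.sixj l k (M.star m) j i n := by
  rw [sixj, sixj, M.tetrahedral_two, v_star]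

theorem sixj_three (i j m k l n : L) : M.sixj i j m k l n = M.sixj i m j (M.star k) n l := by
  have := M.v_ne_zero
  rw [sixj, sixj, M.tetrahedral_three]
  field_simp [this j, this l, this m, this n]

theorem sixj_ne_zero {i j m k l n : L} (h : M.sixj i j m k l n ≠ 0) :
    (M.allowed i j m ∧ M.allowed k l (M.star m)) ∧
      (M.allowed i l n ∧ M.allowed j k (M.star n)) :=
  M.physicality _ _ _ _ _ _ fun h' => h (by rw [sixj, h', zero_div])

/-- The summation label contributes `v n` twice on the left, which gives the weight `d n`; the
remaining factors `v` agree on both sides. -/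
theorem sixj_pentagon (i j k l m p q r s : L) :
    ∑ n, M.d n * (M.sixj m l q k p n * M.sixj j i (M.star p) m n s * M.sixj j s n l k r)
      = M.sixj j i (M.star p) (M.star q) k r * M.sixj (M.star r) i (M.star q) m l s := by
  have h := M.pentagon i j k l m p q r s
  have hv := M.v_ne_zero
  simp only [F_eq, v_star] at h
  have hc : M.v q * M.v p * M.v s * M.v r ≠ 0 := by simp [hv]
  apply mul_right_cancel₀ hc
  rw [Finset.sum_mul]
  refine Eq.trans (Finset.sum_congr rfl fun n _ => ?_) (h.trans ?_)
  · rw [d_eq]; ring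
  · ring

open scoped Classical in
-- This is the normalization axiom; the tetrahedral symmetries then carry the zero to the five other
-- positions.
theorem sixj_zero₃ (i j k l n : L) : M.sixj i j M.zero k l n =
    if j = M.star i ∧ k = M.star l ∧ M.allowed i l n then (M.v i * M.v l)⁻¹ else 0 := by
  by_cases h1 : j = M.star i
  · by_cases h2 : k = M.star l
    · subst h1 h2
      by_cases h3 : M.allowed i l n
      · rw [sixj, M.normalization_of_allowed _ _ _ h3]
        have := M.v_ne_zero
        simp only [h3, and_self, if_true, v_zero]
        field_simp [this n, this i, this l]
      · rw [sixj, M.normalization_of_not_allowed _ _ _ h3]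
        simp [h3]
    · simp only [h2, false_and, and_false, if_false]
      by_contra h
      have h3 := (M.sixj_ne_zero h).1.2
      rw [M.star_zero, allowed_zero_right] at h3
      exact h2 (by rw [h3, M.star_star])
  · simp only [h1, false_and, if_false]
    by_contra h
    exact h1 (M.allowed_zero_right.1 (M.sixj_ne_zero h).1.1)

open scoped Classical in
theorem sixj_zero₂ (i m k l n : L) : M.sixj i M.zero m k l n =
    if m = M.star i ∧ k = n ∧ M.allowed i n l then (M.v i * M.v n)⁻¹ else 0 := by
  rw [sixj_three, sixj_zero₃, star_inj]

open scoped Classical in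
theorem sixj_zero₁ (j m k l n : L) : M.sixj M.zero j m k l n =
    if m = M.star j ∧ l = M.star n ∧ M.allowed j l k then (M.v j * M.v n)⁻¹ else 0 := by
  rw [sixj_one, sixj_zero₂, v_star]
  congr 1
  exact propext (and_congr_right fun _ => and_congr_right fun h => by rw [h])

open scoped Classical in
theorem sixj_zero₅ (i j m k n : L) : M.sixj i j m k M.zero n =
    if m = k ∧ i = M.star n ∧ M.allowed k i j then (M.v k * M.v n)⁻¹ else 0 := by
  rw [sixj_two, sixj_zero₁, star_inj]

open scoped Classical in
theorem sixj_zero₆ (i j m k l : L) : M.sixj i j m k l M.zero =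
    if j = M.star k ∧ i = M.star l ∧ M.allowed j i m then (M.v k * M.v l)⁻¹ else 0 := by
  rw [sixj_three, sixj_zero₅, v_star]
  congr 1
  exact propext (and_congr_right fun h => by rw [h])

open scoped Classical in
theorem sixj_zero₄ (i j m l n : L) : M.sixj i j m M.zero l n =
    if m = l ∧ j = n ∧ M.allowed l j i then (M.v l * M.v n)⁻¹ else 0 := by
  rw [sixj_one, sixj_zero₅, v_star, M.star_star]

theorem allowed_reverse_iff {i j k : L} : M.allowed i j k ↔ M.allowed k j i := by
  rw [allowed_swap_iff, allowed_rotate_iff, allowed_rotate_iff]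
  
/-- The branching rule is not assumed to be invariant under reversal. If the reversed triple were
forbidden, normalization would make one `F` zero and its conjugate nonzero. -/
theorem allowed_star_aux {i j k : L} (h : M.allowed i j k) :
    M.allowed (M.star i) (M.star j) (M.star k) := by
  by_contra h'
  have h1 := M.normalization_of_not_allowed _ _ _ h'
  have h2 := M.unitarity i (M.star i) M.zero (M.star j) j k
  rw [M.star_zero, h1, M.normalization_of_allowed _ _ _ h] at h2
  have hv := M.v_ne_zero
  simp [hv] at h2

@[simp] theorem allowed_star_iff {i j k : L} :
    M.allowed (M.star i) (M.star j) (M.star k) ↔ M.allowed i j k :=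
  ⟨fun h => by simpa using M.allowed_star_aux h, M.allowed_star_aux⟩

open scoped Classical in
-- This is the pentagon with `r = 0`: the third symbol on the left and both symbols on the right are
-- then given by normalization.
theorem sixj_orthogonality (i j m p q s : L) :
    ∑ n, M.d n * (M.sixj m (M.star s) q (M.star j) p n * M.sixj j i (M.star p) m n s) =
      if q = i ∧ M.allowed j i (M.star p) ∧ M.allowed m (M.star s) i then (M.d i)⁻¹ else 0 := by
  have h := M.sixj_pentagon i j (M.star j) (M.star s) m p q M.zero s
  have hv := M.v_ne_zero
  simp only [sixj_zero₆, M.star_zero, sixj_zero₁, M.star_star] at h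
  have hc : (M.v j * M.v s)⁻¹ ≠ 0 := by simp [hv]
  apply mul_right_cancel₀ hc
  rw [Finset.sum_mul]
  refine Eq.trans (Finset.sum_congr rfl fun n _ => ?_) (h.trans ?_)
  · by_cases h0 : M.sixj j i (M.star p) m n s = 0
    · simp [h0]
    · have h1 := (M.sixj_ne_zero h0).2.1
      have h2 : M.allowed s j n := by
        rwa [allowed_rotate_iff]
      simp [h2]
      ring
  · rw [M.allowed_swap_iff (i := i) (j := j), M.allowed_reverse_iff (i := i) (j := M.star s),
      star_inj, eq_comm (a := i) (b := q)]
    by_cases h0 : q = i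
    · subst h0
      by_cases h1 : M.allowed j q (M.star p)
      · by_cases h2 : M.allowed m (M.star s) q
        · simp [h1, h2, d_eq]
          field_simp [hv j, hv q, hv s]
        · simp [h2]
      · simp [h1]
    · simp [h0]

open scoped Classical in
-- Orthogonality with two labels zero. It says that `d` is a character of the fusion rules, which
-- makes weighted sums of loops idempotent and lets them absorb other loops.
theorem sum_d_allowed (i j : L) :
    ∑ k, M.d k * (if M.allowed i j k then 1 else 0) = M.d i * M.d j := by
  have h := M.sixj_orthogonality M.zero i j i M.zero j
  have hi := M.v_ne_zero i
  have hj := M.v_ne_zero j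
  have hc' : M.d i * M.d j ≠ 0 := mul_ne_zero (M.d_ne_zero i) (M.d_ne_zero j)
  have hc : (M.d i * M.d j)⁻¹ ≠ 0 := inv_ne_zero hc'
  simp only [sixj_zero₃, sixj_zero₂, allowed_zero_mid, allowed_zero_right,
    true_and, d_zero, inv_one, if_true] at h
  rw [← mul_left_inj' hc, mul_inv_cancel₀ hc', Finset.sum_mul]
  refine Eq.trans ?_ h
  refine Finset.sum_congr rfl fun k _ => ?_
  rw [M.allowed_swap_iff (i := j)]
  split_ifs
  · rw [d_eq, d_eq, d_eq]
    field_simp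
  · simp

/-- The coefficients that exchange the order in which a loop on the left (type `i`) and a loop on
the right (type `j`) of an edge are fused into it; the labels are `x`, then `y` or `t`,
then `z`. -/
noncomputable def swapCoeff (i j x y z t : L) : ℂ :=
  M.sixj j z (M.star y) (M.star i) (M.star x) t

/-- A pentagon, after tetrahedral symmetries. The two corners share the side with label `q`, and
only the label of this side between the two fusions depends on their order. -/
theorem swap_left_right (i j p q r p' q' r' y : L) :
    M.sixj r p q (M.star i) y p' * M.sixj p' y r (M.star j) r' q' =
      ∑ t, M.d t * (M.swapCoeff i j q y q' t *
        (M.sixj p q r (M.star j) r' t * M.sixj r' p t (M.star i) q' p')) := by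
  have h := M.sixj_pentagon r p (M.star i) q' j (M.star q) (M.star y) (M.star p') r'
  simp only [star_star] at h
  rw [M.sixj_one r, M.sixj_three p' y, M.star_star, ← h]
  refine Finset.sum_congr rfl fun t _ => ?_
  rw [swapCoeff, M.sixj_three p q, M.sixj_one r' p, M.star_star]
  ring

theorem swap_right_left (i j p q r p' q' r' y : L) :
    M.sixj p q r (M.star j) r' y * M.sixj r' p y (M.star i) q' p' =
      ∑ t, M.d t * (M.swapCoeff (M.star j) (M.star i) q y q' t *
        (M.sixj r p q (M.star i) t p' * M.sixj p' t r (M.star j) r' q')) := by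
  have h := M.sixj_pentagon p r j q' (M.star i) (M.star q) (M.star y) (M.star r') p'
  simp only [star_star] at h
  rw [M.sixj_three p q, M.sixj_one p r, M.star_star, ← h]
  refine Finset.sum_congr rfl fun t _ => ?_
  rw [swapCoeff, M.star_star, M.sixj_three p' t, M.sixj_one p' r, M.star_star]
  ring

open scoped Classical in
-- The two factors are the coefficients at the two ends of an edge, so a change of order made at
-- both ends has no effect.
theorem swapCoeff_orthogonality (i j x z t u : L) :
    ∑ y, M.d y * (M.swapCoeff i j x y z t *
        M.swapCoeff (M.star i) (M.star j) (M.star x) (M.star y) (M.star z) u) =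
      if t = M.star u ∧ M.allowed (M.star x) t j ∧ M.allowed (M.star z) i t
      then (M.d t)⁻¹ else 0 := by
  have h := M.sixj_orthogonality (M.star u) (M.star x) (M.star z) (M.star j) t (M.star i)
  simp only [star_star] at h
  rw [d_star] at h
  have e1 (y : L) : M.swapCoeff i j x y z t =
      M.sixj (M.star z) i t x (M.star j) y := by
    rw [swapCoeff, sixj_two, sixj_three, sixj_one, sixj_two, sixj_three]
    simp only [star_star]
  have e2 (y : L) : M.swapCoeff (M.star i) (M.star j) (M.star x) (M.star y) (M.star z) u =
      M.sixj (M.star x) (M.star u) j (M.star z) y (M.star i) := by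
    rw [swapCoeff, sixj_one, sixj_three, sixj_one, sixj_two]
    simp only [star_star]
  simp only [e1, e2, h]
  by_cases h0 : t = M.star u
  · subst h0
    simp
  · simp [h0]

/-- The coefficients that fuse two loops, of type `i` and then of type `j`, on the left of an edge
with labels `x`, `y`, `z` into one of type `k`. -/
noncomputable def fuseCoeff (i j x y z k : L) : ℂ :=
  M.sixj z j (M.star y) i (M.star x) k

/-- The coefficients that fuse two loops on the right of an edge. -/
noncomputable def fuseCoeff' (i j x y z k : L) : ℂ :=
  M.sixj x (M.star z) k j i (M.star y)

/-- Again a pentagon. The coefficient splits into one factor for each side of the corner, so that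
each factor can be paired with the one from the corner at the other end of that side. -/
theorem fuse_corner (i j a b c b₁ c₁ b₂ c₂ : L) :
    M.sixj a b c (M.star i) c₁ b₁ * M.sixj a b₁ c₁ (M.star j) c₂ b₂ =
      ∑ k, M.d k * (M.fuseCoeff i j b b₁ b₂ k * M.fuseCoeff' i j c c₁ c₂ k *
        M.sixj a b c (M.star k) c₂ b₂) := by
  have h := M.sixj_pentagon a c i j b₂ (M.star b) (M.star b₁) (M.star c₁) (M.star c₂)
  simp only [star_star] at h
  rw [M.sixj_three a b, M.sixj_one a c, M.sixj_three a b₁, M.sixj_one a c₁, M.star_star,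
    M.star_star, ← h]
  refine Finset.sum_congr rfl fun t _ => ?_
  rw [fuseCoeff, fuseCoeff', M.sixj_three a b, M.sixj_one a c, M.star_star]
  ring

open scoped Classical in
-- Summation over the label of a side between two loops forces the corners at its ends to choose the
-- same fused type.
theorem fuseCoeff_orthogonality (i j x z k l : L) :
    ∑ y, M.d y * (M.fuseCoeff i j x y z k *
        M.fuseCoeff' i j (M.star x) (M.star y) (M.star z) l) =
      if k = l ∧ M.allowed i j (M.star k) ∧ M.allowed (M.star x) z k then (M.d k)⁻¹ else 0 := by
  have h := M.sixj_orthogonality k (M.star j) (M.star x) i l (M.star z)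
  simp only [star_star] at h
  have e1 (y : L) : M.fuseCoeff i j x y z k =
      M.sixj (M.star j) k (M.star i) (M.star x) y (M.star z) := by
    rw [fuseCoeff, sixj_two, sixj_three, sixj_one, sixj_two]
    simp only [star_star]
  have e2 (y : L) : M.fuseCoeff' i j (M.star x) (M.star y) (M.star z) l =
      M.sixj (M.star x) z l j i y := by
    rw [fuseCoeff', star_star, star_star]
  simp only [e1, e2]
  refine (Finset.sum_congr rfl fun y _ => by rw [mul_comm (M.sixj _ _ _ _ _ _)]).trans (h.trans ?_)
  rw [eq_comm (a := l), ← M.allowed_star_iff (i := M.star j), allowed_rotate_iff,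
    allowed_rotate_iff]
  simp only [star_star]

end StringNetData

/-! ### Recoupling at corners where possibly nothing happens. -/

namespace StringNetData

variable {L : Type*} [Fintype L] (M : StringNetData L)

open scoped Classical in
/-- The symmetric form of the factor of a corner, with leg `a` and sides `b`, `c`, at which a loop
of type `i` is fused. If `P` fails, nothing happens at the vertex of the corner. -/
noncomputable def cornerSymbol (P : Prop) (i a b c b' c' : L) : ℂ :=
  if P then M.sixj a b c (M.star i) c' b' else if b = b' ∧ c = c' then (M.v b * M.v c)⁻¹ else 0

open scoped Classical in
theorem swapCoeff_zero (x y z t : L) : M.swapCoeff M.zero M.zero x y z t =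
    if t = x then if y = x ∧ z = x then (M.d x)⁻¹ else 0 else 0 := by
  rw [swapCoeff, sixj_zero₁]
  simp only [star_inj, M.star_zero, allowed_zero_right]
  by_cases h1 : t = x
  · by_cases h2 : y = x
    · by_cases h3 : z = x
      · simp [h1, h2, h3, d_eq, sq]
      · simp [h1, h2, h3, Ne.symm h3]
    · by_cases h3 : z = x
      · simp [h1, h2, h3]
      · simp [h1, h2, Ne.symm h3, h3]
  · simp [h1, Ne.symm h1]

/-- Where `P` fails both loops are trivial and both sides reduce to delta functions, so the exchange
holds uniformly at all vertices. -/
theorem cornerSymbol_swap_left_right {P : Prop} {i j : L} (hi : ¬ P → i = M.zero)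
    (hj : ¬ P → j = M.zero) (p q r p' q' r' y : L) :
    M.cornerSymbol P i r p q p' y * M.cornerSymbol P j p' y r q' r' =
      ∑ t, M.d t * (M.swapCoeff i j q y q' t *
        (M.cornerSymbol P j p q r t r' * M.cornerSymbol P i r' p t p' q')) := by
  classical
  by_cases h : P
  · simp only [cornerSymbol, h, if_true]
    exact M.swap_left_right i j p q r p' q' r' y
  · rw [hi h, hj h]
    simp only [cornerSymbol, h, if_false, swapCoeff_zero, ite_mul, mul_ite, zero_mul, mul_zero]
    have := M.d_ne_zero
    by_cases h1 : y = q
    · by_cases h2 : q' = q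
      · subst h1 h2
        by_cases h3 : p = p' <;> by_cases h4 : r = r' <;> simp [h3, h4, this, mul_comm]
      · subst h1
        simp [h2, Ne.symm h2]
    · simp [h1, Ne.symm h1]

theorem cornerSymbol_swap_right_left {P : Prop} {i j : L} (hi : ¬ P → i = M.zero)
    (hj : ¬ P → j = M.zero) (p q r p' q' r' y : L) :
    M.cornerSymbol P j p q r y r' * M.cornerSymbol P i r' p y p' q' =
      ∑ t, M.d t * (M.swapCoeff (M.star j) (M.star i) q y q' t *
        (M.cornerSymbol P i r p q p' t * M.cornerSymbol P j p' t r q' r')) := by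
  classical
  by_cases h : P
  · simp only [cornerSymbol, h, if_true]
    exact M.swap_right_left i j p q r p' q' r' y
  · rw [hi h, hj h, M.star_zero]
    simp only [cornerSymbol, h, if_false, swapCoeff_zero, ite_mul, mul_ite, zero_mul, mul_zero]
    have := M.d_ne_zero
    by_cases h1 : y = q
    · by_cases h2 : q' = q
      · subst h1 h2
        by_cases h3 : p = p' <;> by_cases h4 : r = r' <;> simp [h3, h4, this, mul_comm]
      · subst h1
        simp [h2, Ne.symm h2]
    · simp [h1, Ne.symm h1]

open scoped Classical in
theorem fuseCoeff_zero (x y z k : L) : M.fuseCoeff M.zero M.zero x y z k =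
    if k = M.zero then if y = x ∧ z = x then (M.v x)⁻¹ else 0 else 0 := by
  rw [fuseCoeff, sixj_zero₂]
  by_cases h : k = M.zero
  · subst h
    simp only [star_inj, allowed_zero_mid, true_and, v_zero, mul_one, if_true]
    by_cases h2 : x = z
    · subst h2
      simp
    · simp [h2, Ne.symm h2]
  · simp [h, Ne.symm h]

open scoped Classical in
theorem fuseCoeff'_zero (x y z k : L) : M.fuseCoeff' M.zero M.zero x y z k =
    if k = M.zero then if y = x ∧ z = x then (M.v x)⁻¹ else 0 else 0 := by
  rw [fuseCoeff', sixj_zero₄]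
  by_cases h : k = M.zero
  · subst h
    simp only [star_inj, allowed_zero_left, star_star, true_and, v_zero, one_mul, if_true,
      v_star]
    by_cases h2 : x = z
    · subst h2
      by_cases h3 : x = y
      · simp [h3]
      · simp [h3, Ne.symm h3]
    · simp [h2, Ne.symm h2]
  · simp [h]

theorem cornerSymbol_fuse {P : Prop} {i j : L} (hi : ¬ P → i = M.zero)
    (hj : ¬ P → j = M.zero) (a b c b₁ c₁ b₂ c₂ : L) :
    M.cornerSymbol P i a b c b₁ c₁ * M.cornerSymbol P j a b₁ c₁ b₂ c₂ =
      ∑ k, M.d k * (M.fuseCoeff i j b b₁ b₂ k * M.fuseCoeff' i j c c₁ c₂ k *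
        M.cornerSymbol P k a b c b₂ c₂) := by
  classical
  by_cases h : P
  · simp only [cornerSymbol, h, if_true]
    exact M.fuse_corner i j a b c b₁ c₁ b₂ c₂
  · rw [hi h, hj h]
    simp only [cornerSymbol, h, if_false, fuseCoeff_zero, fuseCoeff'_zero, ite_mul, mul_ite,
      zero_mul, mul_zero]
    have := M.v_ne_zero
    by_cases h1 : b = b₁
    · by_cases h2 : c = c₁
      · subst h1 h2
        by_cases h3 : b = b₂
        · by_cases h4 : c = c₂
          · simp [h3, h4, mul_comm]
          · simp [h3, h4]
        · simp [h3]
      · simp [h2, Ne.symm h2]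
    · simp [h1, Ne.symm h1]

end StringNetData

/-! ### Products over edges and sums over configurations. -/

namespace TrivalentMap

variable {D : Type*} {G : TrivalentMap D}

theorem next_next_ne (a : D) : G.next (G.next a) ≠ a := fun h => by
  have h3 := G.next_next_next a
  rw [h] at h3
  exact G.next_ne a h3

namespace FusionOrder

variable (o : G.FusionOrder)

/-- A product over the darts is a product over the edges. -/
theorem prod_darts [Fintype D] {R : Type*} [CommMonoid R] (h : D → R) :
    ∏ a, h a = ∏ r : {a // o.first a = true}, h r * h (G.rev r) := by
  classical
  rw [← Fintype.prod_subtype_mul_prod_subtype (fun a => o.first a = true) h,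
    Finset.prod_mul_distrib]
  congr 1
  let e : {a // ¬ o.first a = true} ≃ {a // o.first a = true} :=
    ⟨fun a => ⟨G.rev a.1, by have := a.2; rw [o.first_rev]; simpa using this⟩,
      fun a => ⟨G.rev a.1, by have := a.2; rw [o.first_rev]; simpa using this⟩,
      fun a => Subtype.ext (G.rev_rev a.1), fun a => Subtype.ext (G.rev_rev a.1)⟩
  exact Fintype.prod_equiv e _ _ fun a => by simp [e, G.rev_rev]

theorem prod_congr_edges [Fintype D] {R : Type*} [CommMonoid R] (o : G.FusionOrder) {h h' : D → R}
    (H : ∀ a, h a * h (G.rev a) = h' a * h' (G.rev a)) : ∏ a, h a = ∏ a, h' a := by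
  rw [o.prod_darts, o.prod_darts]
  exact Finset.prod_congr rfl fun r _ => H _

variable {L : Type*} [Fintype L] {M : StringNetData L}

/-- A configuration is given by its values on the darts that are treated first. -/
def configEquiv : G.Config M ≃ ({a // o.first a = true} → L) where
  toFun y r := y.1 r
  invFun h := ⟨fun a => if ha : o.first a = true then h ⟨a, ha⟩ else
      M.star (h ⟨G.rev a, by rw [o.first_rev]; simpa using ha⟩), fun a => by
    by_cases ha : o.first a = true
    · have hb : ¬ o.first (G.rev a) = true := by rw [o.first_rev, ha]; simp
      simp [ha, hb, G.rev_rev]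
    · have hb : o.first (G.rev a) = true := by rw [o.first_rev]; simpa using ha
      simp [ha, hb]⟩
  left_inv y := by
    apply Subtype.ext
    funext a
    by_cases ha : o.first a = true
    · simp [ha]
    · simp only [ha]
      rw [y.2]
      simp
  right_inv h := by
    funext r
    simp [r.2]

/-- One label per edge can be chosen freely, so the sum factors over the edges. -/
theorem sum_config_prod [Fintype D] (h : D → L → ℂ) :
    ∑ y : G.Config M, ∏ a, h a (y.1 a) =
      ∏ r : {a // o.first a = true}, ∑ t, h r t * h (G.rev r) (M.star t) := by
  classical
  rw [Finset.prod_univ_sum, Fintype.piFinset_univ]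
  refine Fintype.sum_equiv o.configEquiv _ _ fun y => ?_
  rw [o.prod_darts]
  refine Finset.prod_congr rfl fun r _ => ?_
  rw [y.2]
  rfl

end FusionOrder

end TrivalentMap

/-! ### Changing the order of fusion dart by dart. -/

namespace TrivalentMap

variable {D : Type*} (G : TrivalentMap D) {L : Type*} [Fintype L] (M : StringNetData L)

/-- The factor of the corner between `s` and `next s`, where `φ` tells which of the darts are
treated first, and `X`, `Y`, `Z` are the labels before, between and after the two fusions at each
dart, read into its vertex. The loop has type `ι s`. -/
noncomputable def halfCorner (S : D → Prop) (ι : D → L) (φ : D → Bool) (X Y Z : D → L)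
    (s : D) : ℂ :=
  M.cornerSymbol (S s) (ι s)
    (if φ s = φ (G.next s) then Y (G.next (G.next s)) else
      if φ s then X (G.next (G.next s)) else Z (G.next (G.next s)))
    (if φ s then X s else Y s) (if φ (G.next s) then Y (G.next s) else X (G.next s))
    (if φ s then Y s else Z s) (if φ (G.next s) then Z (G.next s) else Y (G.next s))

end TrivalentMap

/-- The coefficients that change the order of the two fusions at a dart, given whether its left
side is treated first, the types `i` and `j` on the right and on the left, and the labels. -/
noncomputable def StringNetData.flipCoeff {L : Type*} [Fintype L] (M : StringNetData L) (b : Bool)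
    (i j x y z t : L) : ℂ :=
  if b then M.swapCoeff (M.star j) (M.star i) x y z t else M.swapCoeff i j x y z t

namespace TrivalentMap

variable {D : Type*} {G : TrivalentMap D} {L : Type*} [Fintype L] {M : StringNetData L}

section Flip

variable {S : D → Prop} {ι : D → L} (hS : ∀ a, S (G.next a) ↔ S a) (hι : ∀ a, ¬ S a → ι a = M.zero)

include hS hι

open scoped Classical in
-- The hypothesis says that the corner opposite to `a` is resolved first or last at the vertex. The
-- two corners adjacent to `a` are then resolved in succession, and flipping `a` exchanges them.
theorem halfCorner_flip_pair {φ : D → Bool} (X Y Z : D → L) {a : D}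
    (ha : φ (G.next a) ≠ φ (G.next (G.next a))) :
    G.halfCorner M S ι φ X Y Z (G.next (G.next a)) * G.halfCorner M S ι φ X Y Z a =
      ∑ t, M.d t * (M.flipCoeff (φ a) (ι (G.next (G.next a))) (ι a) (X a) (Y a) (Z a) t *
        (G.halfCorner M S ι (Function.update φ a (!φ a)) X (Function.update Y a t) Z
            (G.next (G.next a)) *
          G.halfCorner M S ι (Function.update φ a (!φ a)) X (Function.update Y a t) Z a)) := by
  have h1 := G.next_ne a
  have h2 := G.next_next_ne a
  have h3 := G.next_next_next a
  have hi := hι a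
  have hj := hι (G.next (G.next a))
  rw [hS, hS] at hj
  simp only [halfCorner, StringNetData.flipCoeff, h3, hS, Function.update_self,
    Function.update_of_ne h1, Function.update_of_ne h2]
  cases e0 : φ a <;> cases e1 : φ (G.next a) <;> cases e2 : φ (G.next (G.next a)) <;>
    simp only [e1, e2, ne_eq, not_true_eq_false, Bool.not_false, Bool.not_true, if_true, if_false,
      Bool.false_eq_true, reduceCtorEq] at ha ⊢
  · rw [M.cornerSymbol_swap_left_right hj hi]
    exact Finset.sum_congr rfl fun t _ => by ring
  · rw [M.cornerSymbol_swap_left_right hj hi]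
    exact Finset.sum_congr rfl fun t _ => by ring
  · rw [mul_comm, M.cornerSymbol_swap_right_left hj hi]
  · rw [mul_comm, M.cornerSymbol_swap_right_left hj hi]

open scoped Classical in
theorem prod_halfCorner_flip [Fintype D] {φ : D → Bool} (X Y Z : D → L) {a : D}
    (ha : φ (G.next a) ≠ φ (G.next (G.next a))) :
    ∏ s, G.halfCorner M S ι φ X Y Z s =
      ∑ t, M.d t * (M.flipCoeff (φ a) (ι (G.next (G.next a))) (ι a) (X a) (Y a) (Z a) t *
        ∏ s, G.halfCorner M S ι (Function.update φ a (!φ a)) X (Function.update Y a t) Z s) := by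
  have split (h : D → ℂ) : ∏ s, h s = (h (G.next (G.next a)) * h a) *
      ∏ s ∈ (Finset.univ.erase a).erase (G.next (G.next a)), h s := by
    rw [← Finset.mul_prod_erase Finset.univ h (Finset.mem_univ a),
      ← Finset.mul_prod_erase (Finset.univ.erase a) h (a := G.next (G.next a))
        (by simp [G.next_next_ne])]
    ring
  rw [split, halfCorner_flip_pair hS hι X Y Z ha, Finset.sum_mul]
  refine Finset.sum_congr rfl fun t _ => ?_
  rw [split, mul_assoc, mul_assoc]
  congr 3
  refine Finset.prod_congr rfl fun s hs => ?_
  simp only [Finset.mem_erase, Finset.mem_univ, and_true, ne_eq] at hs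
  have h1 : G.next s ≠ a := fun h => hs.1 (by rw [← h, G.next_next_next])
  simp only [halfCorner, Function.update_of_ne hs.2, Function.update_of_ne h1]
  by_cases h2 : G.next (G.next s) = a
  · have h3 : s = G.next a := by rw [← h2, G.next_next_next]
    subst h3
    simp [ha]
  · simp only [Function.update_of_ne h2]

end Flip

/-- At no vertex all three, or none, of the darts are first. -/
def IsMixed (G : TrivalentMap D) (φ : D → Bool) : Prop :=
  ∀ a, ¬ (φ a = φ (G.next a) ∧ φ (G.next a) = φ (G.next (G.next a)))

/-- The mixed orders at a vertex form a cube without two opposite corners, a hexagon. From any of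
its points, some step along it decreases the number of disagreements with a given other point. -/
theorem IsMixed.exists_flip {φ φ' : D → Bool} (h : G.IsMixed φ) (h' : G.IsMixed φ')
    (hne : φ ≠ φ') : ∃ a, φ a ≠ φ' a ∧ φ (G.next a) ≠ φ (G.next (G.next a)) := by
  obtain ⟨a, ha⟩ := Function.ne_iff.1 hne
  by_contra! H
  have h0 := H a ha
  have h1 := H (G.next a)
  have h2 := H (G.next (G.next a))
  have g := h a
  have g' := h' a
  simp only [G.next_next_next] at h1 h2
  cases h3 : φ a <;> cases h4 : φ (G.next a) <;> cases h5 : φ (G.next (G.next a)) <;>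
    cases h6 : φ' a <;> cases h7 : φ' (G.next a) <;> cases h8 : φ' (G.next (G.next a)) <;>
    simp_all

open scoped Classical in
theorem IsMixed.flip {φ : D → Bool} (h : G.IsMixed φ) {a : D}
    (ha : φ (G.next a) ≠ φ (G.next (G.next a))) :
    G.IsMixed (Function.update φ a (!φ a)) := by
  intro s
  have hs := h s
  have n1 := G.next_ne s
  have n2 := G.next_next_ne s
  have n3 := G.next_ne (G.next s)
  by_cases h0 : s = a
  · subst h0
    rw [Function.update_of_ne n1, Function.update_of_ne n2]
    exact fun H => ha H.2
  · by_cases h1 : G.next s = a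
    · subst h1
      rw [G.next_next_next] at ha
      rw [Function.update_of_ne n1.symm, Function.update_of_ne n3]
      exact fun H => ha (H.2 ▸ H.1).symm
    · by_cases h2 : G.next (G.next s) = a
      · subst h2
        rw [G.next_next_next] at ha
        rw [Function.update_of_ne n2.symm, Function.update_of_ne n3.symm]
        exact fun H => ha H.1
      · rwa [Function.update_of_ne h0, Function.update_of_ne h1, Function.update_of_ne h2]

open scoped Classical in
/-- The coefficients that change the order of the fusions at a dart from that of `φ` to that of
`φ'`. -/
noncomputable def orderCoeff (G : TrivalentMap D) (M : StringNetData L) (ι : D → L)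
    (φ φ' : D → Bool) (X Z : D → L) (a : D) (y t : L) : ℂ :=
  if φ a = φ' a then if y = t then 1 else 0 else
    M.d t * M.flipCoeff (φ a) (ι (G.next (G.next a))) (ι a) (X a) y (Z a) t

open scoped Classical in
-- The two darts of an edge are flipped separately, so an intermediate `φ` need not come from a
-- fusion order, and the new labels are arbitrary functions on darts. Consistency along edges is
-- restored only by `sum_config_gauge`.
theorem prod_halfCorner_order [Fintype D] {S : D → Prop} {ι : D → L}
    (hS : ∀ a, S (G.next a) ↔ S a) (hι : ∀ a, ¬ S a → ι a = M.zero) (X Z : D → L)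
    {φ φ' : D → Bool} (h : G.IsMixed φ) (h' : G.IsMixed φ') (Y : D → L) :
    ∏ s, G.halfCorner M S ι φ X Y Z s =
      ∑ Y' : D → L, (∏ a, G.orderCoeff M ι φ φ' X Z a (Y a) (Y' a)) *
        ∏ s, G.halfCorner M S ι φ' X Y' Z s := by
  induction hn : (Finset.univ.filter fun a => φ a ≠ φ' a).card using Nat.strong_induction_on
    generalizing φ Y with
  | _ n ih =>
    by_cases hφ : φ = φ'
    · subst hφ
      rw [Finset.sum_eq_single Y]
      · simp [orderCoeff]
      · intro Y' _ hY
        obtain ⟨a, ha⟩ := Function.ne_iff.1 hY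
        rw [Finset.prod_eq_zero (Finset.mem_univ a), zero_mul]
        simp [orderCoeff, Ne.symm ha]
      · simp
    · obtain ⟨a, ha, hf⟩ := h.exists_flip h' hφ
      set ψ := Function.update φ a (!φ a) with hψ
      have hψa : ψ a = φ' a := by
        rw [hψ, Function.update_self]
        revert ha
        generalize φ a = x, φ' a = y
        revert x y
        decide
      have hψb : ∀ b, b ≠ a → ψ b = φ b := fun b hb => by rw [hψ, Function.update_of_ne hb]
      have hlt : (Finset.univ.filter fun b => ψ b ≠ φ' b).card < n := by
        rw [← hn]
        apply Finset.card_lt_card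
        rw [Finset.ssubset_iff_of_subset]
        · exact ⟨a, by simp [ha], by simp [hψa]⟩
        · intro b hb
          simp only [Finset.mem_filter, Finset.mem_univ, true_and] at hb ⊢
          by_cases hba : b = a
          · subst hba
            exact ha
          · rwa [← hψb b hba]
      rw [prod_halfCorner_flip hS hι X Y Z hf]
      have hih := fun t => ih _ hlt (h.flip hf) (Function.update Y a t) rfl
      simp only [← hψ] at hih ⊢
      simp only [hih, Finset.mul_sum]
      rw [Finset.sum_comm]
      refine Finset.sum_congr rfl fun Y' _ => ?_
      have key (t : L) : ∏ b, G.orderCoeff M ι ψ φ' X Z b (Function.update Y a t b) (Y' b) =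
          (if t = Y' a then 1 else 0) *
            ∏ b ∈ Finset.univ.erase a, G.orderCoeff M ι φ φ' X Z b (Y b) (Y' b) := by
        rw [← Finset.mul_prod_erase Finset.univ _ (Finset.mem_univ a)]
        congr 1
        · simp [orderCoeff, hψa]
        · refine Finset.prod_congr rfl fun b hb => ?_
          have hba : b ≠ a := (Finset.mem_erase.1 hb).1
          rw [Function.update_of_ne hba, orderCoeff, hψb b hba, orderCoeff]
      simp only [key]
      rw [Finset.sum_eq_single (Y' a)]
      · rw [if_pos rfl, ← Finset.mul_prod_erase Finset.univ
            (fun b => G.orderCoeff M ι φ φ' X Z b (Y b) (Y' b)) (Finset.mem_univ a)]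
        have e : G.orderCoeff M ι φ φ' X Z a (Y a) (Y' a) = M.d (Y' a) *
            M.flipCoeff (φ a) (ι (G.next (G.next a))) (ι a) (X a) (Y a) (Z a) (Y' a) := by
          rw [orderCoeff, if_neg ha]
        rw [e]
        ring
      · intro t _ ht
        simp [ht]
      · simp

end TrivalentMap

/-! ### Loops in all plaquettes; independence of the order of fusion. -/

namespace TrivalentMap

variable {D : Type*} {G : TrivalentMap D} {L : Type*} [Fintype L] {M : StringNetData L}

namespace FusionOrder

variable (o : G.FusionOrder)

open scoped Classical in
/-- The factor of the corner between `s` and `next s` when loops of types `ι` are fused at the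
vertices in `S`, and nothing happens at the other vertices. -/
noncomputable def localFactor (S : D → Prop) (ι : D → L) (x y z : G.Config M) (s : D) : ℂ :=
  if S s then o.cornerFactor (ι s) x y z s else
    if (o.before x y s).1 s = (o.after y z s).1 s ∧
      (o.before x y (G.rev (G.next s))).1 (G.rev (G.next s)) =
        (o.after y z (G.rev (G.next s))).1 (G.rev (G.next s)) then 1 else 0

/-- The operator that adds loops of type `ι s` in the plaquettes to the left of the darts `s`, with
nothing done at vertices outside `S`. -/
noncomputable def multiLoop [Fintype D] (M : StringNetData L) (S : D → Prop) (ι : D → L) :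
    Matrix (G.Config M) (G.Config M) ℂ :=
  fun z x => ∑ y : G.Config M, ∏ s, o.localFactor S ι x y z s

/-- The factors `v` are those between `F` and the `6j`-symbol. At vertices outside `S` they cancel
the inverse weight in `cornerSymbol`. -/
theorem localFactor_eq (S : D → Prop) (ι : D → L) (x y z : G.Config M) (s : D) :
    o.localFactor S ι x y z s =
      G.halfCorner M S ι o.first (fun a => x.1 (G.rev a)) (fun a => y.1 (G.rev a))
        (fun a => z.1 (G.rev a)) s *
      (M.v ((o.before x y (G.rev (G.next s))).1 (G.rev (G.next s))) *
        M.v ((o.after y z s).1 s)) := by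
  have hb : (if o.first s then x.1 (G.rev s) else y.1 (G.rev s)) =
      M.star ((o.before x y s).1 s) := by
    rw [← (o.before x y s).2, before]; split_ifs <;> rfl
  have hb' : (if o.first s then y.1 (G.rev s) else z.1 (G.rev s)) =
      M.star ((o.after y z s).1 s) := by
    rw [← (o.after y z s).2, after]; split_ifs <;> rfl
  have hc : (if o.first (G.next s) then y.1 (G.rev (G.next s)) else x.1 (G.rev (G.next s))) =
      (o.before x y (G.rev (G.next s))).1 (G.rev (G.next s)) := by
    rw [before, o.first_rev]; cases o.first (G.next s) <;> rfl
  have hc' : (if o.first (G.next s) then z.1 (G.rev (G.next s)) else y.1 (G.rev (G.next s))) =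
      (o.after y z (G.rev (G.next s))).1 (G.rev (G.next s)) := by
    rw [after, o.first_rev]; cases o.first (G.next s) <;> rfl
  have hl : (if o.first s = o.first (G.next s) then y.1 (G.rev (G.next (G.next s))) else
      if o.first s then x.1 (G.rev (G.next (G.next s))) else z.1 (G.rev (G.next (G.next s)))) =
      (o.leg x y z s).1 (G.rev (G.next (G.next s))) := by
    rw [leg]; cases o.first s <;> cases o.first (G.next s) <;> rfl
  have hv := M.v_ne_zero
  rw [localFactor, halfCorner, StringNetData.cornerSymbol, hb, hb', hc, hc', hl]
  by_cases h1 : S s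
  · rw [if_pos h1, if_pos h1, cornerFactor, M.F_eq, (o.before x y s).2, (o.after y z s).2, M.v_star]
  · rw [if_neg h1, if_neg h1, M.star_inj]
    by_cases h2 : (o.before x y s).1 s = (o.after y z s).1 s ∧
      (o.before x y (G.rev (G.next s))).1 (G.rev (G.next s)) =
        (o.after y z (G.rev (G.next s))).1 (G.rev (G.next s))
    · rw [if_pos h2, if_pos h2, h2.1, M.v_star, mul_comm (M.v _), inv_mul_cancel₀]
      exact mul_ne_zero (hv _) (hv _)
    · rw [if_neg h2, if_neg h2, zero_mul]

/-- After reindexing by sides, every side carries one weight from its label before and one from its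
label after the fusion. The intermediate label occurs on both darts of its edge and so has total
weight `d`. -/
theorem multiLoop_apply [Fintype D] (S : D → Prop) (ι : D → L) (z x : G.Config M) :
    o.multiLoop M S ι z x = (∏ s, if o.first s then M.v (x.1 s) else M.v (z.1 s)) *
      ∑ y : G.Config M, (∏ s, M.v (y.1 s)) *
        ∏ s, G.halfCorner M S ι o.first (fun a => x.1 (G.rev a)) (fun a => y.1 (G.rev a))
          (fun a => z.1 (G.rev a)) s := by
  rw [multiLoop, Finset.mul_sum]
  refine Finset.sum_congr rfl fun y _ => ?_
  simp only [localFactor_eq, Finset.prod_mul_distrib]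
  have e : ∏ s, M.v ((o.before x y (G.rev (G.next s))).1 (G.rev (G.next s))) =
      ∏ s, M.v ((o.before x y s).1 s) :=
    Fintype.prod_equiv (G.next.trans G.rev)
      (fun s => M.v ((o.before x y (G.rev (G.next s))).1 (G.rev (G.next s))))
      (fun s => M.v ((o.before x y s).1 s)) fun s => rfl
  have e2 : (∏ s, M.v ((o.before x y s).1 s)) * ∏ s, M.v ((o.after y z s).1 s) =
      (∏ s, if o.first s then M.v (x.1 s) else M.v (z.1 s)) * ∏ s, M.v (y.1 s) := by
    rw [← Finset.prod_mul_distrib, ← Finset.prod_mul_distrib]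
    refine Finset.prod_congr rfl fun s _ => ?_
    rw [before, after]
    split_ifs
    · rfl
    · rw [mul_comm]
  rw [e, e2]
  ring

open scoped Classical in
-- The matrices `U` change the basis of the intermediate label at each dart. By `hU` those at the
-- two ends of an edge are dual with respect to `d`, up to a condition `C` that holds on the support
-- of `g`. Summation over the edge labels therefore removes `U` and leaves `g` on labels that match
-- along edges.
theorem sum_config_gauge [Fintype D] (o : G.FusionOrder) (f g : (D → L) → ℂ)
    (U : D → L → L → ℂ) (C : D → L → Prop)
    (h : ∀ η, f η = ∑ η' : D → L, (∏ a, U a (η a) (η' a)) * g η')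
    (hU : ∀ a t u, ∑ y, M.d y * (U a y t * U (G.rev a) (M.star y) u) =
      if t = M.star u ∧ C a t then M.d t else 0)
    (hC : ∀ η, g η ≠ 0 → ∀ a, C a (η a)) :
    ∑ y : G.Config M, (∏ s, M.v (y.1 s)) * f (fun a => y.1 (G.rev a)) =
      ∑ y : G.Config M, (∏ s, M.v (y.1 s)) * g (fun a => y.1 (G.rev a)) := by
  have e1 (η' : D → L) : ∑ y : G.Config M, (∏ s, M.v (y.1 s)) *
      ∏ a, U a (y.1 (G.rev a)) (η' a) =
      ∏ r : {a // o.first a = true},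
        if η' r = M.star (η' (G.rev r)) ∧ C r (η' r) then M.d (η' r) else 0 := by
    have := o.sum_config_prod (M := M) fun a t => M.v t * U a (M.star t) (η' a)
    calc _ = ∑ y : G.Config M, ∏ a, (M.v (y.1 a) * U a (M.star (y.1 a)) (η' a)) :=
          Finset.sum_congr rfl fun y _ => by
            rw [← Finset.prod_mul_distrib]
            exact Finset.prod_congr rfl fun a _ => by rw [y.2]
      _ = _ := by
        rw [this]
        refine Finset.prod_congr rfl fun r _ => ?_
        rw [← hU]
        refine Fintype.sum_equiv (Function.Involutive.toPerm M.star M.star_star) _ _ fun t => ?_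
        change _ = M.d (M.star t) * (U r (M.star t) (η' r) *
          U (G.rev r) (M.star (M.star t)) (η' (G.rev r)))
        rw [M.star_star, M.v_star, M.d_star, M.d_eq]
        ring
  simp only [h, Finset.mul_sum]
  rw [Finset.sum_comm]
  have e2 (η' : D → L) : ∑ y : G.Config M, (∏ s, M.v (y.1 s)) *
      ((∏ a, U a (y.1 (G.rev a)) (η' a)) * g η') =
      (∏ r : {a // o.first a = true},
        if η' r = M.star (η' (G.rev r)) ∧ C r (η' r) then M.d (η' r) else 0) * g η' := by
    rw [← e1, Finset.sum_mul]
    exact Finset.sum_congr rfl fun y _ => by ring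
  simp only [e2]
  symm
  refine Finset.sum_of_injOn (fun y : G.Config M => fun a => y.1 (G.rev a)) ?_ ?_ ?_ ?_
  · intro y _ y' _ hy
    apply Subtype.ext
    funext a
    have := congrFun hy (G.rev a)
    simpa only [G.rev_rev] using this
  · exact fun _ _ => Finset.mem_coe.2 (Finset.mem_univ _)
  -- A labeling of the darts that is no configuration violates reversal on some edge, and the factor
  -- of this edge is zero.
  · intro η _ hη
    have : ∃ r : {a // o.first a = true}, η r ≠ M.star (η (G.rev r)) := by
      by_contra! H
      have H' : ∀ a, η a = M.star (η (G.rev a)) := fun a => by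
        by_cases ha : o.first a = true
        · exact H ⟨a, ha⟩
        · have := H ⟨G.rev a, by rw [o.first_rev]; simpa using ha⟩
          simp only [G.rev_rev] at this
          rw [this, M.star_star]
      refine hη ⟨⟨fun a => η (G.rev a), fun a => by
        change η (G.rev (G.rev a)) = M.star (η (G.rev a))
        rw [G.rev_rev, ← H']⟩, Finset.mem_coe.2 (Finset.mem_univ _), ?_⟩
      funext a
      exact congrArg η (G.rev_rev a)
    obtain ⟨r, hr⟩ := this
    rw [Finset.prod_eq_zero (Finset.mem_univ r), zero_mul]
    rw [if_neg]
    exact fun h => hr h.1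
  · intro y _
    by_cases hg : g (fun a => y.1 (G.rev a)) = 0
    · rw [hg, mul_zero, mul_zero]
    · congr 1
      rw [o.prod_darts]
      refine Finset.prod_congr rfl fun r _ => ?_
      have hr : y.1 (G.rev r) = M.star (y.1 (G.rev (G.rev r))) := by rw [G.rev_rev, y.2]
      have hr' : M.d (y.1 (G.rev r)) = M.v (y.1 r) * M.v (y.1 (G.rev r)) := by
        rw [y.2, M.v_star, M.d_star, M.d_eq, sq]
      rw [if_pos ⟨hr, hC _ hg _⟩]
      exact hr'.symm

theorem cornerSymbol_allowed {P : Prop} {i a b c b' c' : L} (hi : ¬ P → i = M.zero)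
    (h : M.cornerSymbol P i a b c b' c' ≠ 0) :
    M.allowed (M.star c) c' (M.star i) ∧ M.allowed (M.star b) i b' := by
  classical
  by_cases hP : P
  · rw [StringNetData.cornerSymbol, if_pos hP] at h
    obtain ⟨⟨-, h1⟩, -, h2⟩ := M.sixj_ne_zero h
    constructor
    · rwa [M.allowed_rotate_iff, M.allowed_swap_iff]
    · rw [← M.allowed_star_iff] at h2
      simpa only [M.star_star] using h2
  · rw [StringNetData.cornerSymbol, if_neg hP] at h
    rw [hi hP]
    obtain ⟨rfl, rfl⟩ := (ite_ne_right_iff.1 h).1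
    simp [M.allowed_zero_right, M.allowed_zero_mid]

/-- The admissibility conditions on a label between two fusions, in the order of `φ'`. -/
def orderCond (G : TrivalentMap D) (M : StringNetData L) (ι : D → L)
    (φ φ' : D → Bool) (X Z : D → L) (a : D) (t : L) : Prop :=
  φ a ≠ φ' a → if φ a then
    M.allowed (M.star (X a)) t (M.star (ι (G.next (G.next a)))) ∧
      M.allowed (M.star (Z a)) (M.star (ι a)) t
  else M.allowed (M.star (X a)) t (ι a) ∧ M.allowed (M.star (Z a)) (ι (G.next (G.next a))) t

open scoped Classical in
-- The type on the right of `a` is the type on the left of `rev a`. Hence the coefficient at the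
-- other end has all types and outer labels reversed, as in `swapCoeff_orthogonality`.
theorem sum_orderCoeff [Fintype D] (o o' : G.FusionOrder) {ι : D → L}
    (hf : ∀ a, ι (G.facePerm a) = ι a) (x z : G.Config M) (a : D) (t u : L) :
    ∑ y, M.d y * (G.orderCoeff M ι o.first o'.first (fun a => x.1 (G.rev a))
        (fun a => z.1 (G.rev a)) a y t *
      G.orderCoeff M ι o.first o'.first (fun a => x.1 (G.rev a))
        (fun a => z.1 (G.rev a)) (G.rev a) (M.star y) u) =
      if t = M.star u ∧ orderCond G M ι o.first o'.first (fun a => x.1 (G.rev a))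
        (fun a => z.1 (G.rev a)) a t then M.d t else 0 := by
  have hinv : ∀ b, G.next (G.next b) = G.next⁻¹ b := fun b => by
    rw [Equiv.Perm.eq_inv_iff_eq, G.next_next_next]
  have h1 : ι (G.next (G.next (G.rev a))) = ι a := by rw [hinv]; exact hf a
  have h2 : ι (G.rev a) = ι (G.next (G.next a)) := by
    rw [hinv, ← hf (G.rev a), facePerm, Equiv.Perm.mul_apply, G.rev_rev]
  have hd := M.d_ne_zero
  by_cases he : o.first a = o'.first a
  · have he' : o.first (G.rev a) = o'.first (G.rev a) := by rw [o.first_rev, o'.first_rev, he]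
    simp only [orderCoeff, he', if_true, orderCond, he, ne_eq, not_true_eq_false,
      false_imp_iff, and_true]
    rw [Finset.sum_eq_single t]
    · by_cases h : t = M.star u
      · simp [h]
      · have h' : ¬ M.star t = u := fun h' => h (by rw [← h', M.star_star])
        simp [h, h']
    · intro y _ hy
      simp [hy]
    · simp
  · have he' : ¬ o.first (G.rev a) = o'.first (G.rev a) := by
      rw [o.first_rev, o'.first_rev]
      simpa using he
    have hx := x.2 a
    have hz := z.2 a
    simp only [orderCoeff, he', if_false, h1, h2, G.rev_rev, hx, hz, orderCond, ne_eq, he,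
      not_false_eq_true, true_imp_iff]
    simp only [o.first_rev, StringNetData.flipCoeff]
    have key (i j i' j' : L) (hi : i' = M.star i) (hj : j' = M.star j) (x z : L) :
        ∑ y, M.d y * (M.d t * M.swapCoeff i j (M.star x) y (M.star z) t *
          (M.d u * M.swapCoeff i' j' x (M.star y) z u)) =
        if t = M.star u ∧ M.allowed (M.star (M.star x)) t j ∧
          M.allowed (M.star (M.star z)) i t then M.d t else 0 := by
      have h := M.swapCoeff_orthogonality i j (M.star x) (M.star z) t u
      rw [M.star_star x, M.star_star z] at h ⊢
      rw [hi, hj]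
      calc _ = M.d t * M.d u * ∑ y, M.d y * (M.swapCoeff i j (M.star x) y (M.star z) t *
          M.swapCoeff (M.star i) (M.star j) x (M.star y) z u) := by
            rw [Finset.mul_sum]
            exact Finset.sum_congr rfl fun y _ => by ring
        _ = _ := by
          rw [h]
          split_ifs with hc
          · rw [hc.1, M.d_star]
            field_simp [hd u]
          · rw [mul_zero]
    cases o.first a
    · exact key (ι (G.next (G.next a))) (ι a) _ _ rfl rfl (x.1 a) (z.1 a)
    · exact key (M.star (ι a)) (M.star (ι (G.next (G.next a)))) _ _
        (M.star_star _).symm (M.star_star _).symm (x.1 a) (z.1 a)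

theorem multiLoop_order [Fintype D] (o' : G.FusionOrder) {S : D → Prop} {ι : D → L}
    (hS : ∀ a, S (G.next a) ↔ S a) (hι : ∀ a, ¬ S a → ι a = M.zero)
    (hf : ∀ a, ι (G.facePerm a) = ι a) : o.multiLoop M S ι = o'.multiLoop M S ι := by
  ext z x
  rw [multiLoop_apply, multiLoop_apply]
  congr 1
  -- For either order an edge contributes `v` of its initial label times `v` of its final label.
  · refine o.prod_congr_edges fun s => ?_
    rw [o.first_rev, o'.first_rev, x.2, z.2, M.v_star, M.v_star]
    cases o.first s <;> cases o'.first s <;> simp [mul_comm]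
  · refine sum_config_gauge o _ _ _ _ (prod_halfCorner_order hS hι _ _ o.mixed o'.mixed)
      (fun a t u => sum_orderCoeff o o' hf x z a t u) ?_
    intro η hη a hne
    have h1 := cornerSymbol_allowed (hι _) (Finset.prod_ne_zero_iff.1 hη a (Finset.mem_univ _))
    have h2 := cornerSymbol_allowed (hι _)
      (Finset.prod_ne_zero_iff.1 hη (G.next (G.next a)) (Finset.mem_univ _))
    rw [G.next_next_next] at h2
    have h3 := h1.2
    have h4 := h2.1
    cases e : o.first a <;> cases e' : o'.first a <;> simp only [e, e', ne_eq,
      not_true_eq_false, if_true, Bool.false_eq_true, if_false] at hne h3 h4 ⊢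
    · refine ⟨?_, ?_⟩
      · rw [M.allowed_swap_iff, M.allowed_rotate_iff]
        exact h3
      · rw [M.allowed_rotate_iff, M.allowed_rotate_iff, ← M.allowed_star_iff, M.star_star]
        exact h4
    · refine ⟨h4, ?_⟩
      rw [← M.allowed_star_iff, M.allowed_reverse_iff, M.star_star, M.star_star]
      exact h3

end FusionOrder

end TrivalentMap

/-! ### Interleaving two operators at a vertex. -/

namespace StringNetData

variable {L : Type*} [Fintype L] (M : StringNetData L)

section Stack

variable {P : Prop} {ia ib ic ja jb jc : L} (hia : ¬ P → ia = M.zero) (hib : ¬ P → ib = M.zero)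
  (hic : ¬ P → ic = M.zero) (hja : ¬ P → ja = M.zero) (hjb : ¬ P → jb = M.zero)
  (hjc : ¬ P → jc = M.zero) (p₀ p₁ p₂ p₃ p₄ q₀ q₁ q₂ q₃ q₄ r₀ r₁ r₂ r₃ r₄ : L)

include hib hic hja hjb

/-- Three exchanges, one for each dart, move the corners of the second operator forward until both
loops pass each corner in immediate succession. The corners are resolved here in the cyclic order of
`next`; the primed version treats the opposite order. -/
theorem cornerSymbol_stack :
    (M.cornerSymbol P ia r₀ p₀ q₀ p₁ q₁ * M.cornerSymbol P ib p₁ q₁ r₀ q₂ r₁ *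
      M.cornerSymbol P ic q₂ r₁ p₁ r₂ p₂) *
      (M.cornerSymbol P ja r₂ p₂ q₂ p₃ q₃ * M.cornerSymbol P jb p₃ q₃ r₂ q₄ r₃ *
      M.cornerSymbol P jc q₄ r₃ p₃ r₄ p₄) =
    ∑ p, ∑ q, ∑ r,
      ((M.d p * M.swapCoeff ic ja p₁ p₂ p₃ p) *
        (M.d q * M.swapCoeff (M.star ib) (M.star ja) q₁ q₂ q₃ q) *
        (M.d r * M.swapCoeff (M.star ic) (M.star jb) r₁ r₂ r₃ r)) *
      ((M.cornerSymbol P ia r₀ p₀ q₀ p₁ q₁ * M.cornerSymbol P ja r₀ p₁ q₁ p q) *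
        (M.cornerSymbol P ib p q r₀ q₃ r₁ * M.cornerSymbol P jb p q₃ r₁ q₄ r) *
        (M.cornerSymbol P ic q₄ r p r₃ p₃ * M.cornerSymbol P jc q₄ r₃ p₃ r₄ p₄)) := by
  -- Each such rearrangement isolates the two factors that are exchanged next.
  rw [show ∀ a b c d e f : ℂ, (a * b * c) * (d * e * f) = (a * b * e * f) * (c * d) by
      intros; ring,
    M.cornerSymbol_swap_left_right hic hja, Finset.mul_sum]
  refine Finset.sum_congr rfl fun p _ => ?_
  rw [show ∀ a b c d e f g h : ℂ, (a * b * c * d) * (e * (f * (g * h))) =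
      (a * c * d * e * f * h) * (b * g) by intros; ring,
    M.cornerSymbol_swap_right_left hja hib, Finset.mul_sum]
  refine Finset.sum_congr rfl fun q _ => ?_
  rw [show ∀ a b c d e f g h k l : ℂ, (a * b * c * d * e * f) * (g * (h * (k * l))) =
      (a * c * d * e * g * h * k * l) * (f * b) by intros; ring,
    M.cornerSymbol_swap_right_left hjb hic, Finset.mul_sum]
  refine Finset.sum_congr rfl fun r _ => ?_
  ring

omit hjb in
include hjc in
theorem cornerSymbol_stack' :
    (M.cornerSymbol P ia r₀ p₀ q₀ p₁ q₁ * M.cornerSymbol P ib p₂ q₁ r₁ q₂ r₂ *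
      M.cornerSymbol P ic q₁ r₀ p₁ r₁ p₂) *
      (M.cornerSymbol P ja r₂ p₂ q₂ p₃ q₃ * M.cornerSymbol P jb p₄ q₃ r₃ q₄ r₄ *
      M.cornerSymbol P jc q₃ r₂ p₃ r₃ p₄) =
    ∑ p, ∑ q, ∑ r,
      ((M.d p * M.swapCoeff ic ja p₁ p₂ p₃ p) *
        (M.d q * M.swapCoeff (M.star ib) (M.star ja) q₁ q₂ q₃ q) *
        (M.d r * M.swapCoeff ib jc r₁ r₂ r₃ r)) *
      ((M.cornerSymbol P ia r₀ p₀ q₀ p₁ q₁ * M.cornerSymbol P ja r₀ p₁ q₁ p q) *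
        (M.cornerSymbol P ib p₄ q r q₃ r₃ * M.cornerSymbol P jb p₄ q₃ r₃ q₄ r₄) *
        (M.cornerSymbol P ic q r₀ p r₁ p₃ * M.cornerSymbol P jc q r₁ p₃ r p₄)) := by
  rw [Finset.sum_comm, show ∀ a b c d e f : ℂ, (a * b * c) * (d * e * f) =
      (a * c * e * f) * (b * d) by intros; ring,
    M.cornerSymbol_swap_right_left hja hib, Finset.mul_sum]
  refine Finset.sum_congr rfl fun q _ => ?_
  rw [show ∀ a b c d e f g h : ℂ, (a * b * c * d) * (e * (f * (g * h))) =
      (a * c * d * e * f * h) * (b * g) by intros; ring,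
    M.cornerSymbol_swap_left_right hic hja, Finset.mul_sum]
  refine Finset.sum_congr rfl fun p _ => ?_
  rw [show ∀ a b c d e f g h k l : ℂ, (a * b * c * d * e * f) * (g * (h * (k * l))) =
      (a * b * d * e * g * h * k * l) * (f * c) by intros; ring,
    M.cornerSymbol_swap_left_right hib hjc, Finset.mul_sum]
  refine Finset.sum_congr rfl fun r _ => ?_
  ring

end Stack

end StringNetData

namespace TrivalentMap

variable {D : Type*} {G : TrivalentMap D}

/-- The darts whose left corner comes first at their vertex. -/
abbrev Least (G : TrivalentMap D) (φ : D → Bool) : Type _ :=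
  {s : D // φ s = true ∧ φ (G.next s) = false}

/-- A dart at the vertex of another one. -/
def nthNext (G : TrivalentMap D) (s : D) (k : Fin 3) : D := ![s, G.next s, G.next (G.next s)] k

/-- Exactly one corner is resolved first at each vertex, so these corners represent the vertices. -/
theorem IsMixed.bijective {φ : D → Bool} (h : G.IsMixed φ) :
    Function.Bijective fun p : G.Least φ × Fin 3 => G.nthNext p.1.1 p.2 := by
  constructor
  · rintro ⟨⟨s, hs⟩, k⟩ ⟨⟨s', hs'⟩, k'⟩ e
    have n3 := G.next_next_next
    have inj := G.next.injective
    have c1 : s ≠ G.next s' := fun h => by rw [h, hs'.2] at hs; simp at hs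
    have c2 : G.next s ≠ s' := fun h => by rw [h, hs'.1] at hs; simp at hs
    change ![s, G.next s, G.next (G.next s)] k = ![s', G.next s', G.next (G.next s')] k' at e
    have key : s = s' ∧ k = k' := by
      fin_cases k <;> fin_cases k' <;> simp at e ⊢
      · exact e
      · exact c1 e
      · exact c2 (by rw [e, n3])
      · exact c2 e
      · exact e
      · exact c1 e
      · exact c1 (by rw [← e, n3])
      · exact c2 e
      · exact e
    obtain ⟨rfl, rfl⟩ := key
    rfl
  · intro a
    have ha := h a
    cases e0 : φ a <;> cases e1 : φ (G.next a) <;> cases e2 : φ (G.next (G.next a)) <;>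
      simp only [e0, e1, e2, reduceCtorEq, and_true, and_false, not_false_eq_true,
        not_true_eq_false] at ha
    · exact ⟨(⟨G.next (G.next a), e2, by rwa [G.next_next_next]⟩, 1), G.next_next_next a⟩
    · exact ⟨(⟨G.next a, e1, e2⟩, 2), G.next_next_next a⟩
    · exact ⟨(⟨G.next (G.next a), e2, by rwa [G.next_next_next]⟩, 1), G.next_next_next a⟩
    · exact ⟨(⟨a, e0, e1⟩, 0), rfl⟩
    · exact ⟨(⟨a, e0, e1⟩, 0), rfl⟩
    · exact ⟨(⟨G.next a, e1, e2⟩, 2), G.next_next_next a⟩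

theorem IsMixed.prod_eq [Fintype D] {φ : D → Bool} (h : G.IsMixed φ) {R : Type*} [CommMonoid R]
    (f : D → R) :
    ∏ s, f s = ∏ s : G.Least φ, f s * f (G.next s) * f (G.next (G.next s)) := by
  classical
  rw [← Function.Bijective.prod_comp h.bijective f, Fintype.prod_prod_type]
  refine Finset.prod_congr rfl fun s _ => ?_
  rw [Fin.prod_univ_three]
  rfl

open scoped Classical in
theorem IsMixed.prod_sum_eq [Fintype D] {L : Type*} [Fintype L] {φ : D → Bool} (h : G.IsMixed φ)
    (f : G.Least φ → L → L → L → ℂ) :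
    ∏ s, ∑ p, ∑ q, ∑ r, f s p q r =
      ∑ η : D → L, ∏ s : G.Least φ, f s (η s) (η (G.next s)) (η (G.next (G.next s))) := by
  have e1 (s : G.Least φ) : ∑ p, ∑ q, ∑ r, f s p q r = ∑ t : L × L × L, f s t.1 t.2.1 t.2.2 := by
    rw [Fintype.sum_prod_type]
    exact Finset.sum_congr rfl fun p _ => by rw [Fintype.sum_prod_type]
  simp only [e1]
  rw [Finset.prod_univ_sum, Fintype.piFinset_univ]
  symm
  let E := Equiv.ofBijective _ h.bijective
  have hE : ∀ p, E p = G.nthNext p.1.1 p.2 := fun p => rfl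
  refine Fintype.sum_bijective
    (fun (η : D → L) (s : G.Least φ) => (η s, η (G.next s), η (G.next (G.next s)))) ⟨?_, ?_⟩ _ _
    fun η => rfl
  · intro η η' he
    funext a
    obtain ⟨⟨s, k⟩, rfl⟩ := E.surjective a
    have := congrFun he s
    simp only [Prod.mk.injEq] at this
    rw [hE]
    fin_cases k
    · exact this.1
    · exact this.2.1
    · exact this.2.2
  · intro p
    refine ⟨fun a => ![(p (E.symm a).1).1, (p (E.symm a).1).2.1, (p (E.symm a).1).2.2]
      (E.symm a).2, ?_⟩
    funext s
    have h0 : E.symm s.1 = (s, 0) := by rw [Equiv.symm_apply_eq]; rfl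
    have h1 : E.symm (G.next s.1) = (s, 1) := by rw [Equiv.symm_apply_eq]; rfl
    have h2 : E.symm (G.next (G.next s.1)) = (s, 2) := by rw [Equiv.symm_apply_eq]; rfl
    simp [h0, h1, h2]

variable {L : Type*} [Fintype L] {M : StringNetData L}

/-- The factor of the corner between `s` and `next s` when loops of type `κ s` and `ι s` are fused
directly after each other. The labels at a dart, read into its vertex, are `X`, `Y`, `m`, `Y'`, `Z`;
the arguments `m₀`, `m₁`, `m₂` are the values of `m` at the three darts. -/
noncomputable def stackCorner (G : TrivalentMap D) (M : StringNetData L) (S : D → Prop)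
    (κ ι : D → L) (φ : D → Bool) (X Y Y' Z : D → L) (s : D) (m₀ m₁ m₂ : L) : ℂ :=
  M.cornerSymbol (S s) (κ s)
      (if φ s = φ (G.next s) then m₂ else
        if φ s then X (G.next (G.next s)) else Z (G.next (G.next s)))
      (if φ s then X s else m₀) (if φ (G.next s) then m₁ else X (G.next s))
      (if φ s then Y s else Y' s) (if φ (G.next s) then Y' (G.next s) else Y (G.next s)) *
    M.cornerSymbol (S s) (ι s)
      (if φ s = φ (G.next s) then m₂ else
        if φ s then X (G.next (G.next s)) else Z (G.next (G.next s)))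
      (if φ s then Y s else Y' s) (if φ (G.next s) then Y' (G.next s) else Y (G.next s))
      (if φ s then m₀ else Z s) (if φ (G.next s) then Z (G.next s) else m₁)

/-- The coefficients that exchange the second fusion of the first operator at a dart with the first
fusion of the second operator. -/
noncomputable def stackCoeff (G : TrivalentMap D) (M : StringNetData L)
    (κ ι : D → L) (φ : D → Bool) (Y Y' : D → L) (a : D) (m t : L) : ℂ :=
  M.d t * if φ a then M.swapCoeff (κ (G.next (G.next a))) (ι a) (Y a) m (Y' a) t else
    M.swapCoeff (M.star (κ a)) (M.star (ι (G.next (G.next a)))) (Y a) m (Y' a) t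

section

variable {S : D → Prop} {κ ι : D → L} (hS : ∀ a, S (G.next a) ↔ S a)
  (hκ : ∀ a, ¬ S a → κ a = M.zero) (hι : ∀ a, ¬ S a → ι a = M.zero)

include hS hκ hι

theorem vertex_stack {φ : D → Bool} (X Y m Y' Z : D → L) (s : G.Least φ) :
    (G.halfCorner M S κ φ X Y m s * G.halfCorner M S κ φ X Y m (G.next s) *
        G.halfCorner M S κ φ X Y m (G.next (G.next s))) *
      (G.halfCorner M S ι φ m Y' Z s * G.halfCorner M S ι φ m Y' Z (G.next s) *
        G.halfCorner M S ι φ m Y' Z (G.next (G.next s))) =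
    ∑ p, ∑ q, ∑ r, (G.stackCoeff M κ ι φ Y Y' s (m s) p *
        G.stackCoeff M κ ι φ Y Y' (G.next s) (m (G.next s)) q *
        G.stackCoeff M κ ι φ Y Y' (G.next (G.next s)) (m (G.next (G.next s))) r) *
      (G.stackCorner M S κ ι φ X Y Y' Z s p q r *
        G.stackCorner M S κ ι φ X Y Y' Z (G.next s) q r p *
        G.stackCorner M S κ ι φ X Y Y' Z (G.next (G.next s)) r p q) := by
  obtain ⟨s, h0, h1⟩ := s
  have ka := hκ s
  have kb := hκ (G.next s)
  have kc := hκ (G.next (G.next s))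
  have ja := hι s
  have jb := hι (G.next s)
  have jc := hι (G.next (G.next s))
  simp only [hS] at kb kc jb jc
  -- The corner at `s` is the first; the value at the third dart decides which of the other two is
  -- the second.
  cases h2 : φ (G.next (G.next s)) <;>
    simp only [halfCorner, stackCorner, stackCoeff, G.next_next_next, hS, h0, h1, h2, if_true,
      if_false, reduceCtorEq]
  · exact M.cornerSymbol_stack kb kc ja jb _ _ _ _ _ _ _ _ _ _ _ _ _ _ _
  · exact M.cornerSymbol_stack' kb kc ja jc _ _ _ _ _ _ _ _ _ _ _ _ _ _ _

open scoped Classical in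
theorem prod_halfCorner_stack [Fintype D] {φ : D → Bool} (h : G.IsMixed φ) (X Y Y' Z m : D → L) :
    (∏ s, G.halfCorner M S κ φ X Y m s) * ∏ s, G.halfCorner M S ι φ m Y' Z s =
      ∑ η : D → L, (∏ a, G.stackCoeff M κ ι φ Y Y' a (m a) (η a)) *
        ∏ s, G.stackCorner M S κ ι φ X Y Y' Z s (η s) (η (G.next s)) (η (G.next (G.next s))) := by
  rw [h.prod_eq, h.prod_eq, ← Finset.prod_mul_distrib]
  simp only [vertex_stack hS hκ hι]
  rw [h.prod_sum_eq]
  refine Finset.sum_congr rfl fun η _ => ?_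
  rw [h.prod_eq, h.prod_eq, ← Finset.prod_mul_distrib]
  simp only [G.next_next_next]

end

end TrivalentMap

/-! ### The product of two operators. -/

namespace TrivalentMap

variable {D : Type*} {G : TrivalentMap D} {L : Type*} [Fintype L] {M : StringNetData L}

/-- The ways to fuse loops of types `κ` and `ι` in each plaquette. -/
def Fuses (G : TrivalentMap D) (M : StringNetData L) (κ ι μ : D → L) : Prop :=
  ∀ s, μ (G.facePerm s) = μ s ∧ M.allowed (κ s) (ι s) (M.star (μ s))

theorem facePerm_rev_next (s : D) : G.facePerm (G.rev (G.next s)) = s := by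
  simp [facePerm, G.rev_rev]

theorem next_next_eq_inv (s : D) : G.next (G.next s) = G.next⁻¹ s := by
  rw [Equiv.Perm.eq_inv_iff_eq, G.next_next_next]

theorem next_next_rev (s : D) : G.next (G.next (G.rev s)) = G.facePerm s := by
  rw [next_next_eq_inv]; rfl

namespace FusionOrder

variable (o : G.FusionOrder)

/-- The labels between two loops that are fused directly after each other into the side `s`. -/
def between (y y' : G.Config M) (s : D) : L := if o.first s then y.1 s else y'.1 s

/-- Each edge has two labels, one from each configuration, and two sides. Sides treated first read
`y` and the others `y'`, so the labels of the sides are free. -/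
theorem between_bijective : Function.Bijective
    fun p : G.Config M × G.Config M => o.between p.1 p.2 := by
  constructor
  · rintro ⟨y, y'⟩ ⟨w, w'⟩ h
    have h1 : ∀ a, o.first a = true → y.1 a = w.1 a := fun a ha => by
      have := congrFun h a
      simpa only [between, ha, if_true] using this
    have h2 : ∀ a, o.first a = false → y'.1 a = w'.1 a := fun a ha => by
      have := congrFun h a
      simpa only [between, ha, if_false, Bool.false_eq_true] using this
    have e1 : y = w := by
      apply Subtype.ext
      funext a
      cases ha : o.first a
      · have := h1 (G.rev a) (by rw [o.first_rev, ha]; rfl)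
        rw [y.2, w.2] at this
        exact M.star_injective this
      · exact h1 a ha
    have e2 : y' = w' := by
      apply Subtype.ext
      funext a
      cases ha : o.first a
      · exact h2 a ha
      · have := h2 (G.rev a) (by rw [o.first_rev, ha]; rfl)
        rw [y'.2, w'.2] at this
        exact M.star_injective this
    rw [e1, e2]
  · intro u
    refine ⟨(⟨fun a => if o.first a then u a else M.star (u (G.rev a)), fun a => ?_⟩,
      ⟨fun a => if o.first a then M.star (u (G.rev a)) else u a, fun a => ?_⟩), ?_⟩
    · cases ha : o.first a <;> simp [o.first_rev, ha, G.rev_rev]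
    · cases ha : o.first a <;> simp [o.first_rev, ha, G.rev_rev]
    · funext a
      cases ha : o.first a <;> simp [between, ha]

open scoped Classical in
theorem sum_between [Fintype D] (f : (D → L) → ℂ) :
    ∑ y : G.Config M, ∑ y' : G.Config M,
      (∏ s, M.v (y.1 s)) * (∏ s, M.v (y'.1 s)) * f (o.between y y') =
    ∑ u : D → L, (∏ s, M.d (u s)) * f u := by
  rw [← Fintype.sum_prod_type']
  refine Fintype.sum_bijective _ o.between_bijective _ _ fun p => ?_
  congr 1
  rw [← Finset.prod_mul_distrib]
  refine o.prod_congr_edges fun a => ?_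
  simp only [between, o.first_rev, p.1.2 a, p.2.2 a, M.v_star]
  cases ha : o.first a <;> simp [M.d_eq] <;> ring

open scoped Classical in
-- `fuse_corner` produces an independent type at every corner. The labels between the two loops are
-- free on every side, and summing over them equates the types at the ends of each side; so the type
-- is constant around each plaquette.
theorem sum_stackCorner [Fintype D] {S : D → Prop} {κ ι : D → L}
    (hκ : ∀ a, ¬ S a → κ a = M.zero) (hι : ∀ a, ¬ S a → ι a = M.zero)
    (hκf : ∀ a, κ (G.facePerm a) = κ a) (hιf : ∀ a, ι (G.facePerm a) = ι a)
    (x m z : G.Config M) :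
    ∑ y : G.Config M, ∑ y' : G.Config M, (∏ s, M.v (y.1 s)) * (∏ s, M.v (y'.1 s)) *
      (∏ s, G.stackCorner M S κ ι o.first (fun a => x.1 (G.rev a)) (fun a => y.1 (G.rev a))
        (fun a => y'.1 (G.rev a)) (fun a => z.1 (G.rev a)) s (m.1 (G.rev s))
        (m.1 (G.rev (G.next s))) (m.1 (G.rev (G.next (G.next s))))) =
    ∑ μ : D → L, if Fuses G M κ ι μ then
      ∏ s, G.halfCorner M S μ o.first (fun a => x.1 (G.rev a)) (fun a => m.1 (G.rev a))
        (fun a => z.1 (G.rev a)) s else 0 := by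
  set β : D → L := fun s => (o.before x m s).1 s with hβ
  set γ : D → L := fun s => (o.after m z s).1 s with hγ
  have hb (s : D) : (if o.first s then x.1 (G.rev s) else m.1 (G.rev s)) = M.star (β s) := by
    rw [hβ, ← (o.before x m s).2, before]; split_ifs <;> rfl
  have hb' (s : D) : (if o.first s then m.1 (G.rev s) else z.1 (G.rev s)) = M.star (γ s) := by
    rw [hγ, ← (o.after m z s).2, after]; split_ifs <;> rfl
  have hc (s : D) : (if o.first s then m.1 (G.rev s) else x.1 (G.rev s)) = β (G.rev s) := by
    simp only [hβ, before, o.first_rev]; cases o.first s <;> rfl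
  have hc' (s : D) : (if o.first s then z.1 (G.rev s) else m.1 (G.rev s)) = γ (G.rev s) := by
    simp only [hγ, after, o.first_rev]; cases o.first s <;> rfl
  have hu (y y' : G.Config M) (s : D) :
      (if o.first s then y.1 (G.rev s) else y'.1 (G.rev s)) = M.star (o.between y y' s) := by
    rw [between]; split_ifs
    · exact y.2 s
    · exact y'.2 s
  have hu' (y y' : G.Config M) (s : D) :
      (if o.first s then y'.1 (G.rev s) else y.1 (G.rev s)) = o.between y y' (G.rev s) := by
    rw [between, o.first_rev]; cases o.first s <;> rfl
  have e1 (y y' : G.Config M) (s : D) :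
      G.stackCorner M S κ ι o.first (fun a => x.1 (G.rev a)) (fun a => y.1 (G.rev a))
        (fun a => y'.1 (G.rev a)) (fun a => z.1 (G.rev a)) s (m.1 (G.rev s))
        (m.1 (G.rev (G.next s))) (m.1 (G.rev (G.next (G.next s)))) =
      ∑ k, M.d k * (M.fuseCoeff (κ s) (ι s) (M.star (β s)) (M.star (o.between y y' s))
          (M.star (γ s)) k *
        M.fuseCoeff' (κ s) (ι s) (β (G.rev (G.next s))) (o.between y y' (G.rev (G.next s)))
          (γ (G.rev (G.next s))) k *
        G.halfCorner M S (fun _ => k) o.first (fun a => x.1 (G.rev a)) (fun a => m.1 (G.rev a))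
          (fun a => z.1 (G.rev a)) s) := by
    rw [stackCorner, M.cornerSymbol_fuse (hκ s) (hι s)]
    simp only [hb, hb', hc, hc']
    rw [hu' y y']
    simp only [hu y y']
    simp only [halfCorner, hb, hb', hc, hc']
  simp only [e1]
  rw [o.sum_between fun u => ∏ s, ∑ k, M.d k * (M.fuseCoeff (κ s) (ι s) (M.star (β s))
    (M.star (u s)) (M.star (γ s)) k * M.fuseCoeff' (κ s) (ι s) (β (G.rev (G.next s)))
    (u (G.rev (G.next s))) (γ (G.rev (G.next s))) k *
        G.halfCorner M S (fun _ => k) o.first (fun a => x.1 (G.rev a)) (fun a => m.1 (G.rev a))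
          (fun a => z.1 (G.rev a)) s)]
  simp only [Finset.prod_univ_sum, Fintype.piFinset_univ, Finset.mul_sum]
  rw [Finset.sum_comm]
  refine Finset.sum_congr rfl fun μ _ => ?_
  -- Reindexing by sides: the side `s` receives `fuseCoeff` from the corner at its start and
  -- `fuseCoeff'` from the corner at its end, which is that of `facePerm s`.
  have e2 (u : D → L) : ∏ s, M.fuseCoeff' (κ s) (ι s) (β (G.rev (G.next s)))
      (u (G.rev (G.next s))) (γ (G.rev (G.next s))) (μ s) =
      ∏ s, M.fuseCoeff' (κ s) (ι s) (β s) (u s) (γ s) (μ (G.facePerm s)) := by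
    refine Fintype.prod_equiv (G.next.trans G.rev) _ _ fun s => ?_
    change _ = M.fuseCoeff' (κ (G.rev (G.next s))) (ι (G.rev (G.next s))) (β (G.rev (G.next s)))
      (u (G.rev (G.next s))) (γ (G.rev (G.next s))) (μ (G.facePerm (G.rev (G.next s))))
    rw [← hκf (G.rev (G.next s)), ← hιf (G.rev (G.next s)), facePerm_rev_next]
  have e3 (u : D → L) : (∏ s, M.d (u s)) * ∏ s, M.d (μ s) * (M.fuseCoeff (κ s) (ι s)
      (M.star (β s)) (M.star (u s)) (M.star (γ s)) (μ s) *
        M.fuseCoeff' (κ s) (ι s) (β (G.rev (G.next s)))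
        (u (G.rev (G.next s))) (γ (G.rev (G.next s))) (μ s) *
        G.halfCorner M S (fun _ => μ s) o.first (fun a => x.1 (G.rev a)) (fun a => m.1 (G.rev a))
          (fun a => z.1 (G.rev a)) s) =
      (∏ s, M.d (u s) * (M.fuseCoeff (κ s) (ι s) (M.star (β s)) (M.star (u s)) (M.star (γ s)) (μ s)
        * M.fuseCoeff' (κ s) (ι s) (β s) (u s) (γ s) (μ (G.facePerm s)))) *
      ∏ s, M.d (μ s) * G.halfCorner M S μ o.first (fun a => x.1 (G.rev a))
        (fun a => m.1 (G.rev a)) (fun a => z.1 (G.rev a)) s := by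
    simp only [Finset.prod_mul_distrib, e2]
    have : ∏ s, G.halfCorner M S (fun _ => μ s) o.first (fun a => x.1 (G.rev a))
        (fun a => m.1 (G.rev a)) (fun a => z.1 (G.rev a)) s = ∏ s, G.halfCorner M S μ o.first
        (fun a => x.1 (G.rev a)) (fun a => m.1 (G.rev a)) (fun a => z.1 (G.rev a)) s := rfl
    rw [this]
    ring
  simp only [e3]
  rw [← Finset.sum_mul]
  have e4 : ∑ u : D → L, ∏ s, M.d (u s) * (M.fuseCoeff (κ s) (ι s) (M.star (β s)) (M.star (u s))
      (M.star (γ s)) (μ s) * M.fuseCoeff' (κ s) (ι s) (β s) (u s) (γ s) (μ (G.facePerm s))) =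
      ∏ s, if μ s = μ (G.facePerm s) ∧ M.allowed (κ s) (ι s) (M.star (μ s)) ∧
        M.allowed (β s) (M.star (γ s)) (μ s) then (M.d (μ s))⁻¹ else 0 := by
    have h0 := Finset.prod_univ_sum (fun _ : D => (Finset.univ : Finset L)) fun s t =>
      M.d t * (M.fuseCoeff (κ s) (ι s) (M.star (β s)) (M.star t)
      (M.star (γ s)) (μ s) * M.fuseCoeff' (κ s) (ι s) (β s) t (γ s) (μ (G.facePerm s)))
    rw [Fintype.piFinset_univ] at h0
    rw [← h0]
    refine Finset.prod_congr rfl fun s _ => ?_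
    have h1 := M.fuseCoeff_orthogonality (κ s) (ι s) (M.star (β s)) (M.star (γ s)) (μ s)
      (μ (G.facePerm s))
    rw [M.star_star, M.star_star] at h1
    rw [← h1]
    refine Fintype.sum_equiv (Function.Involutive.toPerm M.star M.star_star) _ _ fun t => ?_
    change _ = M.d (M.star t) * (M.fuseCoeff (κ s) (ι s) (M.star (β s)) (M.star t)
      (M.star (γ s)) (μ s) * M.fuseCoeff' (κ s) (ι s) (β s) (M.star (M.star t)) (γ s)
        (μ (G.facePerm s)))
    rw [M.star_star, M.d_star]
  rw [e4]
  by_cases hF : Fuses G M κ ι μ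
  · rw [if_pos hF, ← Finset.prod_mul_distrib]
    refine Finset.prod_congr rfl fun s _ => ?_
    have hμ : ¬ S s → μ s = M.zero := fun h => by
      have := (hF s).2
      rw [hκ s h, hι s h, M.allowed_zero_left, M.star_inj] at this
      simpa using this
    -- A nonzero corner supplies the remaining admissibility condition; then the weight `d (μ s)` of
    -- the fusion cancels the inverse weight from orthogonality.
    by_cases h0 : G.halfCorner M S μ o.first (fun a => x.1 (G.rev a))
        (fun a => m.1 (G.rev a)) (fun a => z.1 (G.rev a)) s = 0
    · rw [h0, mul_zero, mul_zero]
    · have h1 := (cornerSymbol_allowed hμ h0).2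
      simp only [hb, hb', M.star_star] at h1
      rw [if_pos ⟨(hF s).1.symm, (hF s).2, by
        rwa [M.allowed_swap_iff, M.allowed_rotate_iff]⟩, ← mul_assoc,
          inv_mul_cancel₀ (M.d_ne_zero _), one_mul]
  · rw [if_neg hF]
    obtain ⟨s, hs⟩ := not_forall.1 hF
    rw [Finset.prod_eq_zero (Finset.mem_univ s), zero_mul]
    rw [if_neg]
    exact fun h => hs ⟨h.1.symm, h.2.1⟩

/-- The admissibility conditions on a label after the exchange of two fusions. -/
def stackCond (G : TrivalentMap D) (M : StringNetData L) (κ ι : D → L)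
    (φ : D → Bool) (Y Y' : D → L) (a : D) (t : L) : Prop :=
  if φ a then M.allowed (M.star (Y a)) t (ι a) ∧
    M.allowed (M.star (Y' a)) (κ (G.next (G.next a))) t
  else M.allowed (M.star (Y a)) t (M.star (ι (G.next (G.next a)))) ∧
    M.allowed (M.star (Y' a)) (M.star (κ a)) t

open scoped Classical in
theorem sum_stackCoeff [Fintype D] {κ ι : D → L}
    (hκf : ∀ a, κ (G.facePerm a) = κ a) (hιf : ∀ a, ι (G.facePerm a) = ι a)
    (y y' : G.Config M) (a : D) (t u : L) :
    ∑ m, M.d m * (G.stackCoeff M κ ι o.first (fun a => y.1 (G.rev a))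
        (fun a => y'.1 (G.rev a)) a m t *
      G.stackCoeff M κ ι o.first (fun a => y.1 (G.rev a))
        (fun a => y'.1 (G.rev a)) (G.rev a) (M.star m) u) =
      if t = M.star u ∧ stackCond G M κ ι o.first (fun a => y.1 (G.rev a))
        (fun a => y'.1 (G.rev a)) a t then M.d t else 0 := by
  have hd := M.d_ne_zero
  have h1 (μ : D → L) (h : ∀ a, μ (G.facePerm a) = μ a) : μ (G.next (G.next (G.rev a))) = μ a := by
    rw [next_next_rev, h]
  have h2 (μ : D → L) (h : ∀ a, μ (G.facePerm a) = μ a) : μ (G.rev a) = μ (G.next (G.next a)) := by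
    rw [← h, facePerm, Equiv.Perm.mul_apply, G.rev_rev, next_next_eq_inv]
  have hx := y.2 a
  have hz := y'.2 a
  simp only [stackCoeff, h1 κ hκf, h1 ι hιf, h2 κ hκf, h2 ι hιf, G.rev_rev, hx, hz, stackCond,
    o.first_rev]
  have key (i j i' j' : L) (hi : i' = M.star i) (hj : j' = M.star j) (x z : L) :
      ∑ y, M.d y * (M.d t * M.swapCoeff i j (M.star x) y (M.star z) t *
        (M.d u * M.swapCoeff i' j' x (M.star y) z u)) =
      if t = M.star u ∧ M.allowed (M.star (M.star x)) t j ∧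
        M.allowed (M.star (M.star z)) i t then M.d t else 0 := by
    have h := M.swapCoeff_orthogonality i j (M.star x) (M.star z) t u
    rw [M.star_star x, M.star_star z] at h ⊢
    rw [hi, hj]
    calc _ = M.d t * M.d u * ∑ y, M.d y * (M.swapCoeff i j (M.star x) y (M.star z) t *
        M.swapCoeff (M.star i) (M.star j) x (M.star y) z u) := by
          rw [Finset.mul_sum]
          exact Finset.sum_congr rfl fun y _ => by ring
      _ = _ := by
        rw [h]
        split_ifs with hc
        · rw [hc.1, M.d_star]
          field_simp [hd u]
        · rw [mul_zero]
  cases o.first a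
  · exact key (M.star (κ a)) (M.star (ι (G.next (G.next a)))) _ _
      (M.star_star _).symm (M.star_star _).symm (y.1 a) (y'.1 a)
  · exact key (κ (G.next (G.next a))) (ι a) _ _ rfl rfl (y.1 a) (y'.1 a)

theorem stackCond_of_ne_zero [Fintype D] {S : D → Prop} {κ ι : D → L}
    (hκ : ∀ a, ¬ S a → κ a = M.zero) (hι : ∀ a, ¬ S a → ι a = M.zero) (X Y Y' Z η : D → L)
    (h : ∏ s, G.stackCorner M S κ ι o.first X Y Y' Z s (η s) (η (G.next s))
      (η (G.next (G.next s))) ≠ 0) (a : D) :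
    stackCond G M κ ι o.first Y Y' a (η a) := by
  have h1 := Finset.prod_ne_zero_iff.1 h a (Finset.mem_univ _)
  have h2 := Finset.prod_ne_zero_iff.1 h (G.next (G.next a)) (Finset.mem_univ _)
  rw [stackCorner, mul_ne_zero_iff] at h1 h2
  have a1 := (cornerSymbol_allowed (hκ _) h1.1).2
  have a2 := (cornerSymbol_allowed (hι _) h1.2).2
  have b1 := (cornerSymbol_allowed (hκ _) h2.1).1
  have b2 := (cornerSymbol_allowed (hι _) h2.2).1
  rw [G.next_next_next] at b1 b2
  rw [stackCond]
  cases e : o.first a <;> simp only [e, if_true, Bool.false_eq_true, if_false] at a1 a2 b1 b2 ⊢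
  · refine ⟨b2, ?_⟩
    rw [← M.allowed_star_iff, M.allowed_reverse_iff, M.star_star, M.star_star]
    exact a1
  · refine ⟨?_, ?_⟩
    · rw [M.allowed_swap_iff, M.allowed_rotate_iff]
      exact a2
    · rw [M.allowed_rotate_iff, M.allowed_rotate_iff, ← M.allowed_star_iff, M.star_star]
      exact b1

open scoped Classical in
theorem multiLoop_mul [Fintype D] {S : D → Prop} {κ ι : D → L} (hS : ∀ a, S (G.next a) ↔ S a)
    (hκ : ∀ a, ¬ S a → κ a = M.zero) (hι : ∀ a, ¬ S a → ι a = M.zero)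
    (hκf : ∀ a, κ (G.facePerm a) = κ a) (hιf : ∀ a, ι (G.facePerm a) = ι a) :
    o.multiLoop M S ι * o.multiLoop M S κ =
      ∑ μ : D → L, if Fuses G M κ ι μ then o.multiLoop M S μ else 0 := by
  ext z x
  rw [Matrix.mul_apply, Matrix.sum_apply]
  have e1 (μ : D → L) : (if Fuses G M κ ι μ then o.multiLoop M S μ else 0) z x =
      (∏ s, if o.first s then M.v (x.1 s) else M.v (z.1 s)) * ∑ m : G.Config M,
        (∏ s, M.v (m.1 s)) * if Fuses G M κ ι μ then ∏ s, G.halfCorner M S μ o.first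
          (fun a => x.1 (G.rev a)) (fun a => m.1 (G.rev a)) (fun a => z.1 (G.rev a)) s else 0 := by
    split_ifs
    · rw [o.multiLoop_apply]
    · simp
  simp only [e1]
  rw [← Finset.mul_sum, Finset.sum_comm]
  simp only [← Finset.mul_sum, ← o.sum_stackCorner hκ hι hκf hιf]
  have e2 (m : G.Config M) : o.multiLoop M S ι z m * o.multiLoop M S κ m x =
      (∏ s, if o.first s then M.v (x.1 s) else M.v (z.1 s)) *
      ∑ y : G.Config M, ∑ y' : G.Config M, (∏ s, M.v (y.1 s)) * (∏ s, M.v (y'.1 s)) *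
        ((∏ s, M.v (m.1 s)) *
          ((∏ s, G.halfCorner M S κ o.first (fun a => x.1 (G.rev a)) (fun a => y.1 (G.rev a))
            (fun a => m.1 (G.rev a)) s) *
          ∏ s, G.halfCorner M S ι o.first (fun a => m.1 (G.rev a)) (fun a => y'.1 (G.rev a))
            (fun a => z.1 (G.rev a)) s)) := by
    rw [o.multiLoop_apply, o.multiLoop_apply]
    have : (∏ s, if o.first s then M.v (m.1 s) else M.v (z.1 s)) *
        (∏ s, if o.first s then M.v (x.1 s) else M.v (m.1 s)) =
        (∏ s, if o.first s then M.v (x.1 s) else M.v (z.1 s)) * ∏ s, M.v (m.1 s) := by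
      rw [← Finset.prod_mul_distrib, ← Finset.prod_mul_distrib]
      refine Finset.prod_congr rfl fun s _ => ?_
      split_ifs <;> ring
    rw [mul_mul_mul_comm, this, mul_assoc]
    congr 1
    rw [mul_comm (∑ y : G.Config M, _) (∑ y : G.Config M, _), Finset.sum_mul_sum, Finset.mul_sum]
    refine Finset.sum_congr rfl fun y _ => ?_
    rw [Finset.mul_sum]
    exact Finset.sum_congr rfl fun y' _ => by ring
  simp only [e2, ← Finset.mul_sum]
  congr 1
  simp only [Finset.mul_sum]
  rw [Finset.sum_comm]
  conv_rhs => rw [Finset.sum_comm]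
  refine Finset.sum_congr rfl fun y _ => ?_
  rw [Finset.sum_comm]
  conv_rhs => rw [Finset.sum_comm]
  refine Finset.sum_congr rfl fun y' _ => ?_
  -- The sum over the labels between the two operators absorbs the exchange coefficients.
  have key := sum_config_gauge (M := M) o _ _ _ _
    (prod_halfCorner_stack hS hκ hι o.mixed (fun a => x.1 (G.rev a)) (fun a => y.1 (G.rev a))
      (fun a => y'.1 (G.rev a)) (fun a => z.1 (G.rev a)))
    (o.sum_stackCoeff hκf hιf y y') (o.stackCond_of_ne_zero hκ hι _ _ _ _)
  simp only [mul_assoc, ← Finset.mul_sum]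
  simp only [key, Finset.mul_sum]
  exact Finset.sum_congr rfl fun m _ => by ring

end FusionOrder

end TrivalentMap

/-! ### Trivial loops and the branching rule. -/

namespace TrivalentMap

/-- The triples of labels at a vertex, before and after each of the three corners is resolved, are
all allowed or all forbidden, provided that this holds at each corner that changes a label. -/
theorem triple_chain {L : Type*} {p : L → L → L → Prop} (hp : ∀ i j k, p i j k → p j k i)
    (f g h : Bool) (hm : ¬ (f = g ∧ g = h)) (x₀ x₁ x₂ y₀ y₁ y₂ z₀ z₁ z₂ : L)
    (h₀ : ((if f then x₀ else y₀) = (if f then y₀ else z₀) ∧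
        (if g then y₁ else x₁) = (if g then z₁ else y₁)) ∨
      (p (if f = g then y₂ else if f then x₂ else z₂) (if f then x₀ else y₀)
        (if g then y₁ else x₁) ∧
      p (if f = g then y₂ else if f then x₂ else z₂) (if f then y₀ else z₀)
        (if g then z₁ else y₁)))
    (h₁ : ((if g then x₁ else y₁) = (if g then y₁ else z₁) ∧
        (if h then y₂ else x₂) = (if h then z₂ else y₂)) ∨
      (p (if g = h then y₀ else if g then x₀ else z₀) (if g then x₁ else y₁)
        (if h then y₂ else x₂) ∧
      p (if g = h then y₀ else if g then x₀ else z₀) (if g then y₁ else z₁)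
        (if h then z₂ else y₂)))
    (h₂ : ((if h then x₂ else y₂) = (if h then y₂ else z₂) ∧
        (if f then y₀ else x₀) = (if f then z₀ else y₀)) ∨
      (p (if h = f then y₁ else if h then x₁ else z₁) (if h then x₂ else y₂)
        (if f then y₀ else x₀) ∧
      p (if h = f then y₁ else if h then x₁ else z₁) (if h then y₂ else z₂)
        (if f then z₀ else y₀))) :
    (p (if f = g then y₂ else if f then x₂ else z₂) (if f then x₀ else y₀)
        (if g then y₁ else x₁) ↔ p x₀ x₁ x₂) ∧ (p z₀ z₁ z₂ ↔ p x₀ x₁ x₂) := by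
  have hp' : ∀ i j k, p i j k ↔ p j k i := fun i j k =>
    ⟨hp _ _ _, fun h => hp _ _ _ (hp _ _ _ h)⟩
  cases f <;> cases g <;> cases h <;> simp at hm h₀ h₁ h₂ ⊢ <;> grind

variable {D : Type*} {G : TrivalentMap D} {L : Type*} [Fintype L] {M : StringNetData L}

/-- The labels that arrive at the vertex of `a` form an allowed triple. -/
def Config.AllowedAt (x : G.Config M) (a : D) : Prop :=
  M.allowed (x.1 (G.rev a)) (x.1 (G.rev (G.next a))) (x.1 (G.rev (G.next (G.next a))))

theorem Config.allowedAt_next (x : G.Config M) (a : D) :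
    x.AllowedAt (G.next a) ↔ x.AllowedAt a := by
  rw [AllowedAt, AllowedAt, G.next_next_next, M.allowed_rotate_iff, M.allowed_rotate_iff]

/-- The vertex of `a` lies on the boundary of `q`. -/
def Touches (q : G.Face) (a : D) : Prop :=
  ∃ b, G.vertex b = G.vertex a ∧ G.face b = q

theorem touches_next {q : G.Face} {a : D} :
    G.Touches q (G.next a) ↔ G.Touches q a := by
  rw [Touches, Touches, G.vertex_next]

open scoped Classical in
/-- The type of the loop to the left of each dart when there is one of type `i` in `q`. -/
noncomputable def loopType (M : StringNetData L) (q : G.Face) (i : L) (a : D) :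
    L :=
  if G.face a = q then i else M.zero

theorem face_facePerm (a : D) : G.face (G.facePerm a) = G.face a :=
  Quotient.sound (Equiv.Perm.SameCycle.symm ⟨1, by simp⟩)

theorem face_rev_next (a : D) : G.face (G.rev (G.next a)) = G.face a := by
  rw [← G.face_facePerm (G.rev (G.next a)), facePerm_rev_next]

namespace FusionOrder

variable (o : G.FusionOrder)

/-- Nothing changes at the corner between `s` and `next s`. -/
def IsTrivial (x y z : G.Config M) (s : D) : Prop :=
  (o.before x y s).1 s = (o.after y z s).1 s ∧
    (o.before x y (G.rev (G.next s))).1 (G.rev (G.next s)) =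
      (o.after y z (G.rev (G.next s))).1 (G.rev (G.next s))

/-- The labels at the corner between `s` and `next s` before it is resolved are allowed. -/
def AllowedBefore (x y z : G.Config M) (s : D) : Prop :=
  M.allowed ((o.leg x y z s).1 (G.rev (G.next (G.next s)))) ((o.before x y s).1 (G.rev s))
    ((o.before x y (G.rev (G.next s))).1 (G.rev (G.next s)))

/-- The labels at the corner between `s` and `next s` after it is resolved are allowed. -/
def AllowedAfter (x y z : G.Config M) (s : D) : Prop :=
  M.allowed ((o.leg x y z s).1 (G.rev (G.next (G.next s)))) ((o.after y z s).1 (G.rev s))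
    ((o.after y z (G.rev (G.next s))).1 (G.rev (G.next s)))

theorem before_eq (x y : G.Config M) (s b : D) :
    (o.before x y s).1 b = if o.first s then x.1 b else y.1 b := by
  rw [before]; split_ifs <;> rfl

theorem after_eq (y z : G.Config M) (s b : D) :
    (o.after y z s).1 b = if o.first s then y.1 b else z.1 b := by
  rw [after]; split_ifs <;> rfl

theorem before_rev_eq (x y : G.Config M) (s b : D) :
    (o.before x y (G.rev s)).1 b = if o.first s then y.1 b else x.1 b := by
  rw [before_eq, o.first_rev]; cases o.first s <;> rfl

theorem after_rev_eq (y z : G.Config M) (s b : D) :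
    (o.after y z (G.rev s)).1 b = if o.first s then z.1 b else y.1 b := by
  rw [after_eq, o.first_rev]; cases o.first s <;> rfl

theorem leg_eq (x y z : G.Config M) (s b : D) :
    (o.leg x y z s).1 b = if o.first s = o.first (G.next s) then y.1 b else
      if o.first s then x.1 b else z.1 b := by
  rw [leg]; cases o.first s <;> cases o.first (G.next s) <;> rfl

theorem isTrivial_iff (x y z : G.Config M) (s : D) : o.IsTrivial x y z s ↔
    ((if o.first s then x.1 (G.rev s) else y.1 (G.rev s)) =
      (if o.first s then y.1 (G.rev s) else z.1 (G.rev s)) ∧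
    (if o.first (G.next s) then y.1 (G.rev (G.next s)) else x.1 (G.rev (G.next s))) =
      if o.first (G.next s) then z.1 (G.rev (G.next s)) else y.1 (G.rev (G.next s))) := by
  have e : (o.before x y s).1 s = (o.after y z s).1 s ↔
      (o.before x y s).1 (G.rev s) = (o.after y z s).1 (G.rev s) := by
    rw [(o.before x y s).2, (o.after y z s).2, M.star_inj]
  rw [IsTrivial, e, before_rev_eq, after_rev_eq, before_eq, after_eq]

theorem allowedBefore_chain {x y z : G.Config M} {s : D}
    (h : ∀ b, G.vertex b = G.vertex s → o.IsTrivial x y z b ∨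
      (o.AllowedBefore x y z b ∧ o.AllowedAfter x y z b)) :
    (o.AllowedBefore x y z s ↔ x.AllowedAt s) ∧ (z.AllowedAt s ↔ x.AllowedAt s) := by
  have h₀ := h s rfl
  have h₁ := h (G.next s) (G.vertex_next s)
  have h₂ := h (G.next (G.next s)) (by rw [G.vertex_next, G.vertex_next])
  simp only [AllowedBefore, AllowedAfter, G.next_next_next, before_rev_eq, after_rev_eq]
    at h₀ h₁ h₂ ⊢
  simp only [isTrivial_iff, before_eq, after_eq, leg_eq, G.next_next_next] at h₀ h₁ h₂ ⊢
  exact triple_chain (p := M.allowed) M.allowed_rotate _ _ _ (o.mixed s) _ _ _ _ _ _ _ _ _ h₀ h₁ h₂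

theorem allowed_of_cornerFactor_ne_zero {i : L} {x y z : G.Config M} {s : D}
    (h : o.cornerFactor i x y z s ≠ 0) : o.AllowedBefore x y z s ∧ o.AllowedAfter x y z s := by
  obtain ⟨⟨h1, -⟩, h2, -⟩ := M.physicality _ _ _ _ _ _ h
  exact ⟨h1, M.allowed_rotate _ _ _ (M.allowed_rotate _ _ _ (M.allowed_reverse_iff.1 h2))⟩

open scoped Classical in
-- A trivial loop changes no label but still tests the branching rule. This is the only difference
-- between a vertex inside and outside `S` when no string passes.
theorem cornerFactor_zero (x y z : G.Config M) (s : D) : o.cornerFactor M.zero x y z s =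
    if o.IsTrivial x y z s ∧ o.AllowedBefore x y z s then 1 else 0 := by
  have hv := M.v_ne_zero
  rw [cornerFactor, M.F_eq, M.star_zero, M.sixj_zero₄, IsTrivial, AllowedBefore,
    (o.before x y s).2, (o.after y z s).2, M.star_inj]
  by_cases h1 : (o.before x y (G.rev (G.next s))).1 (G.rev (G.next s)) =
    (o.after y z (G.rev (G.next s))).1 (G.rev (G.next s))
  · rw [← h1, M.allowed_reverse_iff]
    by_cases h2 : (o.before x y s).1 s = (o.after y z s).1 s
    · simp only [h2, true_and, and_true]
      split_ifs
      · rw [inv_mul_cancel₀]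
        exact mul_ne_zero (hv _) (hv _)
      · rw [zero_mul]
    · simp [h2]
  · simp [h1]

theorem isTrivial_or_allowed {S : D → Prop} {ι : D → L} {x y z : G.Config M} {s : D}
    (h : o.localFactor S ι x y z s ≠ 0) :
    o.IsTrivial x y z s ∨ (o.AllowedBefore x y z s ∧ o.AllowedAfter x y z s) := by
  rw [localFactor] at h
  split_ifs at h with h1 h2
  · exact Or.inr (o.allowed_of_cornerFactor_ne_zero h)
  · exact Or.inl h2
  · exact absurd rfl h

theorem localFactor_mono {S S' : D → Prop} (hSS : ∀ a, S a → S' a) {ι : D → L}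
    (hι : ∀ a, ¬ S a → ι a = M.zero) {x y z : G.Config M} {s : D}
    (h : S' s → ¬ S s → o.IsTrivial x y z s → o.AllowedBefore x y z s) :
    o.localFactor S' ι x y z s = o.localFactor S ι x y z s := by
  classical
  rw [localFactor, localFactor]
  by_cases h1 : S s
  · rw [if_pos h1, if_pos (hSS _ h1)]
  · rw [if_neg h1]
    split_ifs with h2 h3 h3
    · rw [hι _ h1, cornerFactor_zero, if_pos ⟨h3, h h2 h1 h3⟩]
    · rw [hι _ h1, cornerFactor_zero, if_neg fun h => h3 h.1]
    · rfl
    · rfl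

variable [Fintype D]

open scoped Classical in
-- The added vertices carry only trivial loops, which test the branching rule. By
-- `allowedBefore_chain` the result of this test is the same at all stages, so it can be read off
-- from `x`.
theorem multiLoop_mono {S S' : D → Prop} (hSS : ∀ a, S a → S' a)
    {ι : D → L} (hι : ∀ a, ¬ S a → ι a = M.zero) (hS' : ∀ a, S' (G.next a) ↔ S' a)
    (z x : G.Config M) :
    o.multiLoop M S' ι z x =
      if ∀ a, S' a → x.AllowedAt a then o.multiLoop M S ι z x else 0 := by
  have hv : ∀ a b, G.vertex b = G.vertex a → S' a → S' b := fun a b h ha => by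
    rcases G.eq_of_vertex_eq h with rfl | rfl | rfl
    · exact ha
    · exact (hS' _).1 ha
    · exact (hS' _).1 ((hS' _).1 ha)
  have key (y : G.Config M) (h : ∏ s, o.localFactor S' ι x y z s ≠ 0) :
      (∀ a, S' a → x.AllowedAt a) ∧
      ∏ s, o.localFactor S' ι x y z s = ∏ s, o.localFactor S ι x y z s := by
    have h0 := fun s => Finset.prod_ne_zero_iff.1 h s (Finset.mem_univ s)
    have h1 : ∀ s, S' s → o.AllowedBefore x y z s := fun s hs => by
      have := h0 s
      rw [localFactor, if_pos hs] at this
      exact (o.allowed_of_cornerFactor_ne_zero this).1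
    refine ⟨fun a ha => ?_, Finset.prod_congr rfl fun s _ =>
      o.localFactor_mono hSS hι fun hs _ _ => h1 s hs⟩
    exact (o.allowedBefore_chain fun b _ => o.isTrivial_or_allowed (h0 b)).1.1 (h1 a ha)
  split_ifs with hx
  · refine Finset.sum_congr rfl fun y _ => ?_
    by_cases h : ∏ s, o.localFactor S ι x y z s = 0
    · by_contra h'
      rw [h] at h'
      exact h' ((key y h').2.trans h)
    · have h0 := fun s => Finset.prod_ne_zero_iff.1 h s (Finset.mem_univ s)
      exact Finset.prod_congr rfl fun s _ => o.localFactor_mono hSS hι fun hs _ _ =>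
        (o.allowedBefore_chain fun b _ => o.isTrivial_or_allowed (h0 b)).1.2 (hx s hs)
  · refine Finset.sum_eq_zero fun y _ => ?_
    by_contra h
    exact hx (key y h).1

/-- The configurations that a multiloop connects are both allowed where a loop passes. -/
theorem allowedAt_of_multiLoop_ne_zero {S : D → Prop} {ι : D → L} {z x : G.Config M}
    (h : o.multiLoop M S ι z x ≠ 0) {a b : D} (hab : G.vertex b = G.vertex a) (hb : S b) :
    x.AllowedAt a ∧ z.AllowedAt a := by
  obtain ⟨y, -, hy⟩ := Finset.exists_ne_zero_of_sum_ne_zero h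
  have h0 := fun s => Finset.prod_ne_zero_iff.1 hy s (Finset.mem_univ s)
  have h1 := h0 b
  rw [localFactor, if_pos hb] at h1
  have h2 := o.allowedBefore_chain (s := b) fun b _ => o.isTrivial_or_allowed (h0 b)
  have h3 := h2.1.1 (o.allowed_of_cornerFactor_ne_zero h1).1
  have h4 := h2.2.2 h3
  rcases G.eq_of_vertex_eq hab with rfl | rfl | rfl
  · exact ⟨h3, h4⟩
  · simp only [Config.allowedAt_next]
    exact ⟨h3, h4⟩
  · simp only [Config.allowedAt_next]
    exact ⟨h3, h4⟩

theorem loopOp_eq_sides (q : G.Face) (i : L) :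
    o.loopOp M q i = o.multiLoop M (fun a => G.face a = q) (G.loopType M q i) := by
  classical
  ext z x
  refine Finset.sum_congr rfl fun y _ => ?_
  have h1 : (∀ s, G.face s ≠ q → (o.before x y s).1 s = (o.after y z s).1 s) ↔
      ∀ s, G.face s ≠ q → o.IsTrivial x y z s :=
    ⟨fun h s hs => ⟨h s hs, h _ (by rwa [G.face_rev_next])⟩, fun h s hs => (h s hs).1⟩
  rw [Finset.prod_filter]
  by_cases h : ∀ s, G.face s ≠ q → o.IsTrivial x y z s
  · rw [if_pos (h1.2 h)]
    refine Finset.prod_congr rfl fun s _ => ?_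
    rw [localFactor, loopType]
    split_ifs with h2 h3
    · rfl
    · rfl
    · exact absurd (h s h2) h3
  · rw [if_neg (mt h1.1 h)]
    push Not at h
    obtain ⟨s, h2, h3⟩ := h
    refine (Finset.prod_eq_zero (Finset.mem_univ s) ?_).symm
    rw [localFactor, if_neg h2]
    exact if_neg h3

/-- Independence of the order and fusion need a set `S` of whole vertices. Enlarging the sides of
`q` to all vertices that it touches adds no condition, because the loop already enforces the
branching rule there. -/
theorem loopOp_eq (q : G.Face) (i : L) :
    o.loopOp M q i = o.multiLoop M (G.Touches q) (G.loopType M q i) := by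
  classical
  rw [loopOp_eq_sides]
  ext z x
  rw [o.multiLoop_mono (S := fun a => G.face a = q) (ι := G.loopType M q i)
    (fun a h => ⟨a, rfl, h⟩) (fun a h => if_neg h)
    (fun a => touches_next)]
  split_ifs with h
  · rfl
  · by_contra h'
    exact h fun a ⟨b, hb, hb'⟩ => (o.allowedAt_of_multiLoop_ne_zero h' hb hb').1

end FusionOrder

end TrivalentMap

/-! ### Adjoints and the fusion algebra of loops in a plaquette. -/

namespace TrivalentMap

variable {D : Type*} {G : TrivalentMap D} {L : Type*} [Fintype L] {M : StringNetData L}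

/-- Under conjugation the labels before and after the fusion trade places and the loop is reversed.
-/
theorem _root_.StringNetData.conj_sixj_mul (M : StringNetData L) (i a b c b' c' : L) :
    starRingEnd ℂ (M.F a b c (M.star i) c' b') * (M.v c' * M.v b) =
      M.F a b' c' i c b * (M.v c * M.v b') := by
  rw [M.unitarity, M.star_star, M.F_eq, M.F_eq, M.v_star, M.v_star, M.sixj_one, M.sixj_two,
    M.sixj_three, M.sixj_one, M.sixj_two]
  simp only [M.star_star]
  ring

namespace FusionOrder

variable (o : G.FusionOrder)

/-- The reversed order. -/
def opposite : G.FusionOrder where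
  first a := !o.first a
  first_rev a := by rw [o.first_rev]
  mixed a := by
    have := o.mixed a
    simpa using this

theorem opposite_before (x y : G.Config M) (s : D) : o.opposite.before x y s = o.after y x s := by
  rw [before, after, show o.opposite.first s = !o.first s from rfl]
  rcases Bool.eq_false_or_eq_true (o.first s) with h | h <;> simp [h]

theorem opposite_after (y z : G.Config M) (s : D) : o.opposite.after y z s = o.before z y s := by
  rw [before, after, show o.opposite.first s = !o.first s from rfl]
  rcases Bool.eq_false_or_eq_true (o.first s) with h | h <;> simp [h]

theorem opposite_leg (x y z : G.Config M) (s : D) : o.opposite.leg x y z s = o.leg z y x s := by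
  simp only [leg, opposite]
  cases o.first s <;> cases o.first (G.next s) <;> rfl

theorem conj_localFactor (S : D → Prop) (ι : D → L) (x y z : G.Config M) (s : D) :
    starRingEnd ℂ (o.localFactor S ι z y x s) *
        (M.v ((o.after y x (G.rev (G.next s))).1 (G.rev (G.next s))) *
          M.v ((o.before z y s).1 s)) =
      o.opposite.localFactor S (fun a => M.star (ι a)) x y z s *
        (M.v ((o.before z y (G.rev (G.next s))).1 (G.rev (G.next s))) *
          M.v ((o.after y x s).1 s)) := by
  have before_after {s : D} (h : (o.before z y s).1 s = (o.after y x s).1 s) :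
      (o.opposite.before x y s).1 s = (o.opposite.after y z s).1 s := by
    rw [opposite_before, opposite_after, h]
  have before_after' {s : D} (h : (o.opposite.before x y s).1 s = (o.opposite.after y z s).1 s) :
      (o.before z y s).1 s = (o.after y x s).1 s := by
    rw [← opposite_before, ← opposite_after, h]
  rw [localFactor, localFactor, cornerFactor, cornerFactor]
  simp only [opposite_before, opposite_after, opposite_leg]
  split_ifs with h1 h2 h3 h3
  · have h := M.conj_sixj_mul (ι s) ((o.leg z y x s).1 (G.rev (G.next (G.next s))))
      ((o.before z y s).1 (G.rev s)) ((o.before z y (G.rev (G.next s))).1 (G.rev (G.next s)))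
      ((o.after y x s).1 (G.rev s)) ((o.after y x (G.rev (G.next s))).1 (G.rev (G.next s)))
    have e1 : M.v ((o.before z y s).1 (G.rev s)) = M.v ((o.before z y s).1 s) := by
      rw [(o.before z y s).2, M.v_star]
    have e2 : M.v ((o.after y x s).1 (G.rev s)) = M.v ((o.after y x s).1 s) := by
      rw [(o.after y x s).2, M.v_star]
    rw [e1, e2] at h
    rw [M.star_star]
    exact h
  · rw [h2.1, h2.2, map_one]
  · exact absurd ⟨(before_after h2.1), (before_after h2.2)⟩ h3
  · exact absurd ⟨(before_after' h3.1), (before_after' h3.2)⟩ h2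
  · simp

variable [Fintype D]

/-- The adjoint undoes the fusions in the opposite order with reversed loops, and the order does not
matter. The weights `v` of the single corners cancel in the product over all corners. -/
theorem multiLoop_conjTranspose {S : D → Prop} {ι : D → L} (hS : ∀ a, S (G.next a) ↔ S a)
    (hι : ∀ a, ¬ S a → ι a = M.zero) (hf : ∀ a, ι (G.facePerm a) = ι a) :
    (o.multiLoop M S ι)ᴴ = o.multiLoop M S fun a => M.star (ι a) := by
  rw [o.multiLoop_order o.opposite (ι := fun a => M.star (ι a)) hS
    (fun a h => by rw [hι a h, M.star_zero]) fun a => by rw [hf]]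
  ext z x
  rw [Matrix.conjTranspose_apply, ← starRingEnd_apply, multiLoop, multiLoop, map_sum]
  refine Finset.sum_congr rfl fun y _ => ?_
  rw [map_prod]
  have hv : ∏ s, (M.v ((o.before z y s).1 s) * M.v ((o.after y x s).1 s)) ≠ 0 :=
    Finset.prod_ne_zero_iff.2 fun s _ => mul_ne_zero (M.v_ne_zero _) (M.v_ne_zero _)
  have e : ∀ h : D → ℂ, ∏ s, h (G.rev (G.next s)) = ∏ s, h s := fun h =>
    Fintype.prod_equiv (G.next.trans G.rev) _ _ fun s => rfl
  apply mul_right_cancel₀ hv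
  have key : ∏ s, starRingEnd ℂ (o.localFactor S ι z y x s) *
        (M.v ((o.after y x (G.rev (G.next s))).1 (G.rev (G.next s))) *
          M.v ((o.before z y s).1 s)) =
      ∏ s, o.opposite.localFactor S (fun a => M.star (ι a)) x y z s *
        (M.v ((o.before z y (G.rev (G.next s))).1 (G.rev (G.next s))) *
          M.v ((o.after y x s).1 s)) :=
    Finset.prod_congr rfl fun s _ => o.conj_localFactor S ι x y z s
  simp only [Finset.prod_mul_distrib] at key ⊢
  rw [e fun s => M.v ((o.after y x s).1 s), e fun s => M.v ((o.before z y s).1 s)] at key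
  rw [mul_comm (∏ s, M.v ((o.before z y s).1 s)), key]
  ring

end FusionOrder

theorem exists_face_eq {X : Type*} {f : D → X} (hf : ∀ a, f (G.facePerm a) = f a) :
    ∃ g : G.Face → X, f = fun a => g (G.face a) := by
  have h : ∀ (n : ℤ) a, f ((G.facePerm ^ n) a) = f a := fun n => by
    induction n using Int.induction_on with
    | zero => exact fun a => rfl
    | succ n ih =>
      intro a
      rw [add_comm, zpow_add, zpow_one, Equiv.Perm.mul_apply, hf, ih]
    | pred n ih =>
      intro a
      rw [sub_eq_neg_add, zpow_add, Equiv.Perm.mul_apply, zpow_neg_one, ← ih a,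
        ← hf (G.facePerm⁻¹ _)]
      simp
  refine ⟨Quotient.lift f ?_, rfl⟩
  rintro a _ ⟨n, rfl⟩
  exact (h n a).symm

theorem face_surjective (f : G.Face) : ∃ a, G.face a = f := Quotient.exists_rep f

open scoped Classical in
theorem loopType_eq (q : G.Face) (i : L) :
    loopType M q i = fun a => Function.update (fun _ => M.zero) q i (G.face a) := by
  funext a
  rw [loopType, Function.update_apply]

theorem loopType_of_not_touches {q : G.Face} {i : L} {a : D} (h : ¬ G.Touches q a) :
    loopType M q i a = M.zero :=
  if_neg fun h' => h ⟨a, rfl, h'⟩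

theorem loopType_facePerm {q : G.Face} {i : L} (a : D) :
    loopType M q i (G.facePerm a) = loopType M q i a := by
  rw [loopType, loopType, G.face_facePerm]

namespace FusionOrder

variable (o : G.FusionOrder) [Fintype D]

open scoped Classical in
theorem multiLoop_face_mul {S : D → Prop} {κ ι : G.Face → L} (hS : ∀ a, S (G.next a) ↔ S a)
    (hκ : ∀ a, ¬ S a → κ (G.face a) = M.zero) (hι : ∀ a, ¬ S a → ι (G.face a) = M.zero) :
    o.multiLoop M S (fun a => ι (G.face a)) * o.multiLoop M S (fun a => κ (G.face a)) =
      ∑ μ : G.Face → L, if ∀ f, M.allowed (κ f) (ι f) (M.star (μ f)) then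
        o.multiLoop M S (fun a => μ (G.face a)) else 0 := by
  rw [o.multiLoop_mul hS hκ hι (fun a => by rw [G.face_facePerm]) fun a => by rw [G.face_facePerm]]
  symm
  refine Finset.sum_of_injOn (fun (μ : G.Face → L) a => μ (G.face a)) ?_ ?_ ?_ ?_
  · intro μ _ μ' _ h
    funext f
    obtain ⟨a, rfl⟩ := face_surjective f
    exact congrFun h a
  · exact fun _ _ => Finset.mem_coe.2 (Finset.mem_univ _)
  · intro η _ hη
    rw [if_neg]
    intro h
    obtain ⟨g, rfl⟩ := exists_face_eq fun a => (h a).1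
    exact hη ⟨g, Finset.mem_coe.2 (Finset.mem_univ _), rfl⟩
  · intro μ _
    have : Fuses G M (fun a => κ (G.face a)) (fun a => ι (G.face a)) (fun a => μ (G.face a)) ↔
        ∀ f, M.allowed (κ f) (ι f) (M.star (μ f)) := by
      constructor
      · intro h f
        obtain ⟨a, rfl⟩ := face_surjective f
        exact (h a).2
      · exact fun h a => ⟨congrArg μ (G.face_facePerm a), h _⟩
    simp only [this]

open scoped Classical in
-- Outside `q` both types are zero and fuse only to zero, so only the type in `q` remains to be
-- summed.
theorem loopOp_mul (q : G.Face) (i j : L) :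
    o.loopOp M q i * o.loopOp M q j =
      ∑ k, (if M.allowed j i (M.star k) then (1 : ℂ) else 0) • o.loopOp M q k := by
  simp only [loopOp_eq]
  have h0 : ∀ i a, ¬ G.Touches q a →
      Function.update (fun _ => M.zero) q i (G.face a) = M.zero := fun i a h => by
    have := loopType_of_not_touches (M := M) (i := i) h
    rw [loopType_eq] at this
    exact this
  simp only [loopType_eq]
  rw [o.multiLoop_face_mul (fun a => G.touches_next) (h0 j) (h0 i)]
  symm
  refine Finset.sum_of_injOn (fun k => Function.update (fun _ => M.zero) q k) ?_ ?_ ?_ ?_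
  · intro k _ k' _ h
    have := congrFun h q
    simpa using this
  · exact fun _ _ => Finset.mem_coe.2 (Finset.mem_univ _)
  · intro η _ hη
    rw [if_neg]
    intro h
    refine hη ⟨η q, Finset.mem_coe.2 (Finset.mem_univ _), ?_⟩
    funext f
    by_cases hf : f = q
    · subst hf; exact Function.update_self ..
    · have := h f
      simp only [Function.update_of_ne hf] at this ⊢
      rw [M.allowed_zero_left, M.star_zero, M.star_eq_zero] at this
      exact this.symm
  · intro k _
    have : (∀ f, M.allowed (Function.update (fun _ : G.Face => M.zero) q j f)
        (Function.update (fun _ => M.zero) q i f)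
        (M.star (Function.update (fun _ => M.zero) q k f))) ↔ M.allowed j i (M.star k) := by
      constructor
      · intro h
        simpa using h q
      · intro h f
        by_cases hf : f = q
        · rw [hf]; simpa using h
        · simp only [Function.update_of_ne hf]
          rw [M.allowed_zero_left]
    simp only [this]
    split_ifs <;> simp

theorem loopOp_conjTranspose (q : G.Face) (i : L) :
    (o.loopOp M q i)ᴴ = o.loopOp M q (M.star i) := by
  rw [loopOp_eq, loopOp_eq, o.multiLoop_conjTranspose (fun a => G.touches_next)
    (fun a h => loopType_of_not_touches h) loopType_facePerm]
  congr 1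
  funext a
  rw [loopType, loopType]
  split_ifs
  · rfl
  · exact M.star_zero

theorem plaquetteOp_isHermitian (q : G.Face) : (o.plaquetteOp M q).IsHermitian := by
  have h1 : star (∑ i, M.d i ^ 2)⁻¹ = (∑ i, M.d i ^ 2)⁻¹ := by
    have := M.conj_totalDim
    rw [StringNetData.totalDim, starRingEnd_apply] at this
    rw [star_inv₀, this]
  have h2 : ∀ i, star (M.d i) = M.d i := M.conj_d
  rw [Matrix.IsHermitian, plaquetteOp, Matrix.conjTranspose_smul, h1, Matrix.conjTranspose_sum]
  congr 1
  refine Fintype.sum_equiv (Function.Involutive.toPerm M.star M.star_star) _ _ fun i => ?_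
  rw [Matrix.conjTranspose_smul, h2, loopOp_conjTranspose]
  change _ = M.d (M.star i) • o.loopOp M q (M.star i)
  rw [M.d_star]

theorem plaquetteOp_mul_self (q : G.Face) :
    o.plaquetteOp M q * o.plaquetteOp M q = o.plaquetteOp M q := by
  classical
  have h0 : ∑ i, M.d i ^ 2 ≠ 0 := M.totalDim_ne_zero
  -- The character property of `d` makes the square of the weighted sum of loops a multiple of this
  -- sum.
  have h1 (k : L) : ∑ i, ∑ j, M.d i * M.d j * (if M.allowed j i (M.star k) then (1 : ℂ) else 0) =
      (∑ i, M.d i ^ 2) * M.d k := by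
    rw [Finset.sum_mul]
    refine Finset.sum_congr rfl fun i _ => ?_
    have := M.sum_d_allowed i (M.star k)
    rw [M.d_star] at this
    rw [sq, mul_assoc, ← this, Finset.mul_sum]
    refine Finset.sum_congr rfl fun j _ => ?_
    rw [M.allowed_rotate_iff, mul_assoc]
  have h2 : (∑ i, M.d i • o.loopOp M q i) * (∑ i, M.d i • o.loopOp M q i) =
      (∑ i, M.d i ^ 2) • ∑ i, M.d i • o.loopOp M q i := by
    rw [Finset.sum_mul_sum]
    simp only [Matrix.smul_mul, Matrix.mul_smul, loopOp_mul, Finset.smul_sum, smul_smul]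
    calc _ = ∑ k, (∑ i, ∑ j, M.d i * M.d j *
          (if M.allowed j i (M.star k) then (1 : ℂ) else 0)) • o.loopOp M q k := by
          simp only [Finset.sum_smul]
          refine (Finset.sum_congr rfl fun i _ => ?_).trans Finset.sum_comm
          rw [Finset.sum_comm]
          refine Finset.sum_congr rfl fun k _ => Finset.sum_congr rfl fun j _ => ?_
          congr 1
          ring
      _ = _ := by simp only [h1]
  rw [plaquetteOp, Matrix.smul_mul, Matrix.mul_smul, h2, smul_smul, smul_smul,
    inv_mul_cancel_right₀ h0]

end FusionOrder

end TrivalentMap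

/-! ### Signs of permutations and the parity of the Euler characteristic. -/

/-- The sign of a permutation is determined by its number of orbits. -/
theorem Equiv.Perm.sign_eq_card_orbits {X : Type*} [Fintype X] [DecidableEq X] (π : Equiv.Perm X)
    [Fintype (Quotient (Equiv.Perm.SameCycle.setoid π))] :
    Equiv.Perm.sign π =
      (-1) ^ (Fintype.card X + Fintype.card (Quotient (Equiv.Perm.SameCycle.setoid π))) := by
  classical
  -- `g` separates the orbits, and its values are the nontrivial cycles and the fixed points.
  let g : X → Equiv.Perm X ⊕ X := fun x => if π x = x then Sum.inr x else Sum.inl (π.cycleOf x)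
  have hg : ∀ x y, g x = g y ↔ π.SameCycle x y := by
    intro x y
    by_cases hx : π x = x
    · by_cases hy : π y = y
      · simp only [g, hx, hy, if_true, Sum.inr.injEq]
        exact ⟨fun h => h ▸ Equiv.Perm.SameCycle.refl _ _, fun h => h.eq_of_left hx⟩
      · simp only [g, hx, hy, if_true, if_false, reduceCtorEq, false_iff]
        intro h
        exact hy (h.apply_eq_self_iff.1 hx)
    · by_cases hy : π y = y
      · simp only [g, hx, hy, if_true, if_false, reduceCtorEq, false_iff]
        intro h
        exact hx (h.apply_eq_self_iff.2 hy)
      · simp only [g, hx, hy, if_false, Sum.inl.injEq]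
        constructor
        · intro h
          have h1 : π.cycleOf y x ≠ x := by
            rw [← h, Equiv.Perm.cycleOf_apply_self]; exact hx
          exact ((Equiv.Perm.mem_support_cycleOf_iff.1 (Equiv.Perm.mem_support.2 h1)).1).symm
        · exact fun h => h.cycleOf_eq
  let gq : Quotient (Equiv.Perm.SameCycle.setoid π) → Equiv.Perm X ⊕ X :=
    Quotient.lift g fun x y h => (hg x y).2 h
  have hgq : Function.Injective gq := by
    rintro ⟨x⟩ ⟨y⟩ h
    exact Quotient.sound ((hg x y).1 h)
  have himage : Finset.univ.image gq = π.cycleFactorsFinset.disjSum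
      (Finset.univ.filter fun x => π x = x) := by
    ext c
    simp only [Finset.mem_image, Finset.mem_univ, true_and]
    constructor
    · rintro ⟨⟨x⟩, rfl⟩
      change g x ∈ _
      by_cases hx : π x = x
      · simp [g, hx]
      · simp [g, hx, Equiv.Perm.cycleOf_mem_cycleFactorsFinset_iff]
    · intro h
      rcases c with c | x
      · rw [Finset.inl_mem_disjSum] at h
        obtain ⟨hc, h2⟩ := Equiv.Perm.mem_cycleFactorsFinset_iff.1 h
        obtain ⟨x, hx, -⟩ := hc
        have hx' := Equiv.Perm.mem_support.2 hx
        have h3 : π x ≠ x := by rw [← h2 x hx']; exact hx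
        refine ⟨Quotient.mk _ x, ?_⟩
        change g x = _
        simp only [g, h3, if_false, Sum.inl.injEq]
        exact (Equiv.Perm.cycle_is_cycleOf hx' h).symm
      · refine ⟨Quotient.mk _ x, ?_⟩
        rw [Finset.inr_mem_disjSum, Finset.mem_filter] at h
        change g x = _
        simp [g, h.2]
  have hcard := Finset.card_image_of_injective Finset.univ hgq
  rw [himage, Finset.card_disjSum, Finset.card_univ] at hcard
  have hX : Fintype.card X = π.support.card + (Finset.univ.filter fun x => π x = x).card := by
    rw [← Finset.card_univ, ← Finset.card_filter_add_card_filter_not (fun x => π x ≠ x)]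
    simp only [ne_eq, not_not]
    rfl
  rw [Equiv.Perm.sign_of_cycleType, Equiv.Perm.sum_cycleType, hX, ← hcard,
    Equiv.Perm.cycleType_def, Multiset.card_map]
  change _ = (-1 : ℤˣ) ^ (_ + _ + (π.cycleFactorsFinset.card + _))
  rw [show ∀ a b c : ℕ, a + b + (c + b) = a + c + 2 * b by intros; ring, pow_add _ _ (2 * _),
    pow_mul]
  simp

namespace TrivalentMap

variable {D : Type*} {G : TrivalentMap D}

namespace FusionOrder

variable (o : G.FusionOrder) [Fintype D]

/-- The corner between `a` and `next a` is the second to be resolved at its vertex, and both of its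
sides are treated second. -/
def BothLast (a : D) : Prop := o.first a = false ∧ o.first (G.next a) = false

open scoped Classical in
-- Reversal shows that half of the darts are treated first, and each vertex has one or two of them.
-- So half of the vertices have two darts treated second, and these have exactly one corner of the
-- kind counted.
theorem card_eq_six_mul {N : D → Prop} (hr : ∀ a, N (G.rev a) ↔ N a)
    (hn : ∀ a, N (G.next a) ↔ N a) :
    Fintype.card {a // N a} = 6 * Fintype.card {a // o.BothLast a ∧ N a} := by
  have hnn : ∀ h : D → ℕ, ∑ a, h (G.next a) = ∑ a, h a := fun h => Equiv.sum_comp G.next h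
  have hA : ∑ a, (if o.first a = false ∧ N a then 1 else 0) =
      ∑ a, if o.first a = true ∧ N a then 1 else 0 := by
    rw [← Equiv.sum_comp G.rev]
    refine Finset.sum_congr rfl fun a _ => ?_
    rw [o.first_rev, hr]
    cases o.first a <;> simp
  have hA' : ∑ a, (if N a then 1 else 0) = ∑ a, (if o.first a = false ∧ N a then 1 else 0) +
      ∑ a, if o.first a = true ∧ N a then 1 else 0 := by
    rw [← Finset.sum_add_distrib]
    refine Finset.sum_congr rfl fun a _ => ?_
    cases o.first a <;> simp
  let e : D → ℕ := fun a => if (o.first a = false ∧ o.first (G.next a) = true) ∧ N a then 1 else 0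
  have hB : ∑ a, (if N a then 1 else 0) = 3 * ∑ a, e a := by
    have h2 := hnn fun a => e (G.next a)
    have h1 := hnn e
    have h3 : 3 * ∑ a, e a = ∑ a, e a + ∑ a, e (G.next a) + ∑ a, e (G.next (G.next a)) := by
      rw [h2, h1]; ring
    rw [h3, ← Finset.sum_add_distrib, ← Finset.sum_add_distrib]
    refine Finset.sum_congr rfl fun a _ => ?_
    have hm := o.mixed a
    simp only [e, hn, G.next_next_next]
    cases h0 : o.first a <;> cases h1 : o.first (G.next a) <;>
      cases h2 : o.first (G.next (G.next a)) <;> simp [h0, h1, h2] at hm ⊢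
  have hC : ∑ a, (if o.first a = false ∧ N a then 1 else 0) =
      ∑ a, (if o.BothLast a ∧ N a then 1 else 0) + ∑ a, e a := by
    rw [← Finset.sum_add_distrib]
    refine Finset.sum_congr rfl fun a _ => ?_
    simp only [e, BothLast]
    rcases Bool.eq_false_or_eq_true (o.first a) with h0 | h0 <;>
      rcases Bool.eq_false_or_eq_true (o.first (G.next a)) with h1 | h1 <;> simp [h0, h1]
  rw [Fintype.card_subtype, Fintype.card_subtype, Finset.card_filter, Finset.card_filter]
  omega

open scoped Classical in
/-- The parity of the Euler characteristic of a closed oriented surface. -/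
theorem even_card_faces_add {N : G.Face → Prop} (hr : ∀ a, N (G.face (G.rev a)) ↔ N (G.face a)) :
    Even (Fintype.card {f // N f} + Fintype.card {a // o.BothLast a ∧ N (G.face a)}) := by
  have hf : ∀ a, N (G.face (G.facePerm a)) ↔ N (G.face a) := fun a => by rw [G.face_facePerm]
  have hn : ∀ a, N (G.face (G.next a)) ↔ N (G.face a) := fun a => by
    rw [← hr, G.face_rev_next]
  have h6 := o.card_eq_six_mul (N := fun a => N (G.face a)) hr hn
  set k := Fintype.card {a // o.BothLast a ∧ N (G.face a)}
  let πf := G.facePerm.subtypePerm (p := fun a => N (G.face a)) hf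
  let πr := G.rev.subtypePerm (p := fun a => N (G.face a)) hr
  let πn := G.next.subtypePerm (p := fun a => N (G.face a)) hn
  -- Signs are compared in this relation. That of `πn` is trivial because its cube is, and `πr`
  -- consists of `3 * k` transpositions; so the sign of `πf`, hence the parity of its number of
  -- orbits, is known.
  have e1 : πn * πf = πr := by
    ext a
    change G.next (G.facePerm a) = G.rev a
    simp [facePerm]
  have s1 : Equiv.Perm.sign πn = 1 := by
    have : πn ^ 3 = 1 := by
      ext a
      exact G.next_next_next a
    have h := congrArg Equiv.Perm.sign this
    rw [map_pow, map_one] at h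
    rcases Int.units_eq_one_or (Equiv.Perm.sign πn) with h1 | h1
    · exact h1
    · rw [h1] at h
      exact absurd h (by decide)
  have s2 : Equiv.Perm.sign πr = (-1) ^ (3 * k) := by
    have h2 : πr ^ 2 = 1 := by
      ext a
      exact G.rev_rev a
    have h3 : IsEmpty (Function.fixedPoints πr) :=
      ⟨fun a => G.rev_ne a.1.1 (congrArg Subtype.val a.2)⟩
    rw [Equiv.Perm.sign_of_pow_two_eq_one h2, Fintype.card_eq_zero
      (α := Function.fixedPoints πr), h6]
    congr 1
    omega
  have s3 : Equiv.Perm.sign πf = (-1) ^ (6 * k + Fintype.card {f // N f}) := by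
    rw [Equiv.Perm.sign_eq_card_orbits, h6]
    congr 2
    refine (Fintype.card_congr (Equiv.subtypeQuotientEquivQuotientSubtype
      (fun a => N (G.face a)) N (s₁ := Equiv.Perm.SameCycle.setoid G.facePerm)
      (s₂ := Equiv.Perm.SameCycle.setoid πf) (fun a => Iff.rfl) fun x y => ?_)).symm
    exact Equiv.Perm.sameCycle_subtypePerm
  have h := congrArg Equiv.Perm.sign e1
  rw [map_mul, s1, s2, s3, one_mul] at h
  rw [← neg_one_pow_eq_one_iff_even (R := ℤˣ) (by decide)]
  have h7 : ((-1 : ℤˣ)) ^ (6 * k + Fintype.card {f // N f}) = (-1) ^ Fintype.card {f // N f} := by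
    rw [pow_add, show 6 * k = 2 * (3 * k) by ring, pow_mul]
    simp
  have h8 : ((-1 : ℤˣ)) ^ (3 * k) = (-1) ^ k := by
    rw [pow_mul]
    congr 1
  rw [h7, h8] at h
  rw [pow_add, h, ← pow_add, ← two_mul, pow_mul]
  simp

end FusionOrder

end TrivalentMap

theorem prod_mul_neg_one_pow_pos {X : Type*} [Fintype X] {g : X → ℝ} (hg : ∀ x, g x ≠ 0)
    [Fintype {x // g x < 0}] : 0 < (∏ x, g x) * (-1) ^ Fintype.card {x // g x < 0} := by
  have h : ((-1 : ℝ)) ^ Fintype.card {x // g x < 0} = ∏ x, if g x < 0 then -1 else 1 := by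
    rw [Finset.prod_ite, Finset.prod_const, Finset.prod_const_one, mul_one, Fintype.card_subtype]
  rw [h, ← Finset.prod_mul_distrib]
  refine Finset.prod_pos fun x _ => ?_
  split_ifs with h
  · linarith
  · rw [mul_one]
    exact lt_of_le_of_ne (not_lt.1 h) (hg x).symm

/-! ### A common fixed vector obtained from the vacuum. -/

namespace TrivalentMap

variable {D : Type*} {G : TrivalentMap D} {L : Type*} [Fintype L] {M : StringNetData L}

/-- The configuration without strings. -/
def vacuum (G : TrivalentMap D) (M : StringNetData L) : G.Config M :=
  ⟨fun _ => M.zero, fun _ => M.star_zero.symm⟩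

theorem vacuum_apply (a : D) : (G.vacuum M).1 a = M.zero := rfl

namespace FusionOrder

variable (o : G.FusionOrder)

/-- The label read into the vertex of `a` on a dart that has a loop of type `i` on both sides, when
one of them has been fused. -/
def halfFused (M : StringNetData L) (i : L) (a : D) : L := if o.first a then M.star i else i

open scoped Classical in
-- If the labels are zero at the beginning and at the end, the label in between must be the string
-- of the loop. Of the nonzero factors, only that of a corner with both sides treated second differs
-- from `1`.
theorem cornerFactor_vacuum (i : L) (y : G.Config M) (s : D) :
    o.cornerFactor i (G.vacuum M) y (G.vacuum M) s =
      if y.1 (G.rev s) = o.halfFused M i s ∧ y.1 (G.rev (G.next s)) = o.halfFused M i (G.next s) ∧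
        (o.first s = o.first (G.next s) →
          y.1 (G.rev (G.next (G.next s))) = o.halfFused M i (G.next (G.next s)))
      then if o.BothLast s then (M.d i)⁻¹ else 1 else 0 := by
  have hv := M.v_ne_zero
  have hm := o.mixed s
  rw [cornerFactor, before_rev_eq, after_rev_eq, before_eq, after_eq, leg_eq]
  simp only [vacuum_apply, halfFused, BothLast]
  generalize y.1 (G.rev s) = p
  generalize y.1 (G.rev (G.next s)) = q
  generalize y.1 (G.rev (G.next (G.next s))) = r
  rcases Bool.eq_false_or_eq_true (o.first s) with h0 | h0 <;>
    rcases Bool.eq_false_or_eq_true (o.first (G.next s)) with h1 | h1 <;>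
    rcases Bool.eq_false_or_eq_true (o.first (G.next (G.next s))) with h2 | h2 <;>
    simp [h0, h1, h2] at hm <;>
    simp only [h0, h1, h2, M.F_eq, M.sixj_zero₁, M.sixj_zero₂, M.sixj_zero₃, M.allowed_zero_left,
      M.allowed_zero_mid, M.allowed_zero_right, M.star_inj, M.v_zero, M.star_zero, if_true,
      if_false, Bool.true_eq_false, Bool.false_eq_true, true_and, and_true, and_self, and_false,
      true_imp_iff, false_imp_iff] <;>
    split_ifs with ha hb hb <;>
    first
    | rfl
    | exact zero_mul _
    | (exfalso; have e1 := M.star_star i; have e2 := M.star_star r; grind [M.star_star])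
    | (obtain ⟨h3, h4, h5⟩ := hb; simp only [h3, h4, h5, M.v_star, M.d_eq]; have := hv i; field_simp)
    | (obtain ⟨h3, h4⟩ := hb; simp only [h3, h4, M.v_star]; have := hv i; field_simp)

open scoped Classical in
-- The loops on the two sides of an edge must cancel, hence have the same type, and this determines
-- the intermediate configuration.
theorem multiLoop_vacuum [Fintype D] {ι : D → L} (hf : ∀ a, ι (G.facePerm a) = ι a) :
    o.multiLoop M (fun _ => True) ι (G.vacuum M) (G.vacuum M) =
      if ∀ a, ι (G.rev a) = ι a then ∏ s, if o.BothLast s then (M.d (ι s))⁻¹ else 1 else 0 := by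
  have hinj : ∀ i j a, o.halfFused M i a = o.halfFused M j a → i = j := fun i j a h => by
    rw [halfFused, halfFused] at h
    split_ifs at h
    · exact M.star_injective h
    · exact h
  have key (y : G.Config M) (h : ∏ s, o.localFactor (fun _ => True) ι (G.vacuum M) y (G.vacuum M) s
      ≠ 0) (s : D) : y.1 (G.rev s) = o.halfFused M (ι s) s ∧ ι (G.rev s) = ι s := by
    have h1 : ∀ s, y.1 (G.rev s) = o.halfFused M (ι s) s ∧
        y.1 (G.rev (G.next s)) = o.halfFused M (ι s) (G.next s) := fun s => by
      have := Finset.prod_ne_zero_iff.1 h s (Finset.mem_univ _)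
      rw [localFactor, if_pos trivial, cornerFactor_vacuum] at this
      obtain ⟨h, h', -⟩ := (ite_ne_right_iff.1 this).1
      exact ⟨h, h'⟩
    refine ⟨(h1 s).1, ?_⟩
    have h2 := (h1 (G.facePerm (G.rev s))).2
    rw [show G.next (G.facePerm (G.rev s)) = s by simp [facePerm, G.rev_rev], (h1 s).1, hf] at h2
    exact (hinj _ _ _ h2).symm
  split_ifs with hr
  · have hn : ∀ a, ι (G.next a) = ι a := fun a => by
      rw [← hr, ← hf, facePerm_rev_next]
    let y : G.Config M := ⟨fun a => o.halfFused M (ι a) (G.rev a), fun a => by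
      simp only [hr, halfFused, o.first_rev]
      cases o.first a <;> simp⟩
    rw [multiLoop, Finset.sum_eq_single y]
    · refine Finset.prod_congr rfl fun s _ => ?_
      rw [localFactor, if_pos trivial, cornerFactor_vacuum, if_pos]
      simp only [y, hr, hn, G.rev_rev, implies_true, and_self]
    · intro y' _ hy
      by_contra h
      apply hy
      apply Subtype.ext
      funext a
      have := key y' h (G.rev a)
      rw [G.rev_rev, hr] at this
      exact this.1
    · exact fun h => absurd (Finset.mem_univ _) h
  · refine Finset.sum_eq_zero fun y _ => ?_
    by_contra h
    exact hr fun a => (key y h a).2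

variable [Fintype D]

open scoped Classical in
/-- Loops of all types in all plaquettes, weighted by their quantum dimensions. -/
noncomputable def weightedLoops (M : StringNetData L) : Matrix (G.Config M) (G.Config M) ℂ :=
  ∑ κ : G.Face → L, (∏ f, M.d (κ f)) • o.multiLoop M (fun _ => True) fun a => κ (G.face a)

/-- Every term is a nonnegative real number and the term without loops is positive. -/
theorem weightedLoops_vacuum_ne_zero : o.weightedLoops M (G.vacuum M) (G.vacuum M) ≠ 0 := by
  classical
  choose r hr0 hr using M.exists_real_d
  have key (κ : G.Face → L) : ∃ t : ℝ, (0 ≤ t ∧ (κ = (fun _ => M.zero) → 0 < t)) ∧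
      (∏ f, M.d (κ f)) *
        o.multiLoop M (fun _ => True) (fun a => κ (G.face a)) (G.vacuum M) (G.vacuum M) = t := by
    rw [o.multiLoop_vacuum fun a => congrArg κ (G.face_facePerm a)]
    by_cases h : ∀ a, κ (G.face (G.rev a)) = κ (G.face a)
    · rw [if_pos h]
      refine ⟨(∏ f, r (κ f)) * ∏ s, if o.BothLast s then (r (κ (G.face s)))⁻¹ else 1, ?_, ?_⟩
      · have h0 : 0 < (∏ f, r (κ f)) *
            ∏ s, if o.BothLast s then (r (κ (G.face s)))⁻¹ else 1 := by
          have h1 := prod_mul_neg_one_pow_pos (g := fun f => r (κ f)) fun f => hr0 _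
          have h2 := prod_mul_neg_one_pow_pos
            (g := fun s => if o.BothLast s then (r (κ (G.face s)))⁻¹ else 1) fun s => by
              split_ifs
              · exact inv_ne_zero (hr0 _)
              · exact one_ne_zero
          -- The types agree across edges, so the plaquettes of negative dimension fill whole
          -- components. Their number and that of the inverse weights of negative sign have even
          -- sum.
          have h3 := o.even_card_faces_add (N := fun f => r (κ f) < 0) fun a => by rw [h]
          have h4 : Fintype.card {s // (if o.BothLast s then (r (κ (G.face s)))⁻¹ else 1) < 0} =
              Fintype.card {a // o.BothLast a ∧ r (κ (G.face a)) < 0} := by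
            refine Fintype.card_congr (Equiv.subtypeEquivRight fun s => ?_)
            split_ifs with hs
            · simp [hs]
            · simp only [hs, false_and, iff_false, not_lt]
              exact zero_le_one
          have h5 := mul_pos h1 h2
          rw [mul_mul_mul_comm, ← pow_add, h4, h3.neg_one_pow, mul_one] at h5
          exact h5
        exact ⟨h0.le, fun _ => h0⟩
      · push_cast
        simp only [hr]
        congr 1
        refine Finset.prod_congr rfl fun s _ => ?_
        split_ifs <;> simp
    · rw [if_neg h]
      refine ⟨0, ⟨le_rfl, fun h' => absurd (fun a => by rw [h']) h⟩, by simp⟩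
  choose t ht hk using key
  have e : o.weightedLoops M (G.vacuum M) (G.vacuum M) = ((∑ κ, t κ : ℝ) : ℂ) := by
    rw [weightedLoops, Matrix.sum_apply]
    push_cast
    exact Finset.sum_congr rfl fun κ _ => hk κ
  rw [e]
  have : 0 < ∑ κ, t κ :=
    Finset.sum_pos' (fun κ _ => (ht κ).1) ⟨fun _ => M.zero, Finset.mem_univ _, (ht _).2 rfl⟩
  exact_mod_cast this.ne'

/-- After loops have passed all vertices the branching rule holds everywhere, so the loop in `q` may
be treated as acting at every vertex, as fusion requires. -/
theorem loopOp_mul_multiLoop (q : G.Face) (i : L) (κ : D → L) :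
    o.loopOp M q i * o.multiLoop M (fun _ => True) κ =
      o.multiLoop M (fun _ => True) (G.loopType M q i) * o.multiLoop M (fun _ => True) κ := by
  rw [loopOp_eq]
  ext z x
  rw [Matrix.mul_apply, Matrix.mul_apply]
  refine Finset.sum_congr rfl fun m _ => ?_
  by_cases h : o.multiLoop M (fun _ => True) κ m x = 0
  · rw [h, mul_zero, mul_zero]
  · rw [o.multiLoop_mono (S := G.Touches q) (S' := fun _ => True) (fun _ _ => trivial)
      (fun a h => loopType_of_not_touches h) (fun _ => Iff.rfl), if_pos]
    exact fun a _ => (o.allowedAt_of_multiLoop_ne_zero h rfl (b := a) trivial).2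

/-- By the character property, a loop of type `i` that fuses into the weighted loops only multiplies
them by `d i`. -/
theorem plaquetteOp_mul_weightedLoops (q : G.Face) :
    o.plaquetteOp M q * o.weightedLoops M = o.weightedLoops M := by
  classical
  have h0 : ∑ i, M.d i ^ 2 ≠ 0 := M.totalDim_ne_zero
  have h1 (i : L) (μ : G.Face → L) : ∑ κ : G.Face → L, (∏ f, M.d (κ f)) *
      (if ∀ f, M.allowed (κ f) (Function.update (fun _ => M.zero) q i f) (M.star (μ f))
        then (1 : ℂ) else 0) = M.d i * ∏ f, M.d (μ f) := by
    have e1 (κ : G.Face → L) : (if ∀ f, M.allowed (κ f)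
        (Function.update (fun _ => M.zero) q i f) (M.star (μ f)) then (1 : ℂ) else 0) =
        ∏ f, if M.allowed (κ f) (Function.update (fun _ => M.zero) q i f) (M.star (μ f))
          then 1 else 0 := by
      rw [Finset.prod_ite_zero]
      simp
    simp only [e1, ← Finset.prod_mul_distrib]
    rw [← Fintype.prod_sum fun f k => M.d k * if M.allowed k
      (Function.update (fun _ => M.zero) q i f) (M.star (μ f)) then 1 else 0]
    have e2 (f : G.Face) : ∑ k, M.d k * (if M.allowed k
        (Function.update (fun _ => M.zero) q i f) (M.star (μ f)) then (1 : ℂ) else 0) =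
        M.d (Function.update (fun _ => M.zero) q i f) * M.d (μ f) := by
      rw [← M.d_star (μ f), ← M.sum_d_allowed]
      refine Finset.sum_congr rfl fun k _ => ?_
      rw [M.allowed_rotate_iff]
    simp only [e2, Finset.prod_mul_distrib]
    congr 1
    rw [Finset.prod_eq_single q]
    · rw [Function.update_self]
    · intro f _ hf
      rw [Function.update_of_ne hf, M.d_zero]
    · exact fun h => absurd (Finset.mem_univ _) h
  have h2 (i : L) : o.loopOp M q i * o.weightedLoops M = M.d i • o.weightedLoops M := by
    rw [weightedLoops, Finset.mul_sum]
    simp only [Matrix.mul_smul, loopOp_mul_multiLoop, loopType_eq]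
    have e (κ : G.Face → L) := o.multiLoop_face_mul (M := M) (S := fun _ => True) (κ := κ)
      (ι := Function.update (fun _ => M.zero) q i) (fun _ => Iff.rfl)
      (fun _ h => absurd trivial h) (fun _ h => absurd trivial h)
    simp only [e, Finset.smul_sum]
    rw [Finset.sum_comm]
    refine Finset.sum_congr rfl fun μ _ => ?_
    rw [smul_smul, ← h1, Finset.sum_smul]
    refine Finset.sum_congr rfl fun κ _ => ?_
    split_ifs <;> simp
  rw [plaquetteOp, Matrix.smul_mul, Finset.sum_mul]
  simp only [Matrix.smul_mul, h2, smul_smul, ← sq, ← Finset.sum_smul]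
  rw [inv_mul_cancel₀ h0, one_smul]

theorem vertexOp_mul_weightedLoops (w : G.Vertex) :
    G.vertexOp M w * o.weightedLoops M = o.weightedLoops M := by
  classical
  rw [weightedLoops, Finset.mul_sum]
  refine Finset.sum_congr rfl fun κ _ => ?_
  rw [Matrix.mul_smul]
  congr 1
  ext z x
  rw [vertexOp, Matrix.diagonal_mul]
  by_cases h : o.multiLoop M (fun _ => True) (fun a => κ (G.face a)) z x = 0
  · rw [h, mul_zero]
  · rw [if_pos, one_mul]
    exact fun a _ => (o.allowedAt_of_multiLoop_ne_zero h rfl (b := a) trivial).2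

end FusionOrder

end TrivalentMap

/-! ### Ground states of minus a sum of projections. -/

section Projections

variable {X I : Type*} [Fintype X] [Fintype I] {P : I → Matrix X X ℂ}

theorem star_dotProduct_self_eq (φ : X → ℂ) :
    star φ ⬝ᵥ φ = ((∑ x, Complex.normSq (φ x) : ℝ) : ℂ) := by
  push_cast
  exact Finset.sum_congr rfl fun x _ => by
    rw [Pi.star_apply, ← starRingEnd_apply, ← Complex.normSq_eq_conj_mul_self]

theorem star_dotProduct_sub_mulVec {A : Matrix X X ℂ} (hA : A.IsHermitian) (hA' : A * A = A)
    (φ : X → ℂ) :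
    star (φ - A *ᵥ φ) ⬝ᵥ (φ - A *ᵥ φ) = star φ ⬝ᵥ φ - star φ ⬝ᵥ A *ᵥ φ := by
  have h1 : star (A *ᵥ φ) ⬝ᵥ φ = star φ ⬝ᵥ A *ᵥ φ := by
    rw [Matrix.star_mulVec, hA.eq, Matrix.dotProduct_mulVec]
  have h2 : star (A *ᵥ φ) ⬝ᵥ A *ᵥ φ = star φ ⬝ᵥ A *ᵥ φ := by
    rw [Matrix.star_mulVec, hA.eq, ← Matrix.dotProduct_mulVec, Matrix.mulVec_mulVec, hA']
  rw [star_sub, sub_dotProduct, dotProduct_sub, dotProduct_sub, h1, h2]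
  ring

/-- For a projection, the squared norm of `φ - P i φ` is `⟨φ, φ⟩ - ⟨φ, P i φ⟩`; the second terms add
up to `-E ⟨φ, φ⟩`. -/
theorem energy_add_card_mul (hP : ∀ i, (P i).IsHermitian) (hP' : ∀ i, P i * P i = P i) {E : ℝ}
    {φ : X → ℂ} (h : (-∑ i, P i) *ᵥ φ = (E : ℂ) • φ) :
    (E + Fintype.card I) * ∑ x, Complex.normSq (φ x) =
      ∑ i, ∑ x, Complex.normSq ((φ - P i *ᵥ φ) x) := by
  have h1 : star φ ⬝ᵥ (-∑ i, P i) *ᵥ φ = E * (star φ ⬝ᵥ φ) := by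
    rw [h, dotProduct_smul, smul_eq_mul]
  rw [Matrix.neg_mulVec, dotProduct_neg, Matrix.sum_mulVec, dotProduct_sum] at h1
  apply Complex.ofReal_injective
  rw [Complex.ofReal_mul, ← star_dotProduct_self_eq, Complex.ofReal_sum]
  simp only [← star_dotProduct_self_eq, star_dotProduct_sub_mulVec (hP _) (hP' _),
    Finset.sum_sub_distrib, Finset.sum_const, Finset.card_univ, nsmul_eq_mul]
  push_cast
  linear_combination -h1

theorem sum_normSq_pos {φ : X → ℂ} (h : φ ≠ 0) : 0 < ∑ x, Complex.normSq (φ x) := by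
  obtain ⟨x, hx⟩ := Function.ne_iff.1 h
  exact Finset.sum_pos' (fun _ _ => Complex.normSq_nonneg _)
    ⟨x, Finset.mem_univ _, Complex.normSq_pos.2 hx⟩

/-- The ground states of a frustration-free Hamiltonian. -/
theorem isGroundState_neg_sum_iff (hP : ∀ i, (P i).IsHermitian) (hP' : ∀ i, P i * P i = P i)
    {Ψ : X → ℂ} (hΨ : Ψ ≠ 0) (hΨ' : ∀ i, P i *ᵥ Ψ = Ψ) {ψ : X → ℂ} :
    IsGroundState (-∑ i, P i) ψ ↔ ψ ≠ 0 ∧ ∀ i, P i *ᵥ ψ = ψ := by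
  have heig : ∀ φ : X → ℂ, (∀ i, P i *ᵥ φ = φ) →
      (-∑ i, P i) *ᵥ φ = ((-Fintype.card I : ℝ) : ℂ) • φ := fun φ h => by
    rw [Matrix.neg_mulVec, Matrix.sum_mulVec]
    simp only [h, Finset.sum_const, Finset.card_univ]
    funext x
    simp
  constructor
  · rintro ⟨E, hE, h0, hmin⟩
    refine ⟨h0, ?_⟩
    -- The common fixed vector has energy `-card I`, so the left side of `energy_add_card_mul` is at
    -- most zero for `ψ`, and every norm on the right vanishes.
    have h1 := hmin _ Ψ hΨ (heig Ψ hΨ')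
    have h2 := energy_add_card_mul hP hP' hE
    have h3 : ∑ i, ∑ x, Complex.normSq ((ψ - P i *ᵥ ψ) x) ≤ 0 := by
      rw [← h2]
      exact mul_nonpos_of_nonpos_of_nonneg (by linarith) (sum_normSq_pos h0).le
    intro i
    by_contra hi
    have h4 : ψ - P i *ᵥ ψ ≠ 0 := fun h => hi (sub_eq_zero.1 h).symm
    have h5 := Finset.single_le_sum (f := fun i => ∑ x, Complex.normSq ((ψ - P i *ᵥ ψ) x))
      (fun i _ => Finset.sum_nonneg fun _ _ => Complex.normSq_nonneg _) (Finset.mem_univ i)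
    have h6 := sum_normSq_pos h4
    linarith
  · rintro ⟨h0, h⟩
    refine ⟨_, heig ψ h, h0, fun E' φ hφ hE' => ?_⟩
    have h2 := energy_add_card_mul hP hP' hE'
    have h3 : 0 ≤ ∑ i, ∑ x, Complex.normSq ((φ - P i *ᵥ φ) x) :=
      Finset.sum_nonneg fun i _ => Finset.sum_nonneg fun _ _ => Complex.normSq_nonneg _
    rw [← h2] at h3
    have h4 := nonneg_of_mul_nonneg_left h3 (sum_normSq_pos hφ)
    linarith

end Projections

namespace TrivalentMap

variable {D : Type*} {G : TrivalentMap D} {L : Type*} [Fintype L] {M : StringNetData L}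
  [Fintype D]

theorem vertexOp_isHermitian (w : G.Vertex) : (G.vertexOp M w).IsHermitian := by
  classical
  rw [vertexOp]
  refine Matrix.isHermitian_diagonal_iff.2 fun x => ?_
  split_ifs
  · exact IsSelfAdjoint.one _
  · exact IsSelfAdjoint.zero _

theorem vertexOp_mul_self (w : G.Vertex) : G.vertexOp M w * G.vertexOp M w = G.vertexOp M w := by
  classical
  rw [vertexOp, Matrix.diagonal_mul_diagonal]
  congr 1
  funext x
  split_ifs <;> simp

theorem isGroundState_hamiltonian_iff (o : G.FusionOrder) {ψ : G.Config M → ℂ} :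
    IsGroundState (o.hamiltonian M) ψ ↔ ψ ≠ 0 ∧ (∀ w, G.vertexOp M w *ᵥ ψ = ψ) ∧
      ∀ q, o.plaquetteOp M q *ᵥ ψ = ψ := by
  classical
  let P : G.Vertex ⊕ G.Face → Matrix (G.Config M) (G.Config M) ℂ :=
    Sum.elim (G.vertexOp M) (o.plaquetteOp M)
  have h : o.hamiltonian M = -∑ i, P i := by
    rw [FusionOrder.hamiltonian, Fintype.sum_sum_type, neg_add, sub_eq_add_neg]
    rfl
  -- All `Q_w` and `B_q` leave the image of the weighted loops fixed.
  let Ψ : G.Config M → ℂ := o.weightedLoops M *ᵥ Pi.single (G.vacuum M) 1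
  have hΨ : Ψ ≠ 0 := fun h => o.weightedLoops_vacuum_ne_zero (M := M) (by
    have := congrFun h (G.vacuum M)
    simpa [Ψ] using this)
  rw [h, isGroundState_neg_sum_iff (Ψ := Ψ) _ _ hΨ]
  · simp only [Sum.forall]
    rfl
  · rintro (w | q)
    · exact (Matrix.mulVec_mulVec _ _ _).trans (by
        change (G.vertexOp M w * _) *ᵥ _ = _
        rw [o.vertexOp_mul_weightedLoops])
    · exact (Matrix.mulVec_mulVec _ _ _).trans (by
        change (o.plaquetteOp M q * _) *ᵥ _ = _
        rw [o.plaquetteOp_mul_weightedLoops])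
  · rintro (w | q)
    · exact vertexOp_isHermitian w
    · exact o.plaquetteOp_isHermitian q
  · rintro (w | q)
    · exact vertexOp_mul_self w
    · exact o.plaquetteOp_mul_self q

end TrivalentMap

/-! ### The vector `Φ` and the plaquette inside the self-loop. -/

namespace StringNetData

variable {L : Type*} [Fintype L] (M : StringNetData L)

/-- As the dimensions are real and nonzero, the complex power in `Phi` is the positive square root
of a positive number, whatever the signs of the `d j`. -/
theorem exists_real_sqrt_totalDim : ∃ t : ℝ, 0 < t ∧ (∑ j, M.d j ^ 2) = (t ^ 2 : ℝ) ∧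
    (∑ j, M.d j ^ 2) ^ (1 / 2 : ℂ) = t := by
  obtain ⟨r, hr, h⟩ := M.exists_real_totalDim
  rw [totalDim] at h
  refine ⟨√r, Real.sqrt_pos.2 hr, by rw [h, Real.sq_sqrt hr.le], ?_⟩
  rw [h, Real.sqrt_eq_rpow, Complex.ofReal_cpow hr.le]
  norm_num

theorem Phi_mul_conj_Phi (i j : L) :
    M.Phi i * starRingEnd ℂ (M.Phi j) = (∑ k, M.d k ^ 2)⁻¹ * (M.d i * M.d j) := by
  obtain ⟨t, ht, h1, h2⟩ := M.exists_real_sqrt_totalDim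
  have ht' : (t : ℂ) ≠ 0 := by exact_mod_cast ht.ne'
  rw [Phi, Phi, h2, h1, map_div₀, Complex.conj_ofReal, M.conj_d]
  push_cast
  field_simp

theorem sum_normSq_Phi : ∑ i, ‖M.Phi i‖ ^ 2 = 1 := by
  have h : ∑ i, M.Phi i * starRingEnd ℂ (M.Phi i) = 1 := by
    simp only [Phi_mul_conj_Phi, ← sq, ← Finset.mul_sum]
    exact inv_mul_cancel₀ M.totalDim_ne_zero
  simp only [Complex.mul_conj'] at h
  exact_mod_cast h

open scoped Classical in
-- Orthogonality in which one label is zero: the weighted loop in the head annihilates every string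
-- `a` on the stem except the trivial one.
theorem sum_d_mul_F (a l l' : L) :
    ∑ i, M.d i * M.F a (M.star l) l (M.star i) l' (M.star l') =
      if a = M.zero then M.d l * M.d l' else 0 := by
  have hv := M.v_ne_zero
  have h := M.sixj_orthogonality M.zero l' (M.star l) l' a (M.star l)
  simp only [M.sixj_zero₂, M.star_star, true_and, M.allowed_zero_mid, M.allowed_zero_right,
    and_true, M.d_zero, inv_one] at h
  have e (i : L) : M.F a (M.star l) l (M.star i) l' (M.star l') =
      M.sixj (M.star l) l a (M.star l') l' (M.star i) * (M.v l * M.v l') := by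
    rw [M.F_eq, M.sixj_one, M.sixj_three, M.star_star, M.v_star]
  -- The admissibility condition is redundant, since the other factor vanishes when it fails.
  have e2 (n : L) : M.d n * (M.sixj (M.star l) l a (M.star l') l' n *
      if M.allowed l' (M.star l) n then (M.v l' * M.v (M.star l))⁻¹ else 0) =
      M.d n * M.sixj (M.star l) l a (M.star l') l' n * (M.v l * M.v l')⁻¹ := by
    by_cases h0 : M.sixj (M.star l) l a (M.star l') l' n = 0
    · rw [h0]; ring
    · have := (M.sixj_ne_zero h0).2.1
      rw [M.allowed_swap_iff] at this
      rw [if_pos this, M.v_star]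
      ring
  simp only [e2, ← Finset.sum_mul] at h
  simp only [e, ← mul_assoc]
  rw [← Finset.sum_mul, ← Finset.sum_mul,
    Fintype.sum_equiv (Function.Involutive.toPerm M.star M.star_star)
      (fun i => M.d i * M.sixj (M.star l) l a (M.star l') l' (M.star i))
      (fun n => M.d n * M.sixj (M.star l) l a (M.star l') l' n)
      fun i => by
        change _ = M.d (M.star i) * _
        rw [M.d_star]
        rfl]
  have hc : (M.v l * M.v l')⁻¹ ≠ 0 := inv_ne_zero (mul_ne_zero (hv _) (hv _))
  rw [eq_div_of_mul_eq hc h, M.d_eq, M.d_eq]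
  split_ifs
  · field_simp
  · simp

end StringNetData

namespace TrivalentMap

namespace Tadpole

variable {D : Type*} {G : TrivalentMap D} {L : Type*} [Fintype L] {M : StringNetData L}
  (T : G.Tadpole)

theorem face_eq_head_iff {a : D} : G.face a = T.head ↔ a = T.loop := by
  constructor
  · intro h
    have h' : G.facePerm.SameCycle a T.loop := Quotient.exact h
    exact h'.eq_of_right T.facePerm_loop
  · rintro rfl
    rfl

theorem foot_ne_loop : T.foot ≠ T.loop := fun h => T.vertex_foot_ne (by rw [h])

theorem foot_ne_rev_loop : T.foot ≠ G.rev T.loop := fun h =>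
  T.vertex_foot_ne (by rw [h, T.vertex_rev_loop])

variable [Fintype D] (o : G.FusionOrder)

open scoped Classical in
-- The head has a single side and a single corner. Only one of the two fusions at `e₁` changes a
-- label, so the intermediate configuration is `z` or `x`, depending on which side is treated first.
theorem loopOp_head_apply (i : L) (z x : G.Config M) :
    o.loopOp M T.head i z x =
      if ∀ a, a ≠ T.loop → a ≠ G.rev T.loop → z.1 a = x.1 a then
        M.F (x.1 T.foot) (M.star (x.1 T.loop)) (x.1 T.loop) (M.star i) (z.1 T.loop)
          (M.star (z.1 T.loop))
      else 0 := by
  have hfilter : Finset.univ.filter (fun s => G.face s = T.head) = {T.loop} := by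
    ext a
    simp [T.face_eq_head_iff]
  have hc (y : G.Config M) : (∀ s, G.face s ≠ T.head →
      (o.before x y s).1 s = (o.after y z s).1 s) ↔
      y = (if o.first T.loop then z else x) ∧
        ∀ a, a ≠ T.loop → a ≠ G.rev T.loop → z.1 a = x.1 a := by
    simp only [ne_eq, T.face_eq_head_iff, o.before_eq, o.after_eq]
    constructor
    · intro h
      have h1 : ∀ a, a ≠ T.loop → a ≠ G.rev T.loop → x.1 a = y.1 a ∧ y.1 a = z.1 a := by
        intro a ha ha'
        have h2 := h a ha
        have h3 := h (G.rev a) fun h' => ha' (by rw [← h', G.rev_rev])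
        rw [o.first_rev, x.2, y.2, z.2] at h3
        cases h0 : o.first a <;> simp [h0] at h2 h3 <;> exact ⟨by assumption, by assumption⟩
      have h2 := h (G.rev T.loop) (G.rev_ne _)
      rw [o.first_rev] at h2
      refine ⟨?_, fun a ha ha' => ((h1 a ha ha').1.trans (h1 a ha ha').2).symm⟩
      apply Subtype.ext
      funext a
      by_cases ha : a = T.loop
      · subst ha
        split_ifs with h0 <;> simp [h0, x.2, y.2, z.2] at h2 <;> simp [h2]
      · by_cases ha' : a = G.rev T.loop
        · subst ha'
          split_ifs with h0 <;> simp [h0] at h2 <;> simp [h2]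
        · split_ifs
          · exact (h1 a ha ha').2
          · exact (h1 a ha ha').1.symm
    · rintro ⟨rfl, h⟩ a ha
      by_cases ha' : a = G.rev T.loop
      · subst ha'
        rw [o.first_rev]
        cases o.first T.loop <;> simp
      · have := h a ha ha'
        split_ifs <;> simp [this]
  have hx : x.1 (G.rev T.loop) = M.star (x.1 T.loop) := x.2 _
  have hz : z.1 (G.rev T.loop) = M.star (z.1 T.loop) := z.2 _
  have hA : G.rev (G.next (G.next T.loop)) = T.foot := by rw [T.next_loop]; rfl
  have hC : G.rev (G.next T.loop) = T.loop := by rw [T.next_loop, G.rev_rev]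
  rw [FusionOrder.loopOp, hfilter]
  simp only [Finset.prod_singleton, hc]
  by_cases h : ∀ a, a ≠ T.loop → a ≠ G.rev T.loop → z.1 a = x.1 a
  · have hf := h T.foot T.foot_ne_loop T.foot_ne_rev_loop
    rw [if_pos h, Finset.sum_eq_single (if o.first T.loop then z else x), if_pos ⟨rfl, h⟩,
      FusionOrder.cornerFactor, hA, hC, o.leg_eq, T.next_loop, o.first_rev]
    · simp only [o.before_eq, o.after_eq]
      rcases Bool.eq_false_or_eq_true (o.first T.loop) with h0 | h0 <;> simp [h0, hf, hx, hz]
    · intro y _ hy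
      rw [if_neg fun h => hy h.1]
    · exact fun h => absurd (Finset.mem_univ _) h
  · rw [if_neg h]
    exact Finset.sum_eq_zero fun y _ => if_neg fun h' => h h'.2

theorem plaquetteOp_head : o.plaquetteOp M T.head = T.projector M := by
  classical
  ext z x
  have hstem (x : G.Config M) : x.1 T.foot = M.zero ↔ x.1 T.stem = M.zero := by
    rw [foot, x.2, M.star_eq_zero]
  rw [FusionOrder.plaquetteOp, Matrix.smul_apply, Matrix.sum_apply, projector]
  simp only [Matrix.smul_apply, smul_eq_mul, loopOp_head_apply]
  by_cases h : ∀ a, a ≠ T.loop → a ≠ G.rev T.loop → z.1 a = x.1 a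
  · simp only [if_pos h, M.sum_d_mul_F]
    by_cases h0 : x.1 T.foot = M.zero
    · have h1 : z.1 T.foot = M.zero := by rw [h _ T.foot_ne_loop T.foot_ne_rev_loop, h0]
      rw [if_pos h0, if_pos ⟨(hstem z).1 h1, (hstem x).1 h0, fun a h1 h2 _ _ => h a h1 h2⟩,
        M.Phi_mul_conj_Phi, mul_comm (M.d (x.1 _))]
    · rw [if_neg h0, if_neg fun h' => h0 ((hstem x).2 h'.2.1), mul_zero]
  · simp only [if_neg h, mul_zero, Finset.sum_const_zero]
    rw [if_neg]
    rintro ⟨h1, h2, h3⟩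
    refine h fun a ha ha' => ?_
    by_cases hs : a = T.stem
    · rw [hs, h1, h2]
    · by_cases hf : a = T.foot
      · rw [hf, (hstem z).2 h1, (hstem x).2 h2]
      · exact h3 a ha ha' hs hf

end Tadpole

end TrivalentMap

namespace TrivalentMap

/-! ### Darts and plaquettes before and after removal of the tadpole. -/

namespace Tadpole

variable {D : Type*} {G : TrivalentMap D} (T : G.Tadpole)

theorem next_rev_loop : G.next (G.rev T.loop) = T.stem := rfl

theorem next_stem : G.next T.stem = T.loop := by
  have := G.next_next_next T.loop
  rwa [T.next_loop] at this

theorem next_foot : G.next T.foot = T.left := rfl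

theorem next_left : G.next T.left = T.right := rfl

theorem next_right : G.next T.right = T.foot := G.next_next_next T.foot

theorem rev_stem : G.rev T.stem = T.foot := rfl

theorem rev_foot : G.rev T.foot = T.stem := G.rev_rev _

/-- A dart either survives or is one of the six at the two vertices of the tadpole. -/
theorem dart_cases (a : D) : T.Survives a ∨ a = T.loop ∨ a = G.rev T.loop ∨ a = T.stem ∨
    a = T.foot ∨ a = T.left ∨ a = T.right := by
  by_cases h1 : G.vertex a = G.vertex T.loop
  · rcases T.eq_of_vertex_loop h1 with h | h | h <;> simp [h]
  · by_cases h2 : G.vertex a = G.vertex T.foot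
    · rcases T.eq_of_vertex_foot h2 with h | h | h <;> simp [h]
    · exact Or.inl ⟨h1, h2⟩

theorem not_survives_loop : ¬ T.Survives T.loop := fun h => h.1 rfl

theorem not_survives_rev_loop : ¬ T.Survives (G.rev T.loop) := fun h => h.1 T.vertex_rev_loop

theorem not_survives_stem : ¬ T.Survives T.stem := fun h => h.1 T.vertex_stem

theorem not_survives_foot : ¬ T.Survives T.foot := fun h => h.2 rfl

theorem not_survives_left : ¬ T.Survives T.left := fun h => h.2 T.vertex_left

theorem not_survives_right : ¬ T.Survives T.right := fun h => h.2 T.vertex_right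

theorem left_ne_foot : T.left ≠ T.foot := G.next_ne _

theorem right_ne_left : T.right ≠ T.left := G.next_ne _

theorem right_ne_foot : T.right ≠ T.foot := G.next_next_ne _

theorem stem_ne_loop : T.stem ≠ T.loop := fun h => G.next_ne T.loop (by
  have := G.next_next_ne T.loop
  rw [T.next_loop] at this
  exact absurd h this)

theorem rev_loop_ne_loop : G.rev T.loop ≠ T.loop := G.rev_ne _

theorem stem_ne_rev_loop : T.stem ≠ G.rev T.loop := G.next_ne _

theorem ne_of_vertex {a b : D} (ha : G.vertex a = G.vertex T.foot)
    (hb : G.vertex b = G.vertex T.loop) : a ≠ b := fun h =>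
  T.vertex_foot_ne (by rw [← ha, h, hb])

theorem foot_ne_stem : T.foot ≠ T.stem := T.ne_of_vertex rfl T.vertex_stem
theorem left_ne_loop : T.left ≠ T.loop := T.ne_of_vertex T.vertex_left rfl
theorem left_ne_rev_loop : T.left ≠ G.rev T.loop := T.ne_of_vertex T.vertex_left T.vertex_rev_loop
theorem left_ne_stem : T.left ≠ T.stem := T.ne_of_vertex T.vertex_left T.vertex_stem
theorem right_ne_loop : T.right ≠ T.loop := T.ne_of_vertex T.vertex_right rfl
theorem right_ne_rev_loop : T.right ≠ G.rev T.loop :=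
  T.ne_of_vertex T.vertex_right T.vertex_rev_loop
theorem right_ne_stem : T.right ≠ T.stem := T.ne_of_vertex T.vertex_right T.vertex_stem

theorem removed_rev_newDart : (T.removed.rev T.newDart).1 = G.rev T.right := by
  change (T.revFun T.newDart).1 = _
  rw [revFun, dif_pos (show T.newDart.1 = G.rev T.left from rfl)]

theorem removed_rev_val {a : {a : D // T.Survives a}} (h3 : a.1 ≠ G.rev T.left)
    (h4 : a.1 ≠ G.rev T.right) : (T.removed.rev a).1 = G.rev a.1 := by
  change (T.revFun a).1 = _
  rw [revFun, dif_neg h3, dif_neg h4]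

theorem removed_next_val (a : {a : D // T.Survives a}) : (T.removed.next a).1 = G.next a.1 := rfl

theorem eq_newDart {a : {a : D // T.Survives a}} (h : a.1 = G.rev T.left) : a = T.newDart :=
  Subtype.ext h

theorem eq_rev_newDart {a : {a : D // T.Survives a}} (h : a.1 = G.rev T.right) :
    a = T.removed.rev T.newDart :=
  Subtype.ext (by rw [h, removed_rev_newDart])

open scoped Classical in
theorem prod_darts [Fintype D] {R : Type*} [CommMonoid R] (h : D → R) :
    ∏ s, h s = (∏ s : {a // T.Survives a}, h s) *
      ((h T.loop * h (G.rev T.loop) * h T.stem) * (h T.foot * h T.left * h T.right)) := by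
  rw [← Finset.prod_filter_mul_prod_filter_not Finset.univ T.Survives]
  congr 1
  · rw [Finset.prod_subtype (p := T.Survives)]
    simp
  · have : Finset.univ.filter (fun a => ¬ T.Survives a) =
        {T.loop, G.rev T.loop, T.stem, T.foot, T.left, T.right} := by
      ext a
      simp only [Finset.mem_filter, Finset.mem_univ, true_and, Finset.mem_insert,
        Finset.mem_singleton]
      constructor
      · intro ha
        exact (T.dart_cases a).resolve_left ha
      · rintro (rfl | rfl | rfl | rfl | rfl | rfl)
        · exact T.not_survives_loop
        · exact T.not_survives_rev_loop
        · exact T.not_survives_stem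
        · exact T.not_survives_foot
        · exact T.not_survives_left
        · exact T.not_survives_right
    rw [this, Finset.prod_insert, Finset.prod_insert, Finset.prod_insert, Finset.prod_insert,
      Finset.prod_insert, Finset.prod_singleton]
    · simp only [mul_assoc]
    · simpa using T.right_ne_left.symm
    · simpa using ⟨T.left_ne_foot.symm, T.right_ne_foot.symm⟩
    · simpa using ⟨T.foot_ne_stem.symm, T.left_ne_stem.symm, T.right_ne_stem.symm⟩
    · simpa using ⟨T.stem_ne_rev_loop.symm, T.foot_ne_rev_loop.symm, T.left_ne_rev_loop.symm,
        T.right_ne_rev_loop.symm⟩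
    · simpa using ⟨T.rev_loop_ne_loop.symm, T.stem_ne_loop.symm, T.foot_ne_loop.symm,
        T.left_ne_loop.symm, T.right_ne_loop.symm⟩

open scoped Classical in
/-- The dart of `G'` with the same plaquette on its left. -/
noncomputable def shadow (a : D) : {a : D // T.Survives a} :=
  if h : T.Survives a then ⟨a, h⟩ else if a = T.left then T.removed.rev T.newDart else T.newDart

theorem shadow_of_survives (a : {a : D // T.Survives a}) : T.shadow a.1 = a := by
  rw [shadow, dif_pos a.2]

theorem shadow_left : T.shadow T.left = T.removed.rev T.newDart := by
  rw [shadow, dif_neg T.not_survives_left, if_pos rfl]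

theorem shadow_of_not_survives {a : D} (h : ¬ T.Survives a) (h' : a ≠ T.left) :
    T.shadow a = T.newDart := by
  rw [shadow, dif_neg h, if_neg h']

theorem facePerm_eq_iff {a b : D} : G.facePerm a = b ↔ G.rev a = G.next b := by
  rw [facePerm, Equiv.Perm.mul_apply, Equiv.Perm.inv_eq_iff_eq]

theorem facePerm_rev_left : G.facePerm (G.rev T.left) = T.foot := by
  rw [facePerm_eq_iff, G.rev_rev, T.next_foot]

theorem facePerm_foot : G.facePerm T.foot = G.rev T.loop := by
  rw [facePerm_eq_iff, T.rev_foot, T.next_rev_loop]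

theorem facePerm_rev_loop : G.facePerm (G.rev T.loop) = T.stem := by
  rw [facePerm_eq_iff, G.rev_rev, T.next_stem]

theorem facePerm_stem : G.facePerm T.stem = T.right := by
  rw [facePerm_eq_iff, T.rev_stem, T.next_right]

theorem facePerm_rev_right : G.facePerm (G.rev T.right) = T.left := by
  rw [facePerm_eq_iff, G.rev_rev, T.next_left]

theorem removed_facePerm_newDart : (T.removed.facePerm T.newDart).1 = G.facePerm T.right := by
  symm
  rw [facePerm_eq_iff, ← T.removed_rev_newDart, ← T.removed_next_val]
  congr 1
  rw [← facePerm_eq_iff]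

theorem removed_facePerm_rev_newDart :
    (T.removed.facePerm (T.removed.rev T.newDart)).1 = G.facePerm T.left := by
  symm
  rw [facePerm_eq_iff, ← T.removed_next_val]
  change T.newDart.1 = _
  congr 1
  rw [← T.removed.rev_rev T.newDart]
  rw [← facePerm_eq_iff, T.removed.rev_rev]

theorem removed_facePerm_val {a : {a : D // T.Survives a}} (h3 : a.1 ≠ G.rev T.left)
    (h4 : a.1 ≠ G.rev T.right) : (T.removed.facePerm a).1 = G.facePerm a.1 := by
  symm
  rw [facePerm_eq_iff, ← T.removed_next_val, ← T.removed_rev_val h3 h4]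
  congr 1
  rw [← facePerm_eq_iff]

theorem face_rev_left : G.face (G.rev T.left) = T.outer := by
  rw [outer, ← T.facePerm_foot, G.face_facePerm, ← T.facePerm_rev_left, G.face_facePerm]

theorem face_stem : G.face T.stem = T.outer := by
  rw [outer, ← T.facePerm_rev_loop, G.face_facePerm]

theorem face_right : G.face T.right = T.outer := by
  rw [← T.facePerm_stem, G.face_facePerm, face_stem]

theorem face_foot : G.face T.foot = T.outer := by
  rw [outer, ← T.facePerm_foot, G.face_facePerm]

theorem face_rev_right : G.face (G.rev T.right) = G.face T.left := by
  rw [← T.facePerm_rev_right, G.face_facePerm]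

theorem face_shadow {a : D} (h : a ≠ T.loop) : G.face (T.shadow a).1 = G.face a := by
  rcases T.dart_cases a with h | h | h | h | h | h | h
  · rw [T.shadow_of_survives ⟨a, h⟩]
  · contradiction
  · rw [h, T.shadow_of_not_survives T.not_survives_rev_loop T.left_ne_rev_loop.symm]
    exact T.face_rev_left
  · rw [h, T.shadow_of_not_survives T.not_survives_stem T.left_ne_stem.symm, T.face_stem]
    exact T.face_rev_left
  · rw [h, T.shadow_of_not_survives T.not_survives_foot T.left_ne_foot.symm, T.face_foot]
    exact T.face_rev_left
  · rw [h, T.shadow_left, T.removed_rev_newDart, T.face_rev_right]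
  · rw [h, T.shadow_of_not_survives T.not_survives_right T.right_ne_left, T.face_right]
    exact T.face_rev_left

theorem face_removed_facePerm (a : {a : D // T.Survives a}) :
    G.face (T.removed.facePerm a).1 = G.face a.1 := by
  by_cases h3 : a.1 = G.rev T.left
  · rw [T.eq_newDart h3, removed_facePerm_newDart, G.face_facePerm, T.face_right]
    exact T.face_rev_left.symm
  · by_cases h4 : a.1 = G.rev T.right
    · rw [h4, T.eq_rev_newDart h4, removed_facePerm_rev_newDart, G.face_facePerm, T.face_rev_right]
    · rw [T.removed_facePerm_val h3 h4, G.face_facePerm]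

/-- The boundary walk passes `rev left`, `foot`, `rev loop`, `stem` and `right` in succession. All
have the shadow `newDart`, so the excursion around the tadpole collapses to one step. -/
theorem removed_face_shadow_facePerm {a : D} (h : a ≠ T.loop) :
    T.removed.face (T.shadow (G.facePerm a)) = T.removed.face (T.shadow a) := by
  have hn := T.removed.face_facePerm
  have h1 := T.shadow_of_not_survives T.not_survives_rev_loop T.left_ne_rev_loop.symm
  have h2 := T.shadow_of_not_survives T.not_survives_stem T.left_ne_stem.symm
  have h3 := T.shadow_of_not_survives T.not_survives_foot T.left_ne_foot.symm
  have h4 := T.shadow_of_not_survives T.not_survives_right T.right_ne_left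
  rcases T.dart_cases a with h | h | h | h | h | h | h
  · obtain ⟨b, rfl⟩ : ∃ b : {a : D // T.Survives a}, b.1 = a := ⟨⟨a, h⟩, rfl⟩
    rw [T.shadow_of_survives b]
    by_cases e3 : b.1 = G.rev T.left
    · rw [e3, T.facePerm_rev_left, h3, T.eq_newDart e3]
    · by_cases e4 : b.1 = G.rev T.right
      · rw [e4, T.facePerm_rev_right, shadow_left, T.eq_rev_newDart e4]
      · rw [← T.removed_facePerm_val e3 e4, T.shadow_of_survives, hn]
  · contradiction
  · rw [h, T.facePerm_rev_loop, h1, h2]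
  · rw [h, T.facePerm_stem, h2, h4]
  · rw [h, T.facePerm_foot, h3, h1]
  · rw [h, ← T.removed_facePerm_rev_newDart, T.shadow_of_survives, hn, shadow_left]
  · rw [h, ← T.removed_facePerm_newDart, T.shadow_of_survives, hn, h4]

/-- The plaquette of `G` from which a plaquette of `G'` arises. -/
noncomputable def liftFace (q : T.removed.Face) : G.Face :=
  Quotient.lift (fun a : {a : D // T.Survives a} => G.face a.1) (by
    intro a b h
    obtain ⟨g, hg⟩ := exists_face_eq (G := T.removed) (f := fun a => G.face a.1)
      T.face_removed_facePerm
    have h1 := congrFun hg a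
    have h2 := congrFun hg b
    have : T.removed.face a = T.removed.face b := Quotient.sound h
    rw [h1, h2, this]) q

theorem liftFace_face (a : {a : D // T.Survives a}) :
    T.liftFace (T.removed.face a) = G.face a.1 := rfl

theorem liftFace_outerRemoved : T.liftFace T.outerRemoved = T.outer := T.face_rev_left

theorem liftFace_ne_head (q : T.removed.Face) : T.liftFace q ≠ T.head := by
  obtain ⟨a, rfl⟩ := face_surjective q
  rw [liftFace_face, ne_eq, T.face_eq_head_iff]
  exact fun h => T.not_survives_loop (h ▸ a.2)

theorem removed_face_shadow_eq_iff {a : D} (h : a ≠ T.loop) (q : T.removed.Face) :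
    T.removed.face (T.shadow a) = q ↔ G.face a = T.liftFace q := by
  classical
  constructor
  · rintro rfl
    rw [liftFace_face, T.face_shadow h]
  · obtain ⟨b, rfl⟩ := face_surjective q
    rw [liftFace_face]
    intro hab
    -- The value `none` marks the head, where `shadow` is meaningless; this makes the function
    -- invariant on all darts, so it descends to plaquettes.
    obtain ⟨g, hg⟩ := exists_face_eq (G := G)
      (f := fun a => if a = T.loop then none else some (T.removed.face (T.shadow a))) (by
        intro a
        by_cases ha : a = T.loop
        · rw [ha, T.facePerm_loop]
        · have ha' : G.facePerm a ≠ T.loop := fun h => ha (by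
            rw [← T.facePerm_loop] at h
            exact G.facePerm.injective h)
          rw [if_neg ha, if_neg ha', T.removed_face_shadow_facePerm ha])
    have h1 := congrFun hg a
    have h2 := congrFun hg b.1
    have hb : b.1 ≠ T.loop := fun h => T.not_survives_loop (h ▸ b.2)
    simp only [h, hb, if_false, hab] at h1 h2
    rw [← h2, T.shadow_of_survives] at h1
    exact Option.some_injective _ h1

theorem loopType_liftFace {L : Type*} [Fintype L] {M : StringNetData L} (q : T.removed.Face)
    (i : L) : G.loopType M (T.liftFace q) i T.loop = M.zero ∧
      ∀ a, a ≠ T.loop →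
        G.loopType M (T.liftFace q) i a = T.removed.loopType M q i (T.shadow a) := by
  classical
  constructor
  · exact if_neg (T.liftFace_ne_head q).symm
  · intro a h
    rw [loopType, loopType]
    simp only [T.removed_face_shadow_eq_iff h]

end Tadpole

end TrivalentMap

theorem StringNetData.allowed_swap_right {L : Type*} [Fintype L] (M : StringNetData L) {i j k : L} :
    M.allowed i j k ↔ M.allowed i k j := by
  rw [M.allowed_reverse_iff, M.allowed_rotate_iff, M.allowed_rotate_iff]

namespace TrivalentMap

/-! ### Extending configurations and orders over the tadpole; its corner factors. -/

namespace Tadpole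

variable {D : Type*} {G : TrivalentMap D} {L : Type*} [Fintype L] {M : StringNetData L}
  (T : G.Tadpole)

section Extend

open scoped Classical in
/-- The labels of `x'` outside the tadpole, with `l` on the self-loop and `p` on the stem. -/
noncomputable def extendFun (x' : T.removed.Config M) (l p : L) (a : D) : L :=
  if h : T.Survives a then x'.1 ⟨a, h⟩
  else if a = T.left then x'.1 (T.removed.rev T.newDart)
  else if a = T.right then x'.1 T.newDart
  else if a = T.loop then l
  else if a = G.rev T.loop then M.star l
  else if a = T.stem then p
  else M.star p

variable (x' : T.removed.Config M) (l p : L)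

theorem extendFun_val (a : {a : D // T.Survives a}) : T.extendFun x' l p a.1 = x'.1 a := by
  rw [extendFun, dif_pos a.2]

theorem extendFun_left : T.extendFun x' l p T.left = M.star (x'.1 T.newDart) := by
  rw [extendFun, dif_neg T.not_survives_left, if_pos rfl, x'.2]

theorem extendFun_right : T.extendFun x' l p T.right = x'.1 T.newDart := by
  rw [extendFun, dif_neg T.not_survives_right, if_neg T.right_ne_left, if_pos rfl]

theorem extendFun_loop : T.extendFun x' l p T.loop = l := by
  rw [extendFun, dif_neg T.not_survives_loop, if_neg T.left_ne_loop.symm,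
    if_neg T.right_ne_loop.symm, if_pos rfl]

theorem extendFun_rev_loop : T.extendFun x' l p (G.rev T.loop) = M.star l := by
  rw [extendFun, dif_neg T.not_survives_rev_loop, if_neg T.left_ne_rev_loop.symm,
    if_neg T.right_ne_rev_loop.symm, if_neg T.rev_loop_ne_loop, if_pos rfl]

theorem extendFun_stem : T.extendFun x' l p T.stem = p := by
  rw [extendFun, dif_neg T.not_survives_stem, if_neg T.left_ne_stem.symm,
    if_neg T.right_ne_stem.symm, if_neg T.stem_ne_loop, if_neg T.stem_ne_rev_loop, if_pos rfl]

theorem extendFun_foot : T.extendFun x' l p T.foot = M.star p := by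
  rw [extendFun, dif_neg T.not_survives_foot, if_neg T.left_ne_foot.symm,
    if_neg T.right_ne_foot.symm, if_neg T.foot_ne_loop, if_neg T.foot_ne_rev_loop,
    if_neg T.foot_ne_stem]

theorem extendFun_rev_left : T.extendFun x' l p (G.rev T.left) = x'.1 T.newDart :=
  T.extendFun_val x' l p T.newDart

theorem extendFun_rev_right : T.extendFun x' l p (G.rev T.right) = M.star (x'.1 T.newDart) := by
  rw [← x'.2, ← T.removed_rev_newDart, extendFun_val]

/-- The configuration of `G` that has the labels of `x'` outside the tadpole, with `l` on the
self-loop and `p` on the stem. -/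
noncomputable def extend (x' : T.removed.Config M) (l p : L) : G.Config M :=
  ⟨T.extendFun x' l p, fun a => by
    rcases T.dart_cases a with h | h | h | h | h | h | h
    · obtain ⟨b, rfl⟩ : ∃ b : {a : D // T.Survives a}, b.1 = a := ⟨⟨a, h⟩, rfl⟩
      rw [extendFun_val]
      by_cases e3 : b.1 = G.rev T.left
      · rw [e3, G.rev_rev, extendFun_left, T.eq_newDart e3]
      · by_cases e4 : b.1 = G.rev T.right
        · rw [e4, G.rev_rev, extendFun_right, T.eq_rev_newDart e4, x'.2, M.star_star]
        · rw [← T.removed_rev_val e3 e4, extendFun_val, x'.2]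
    · rw [h, extendFun_rev_loop, extendFun_loop]
    · rw [h, G.rev_rev, extendFun_rev_loop, extendFun_loop, M.star_star]
    · rw [h, T.rev_stem, extendFun_foot, extendFun_stem]
    · rw [h, T.rev_foot, extendFun_foot, extendFun_stem, M.star_star]
    · rw [h, extendFun_rev_left, extendFun_left, M.star_star]
    · rw [h, extendFun_rev_right, extendFun_right]⟩

theorem extend_val (a : {a : D // T.Survives a}) : (T.extend x' l p).1 a.1 = x'.1 a :=
  T.extendFun_val x' l p a

theorem extend_loop : (T.extend x' l p).1 T.loop = l := T.extendFun_loop x' l p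

theorem extend_stem : (T.extend x' l p).1 T.stem = p := T.extendFun_stem x' l p

theorem extend_right : (T.extend x' l p).1 T.right = x'.1 T.newDart := T.extendFun_right x' l p

theorem extend_rev_left : (T.extend x' l p).1 (G.rev T.left) = x'.1 T.newDart :=
  T.extendFun_rev_left x' l p

theorem extend_rev_right : (T.extend x' l p).1 (G.rev T.right) =
    x'.1 (T.removed.rev T.newDart) := by
  rw [← T.removed_rev_newDart, extend_val]

/-- The restriction of a configuration in which a string of one type passes `v`. -/
def restrict (x : G.Config M) (h : x.1 (G.rev T.left) = x.1 T.right) : T.removed.Config M :=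
  ⟨fun a => x.1 a.1, fun a => by
    change x.1 (T.removed.rev a).1 = M.star (x.1 a.1)
    by_cases e3 : a.1 = G.rev T.left
    · rw [e3, T.eq_newDart e3, T.removed_rev_newDart, x.2, h]
    · by_cases e4 : a.1 = G.rev T.right
      · rw [T.eq_rev_newDart e4, T.removed.rev_rev, T.removed_rev_newDart]
        change x.1 (G.rev T.left) = _
        rw [h, x.2, M.star_star]
      · rw [T.removed_rev_val e3 e4, x.2]⟩

theorem eq_extend_iff {y : G.Config M} : y = T.extend x' l p ↔
    (∀ a, x'.1 a = y.1 a.1) ∧ y.1 (G.rev T.left) = y.1 T.right ∧ y.1 T.loop = l ∧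
      y.1 T.stem = p := by
  constructor
  · rintro rfl
    exact ⟨fun a => (T.extend_val x' l p a).symm, by rw [extend_rev_left, extend_right],
      T.extend_loop x' l p, T.extend_stem x' l p⟩
  · rintro ⟨h1, h2, h3, h4⟩
    apply Subtype.ext
    funext a
    change _ = T.extendFun x' l p a
    have h0 : y.1 (G.rev T.left) = x'.1 T.newDart := (h1 T.newDart).symm
    have hy := y.2
    rcases T.dart_cases a with h | h | h | h | h | h | h
    · obtain ⟨b, rfl⟩ : ∃ b : {a : D // T.Survives a}, b.1 = a := ⟨⟨a, h⟩, rfl⟩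
      rw [extendFun_val, h1]
    · rw [h, extendFun_loop, h3]
    · rw [h, extendFun_rev_loop, hy, h3]
    · rw [h, extendFun_stem, h4]
    · rw [h, extendFun_foot, foot, hy, h4]
    · rw [h, extendFun_left, ← h0, hy, M.star_star]
    · rw [h, extendFun_right, ← h0, h2]

theorem matches_iff (x : G.Config M) :
    T.Matches M x' x ↔ x = T.extend x' (x.1 T.loop) M.zero := by
  rw [eq_extend_iff, Matches]
  tauto

theorem matches_extend : T.Matches M x' (T.extend x' l M.zero) := by
  rw [matches_iff, extend_loop]

open scoped Classical in
theorem sum_matches [Fintype D] (g : G.Config M → ℂ) :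
    ∑ x, (if T.Matches M x' x then g x else 0) = ∑ l, g (T.extend x' l M.zero) := by
  rw [← Finset.sum_filter]
  refine Finset.sum_nbij' (fun x : G.Config M => x.1 T.loop) (fun l => T.extend x' l M.zero)
    ?_ ?_ ?_ ?_ ?_
  · simp
  · intro l _
    simp [T.matches_extend]
  · intro x hx
    exact ((T.matches_iff x' x).1 (Finset.mem_filter.1 hx).2).symm
  · intro l _
    exact T.extend_loop x' l M.zero
  · intro x hx
    rw [← (T.matches_iff x' x).1 (Finset.mem_filter.1 hx).2]

open scoped Classical in
theorem sum_extend [Fintype D] {g : G.Config M → ℂ} {l p : L}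
    (h : ∀ y, g y ≠ 0 → y.1 (G.rev T.left) = y.1 T.right ∧ y.1 T.loop = l ∧ y.1 T.stem = p) :
    ∑ y, g y = ∑ y' : T.removed.Config M, g (T.extend y' l p) := by
  symm
  refine Finset.sum_of_injOn (fun y' => T.extend y' l p) ?_ ?_ ?_ ?_
  · intro y' _ y'' _ hy
    apply Subtype.ext
    funext a
    have := (T.eq_extend_iff y'' l p).1 hy
    rw [this.1, extend_val]
  · exact fun _ _ => Finset.mem_coe.2 (Finset.mem_univ _)
  · intro y _ hy
    by_contra h0
    obtain ⟨h1, h2, h3⟩ := h y h0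
    exact hy ⟨T.restrict y h1, Finset.mem_coe.2 (Finset.mem_univ _),
      ((T.eq_extend_iff (T.restrict y h1) l p).2 ⟨fun _ => rfl, h1, h2, h3⟩).symm⟩
  · exact fun _ _ => rfl

end Extend

section Order

variable (o' : T.removed.FusionOrder)

open scoped Classical in
/-- An order that restricts to a given one when the tadpole is removed. -/
noncomputable def extendFirst (a : D) : Bool :=
  if h : T.Survives a then o'.first ⟨a, h⟩
  else if a = T.left then !o'.first T.newDart
  else if a = T.right then o'.first T.newDart
  else decide (a = T.loop ∨ a = T.foot)

theorem extendFirst_val (a : {a : D // T.Survives a}) : T.extendFirst o' a.1 = o'.first a := by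
  rw [extendFirst, dif_pos a.2]

theorem extendFirst_left : T.extendFirst o' T.left = !o'.first T.newDart := by
  rw [extendFirst, dif_neg T.not_survives_left, if_pos rfl]

theorem extendFirst_right : T.extendFirst o' T.right = o'.first T.newDart := by
  rw [extendFirst, dif_neg T.not_survives_right, if_neg T.right_ne_left, if_pos rfl]

theorem extendFirst_loop : T.extendFirst o' T.loop = true := by
  rw [extendFirst, dif_neg T.not_survives_loop, if_neg T.left_ne_loop.symm,
    if_neg T.right_ne_loop.symm]
  simp

theorem extendFirst_foot : T.extendFirst o' T.foot = true := by
  rw [extendFirst, dif_neg T.not_survives_foot, if_neg T.left_ne_foot.symm,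
    if_neg T.right_ne_foot.symm]
  simp

theorem extendFirst_rev_loop : T.extendFirst o' (G.rev T.loop) = false := by
  rw [extendFirst, dif_neg T.not_survives_rev_loop, if_neg T.left_ne_rev_loop.symm,
    if_neg T.right_ne_rev_loop.symm]
  simp [T.rev_loop_ne_loop, T.foot_ne_rev_loop.symm]

theorem extendFirst_stem : T.extendFirst o' T.stem = false := by
  rw [extendFirst, dif_neg T.not_survives_stem, if_neg T.left_ne_stem.symm,
    if_neg T.right_ne_stem.symm]
  simp [T.stem_ne_loop, T.foot_ne_stem.symm]

theorem extendFirst_rev_left : T.extendFirst o' (G.rev T.left) = o'.first T.newDart :=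
  T.extendFirst_val o' T.newDart

theorem extendFirst_rev_right : T.extendFirst o' (G.rev T.right) = !o'.first T.newDart := by
  rw [← o'.first_rev, ← T.removed_rev_newDart, extendFirst_val]

/-- An order that restricts to a given one when the tadpole is removed. -/
noncomputable def extendOrder : G.FusionOrder where
  first := T.extendFirst o'
  first_rev a := by
    rcases T.dart_cases a with h | h | h | h | h | h | h
    · obtain ⟨b, rfl⟩ : ∃ b : {a : D // T.Survives a}, b.1 = a := ⟨⟨a, h⟩, rfl⟩
      rw [extendFirst_val]
      by_cases e3 : b.1 = G.rev T.left
      · rw [e3, G.rev_rev, extendFirst_left, T.eq_newDart e3]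
      · by_cases e4 : b.1 = G.rev T.right
        · rw [e4, G.rev_rev, extendFirst_right, T.eq_rev_newDart e4, o'.first_rev, Bool.not_not]
        · rw [← T.removed_rev_val e3 e4, extendFirst_val, o'.first_rev]
    · rw [h, extendFirst_rev_loop, extendFirst_loop]; rfl
    · rw [h, G.rev_rev, extendFirst_rev_loop, extendFirst_loop]; rfl
    · rw [h, T.rev_stem, extendFirst_foot, extendFirst_stem]; rfl
    · rw [h, T.rev_foot, extendFirst_foot, extendFirst_stem]; rfl
    · rw [h, extendFirst_rev_left, extendFirst_left, Bool.not_not]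
    · rw [h, extendFirst_rev_right, extendFirst_right]
  mixed a := by
    rcases T.dart_cases a with h | h | h | h | h | h | h
    · have := o'.mixed ⟨a, h⟩
      simpa only [← extendFirst_val, removed_next_val] using this
    · rw [h, T.next_loop, extendFirst_loop, extendFirst_rev_loop]; simp
    · rw [h, T.next_rev_loop, T.next_stem, extendFirst_loop, extendFirst_stem]; simp
    · rw [h, T.next_stem, extendFirst_loop, extendFirst_stem]; simp
    · rw [h, T.next_foot, T.next_left, extendFirst_left, extendFirst_right]; simp
    · rw [h, T.next_left, extendFirst_left, extendFirst_right]; simp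
    · rw [h, T.next_right, T.next_foot, extendFirst_left, extendFirst_right]
      cases o'.first T.newDart <;> simp

end Order

section Corners

variable (o : G.FusionOrder)

open scoped Classical in
-- The stem is empty before and after, so in between it carries the string of the loop fused into
-- its first side. The first side of the self-loop faces the head, where the loop is trivial, so its
-- label is unchanged by the first fusion.
theorem cornerFactors_loop (h1 : o.first T.loop = true) (h2 : o.first T.stem = false) (i : L)
    (x y z : G.Config M) (hx : x.1 T.stem = M.zero) (hz : z.1 T.stem = M.zero) :
    o.cornerFactor M.zero x y z T.loop * o.cornerFactor i x y z (G.rev T.loop) *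
        o.cornerFactor i x y z T.stem =
      if y.1 T.loop = x.1 T.loop ∧ y.1 T.stem = M.star i ∧
        M.allowed (M.star (x.1 T.loop)) i (z.1 T.loop) then (M.d i)⁻¹ else 0 := by
  have hv := M.v_ne_zero
  have hx' : x.1 T.foot = M.zero := by rw [foot, x.2, hx, M.star_zero]
  have hz' : z.1 T.foot = M.zero := by rw [foot, z.2, hz, M.star_zero]
  have hy' : y.1 T.foot = M.star (y.1 T.stem) := y.2 _
  have hxl : x.1 (G.rev T.loop) = M.star (x.1 T.loop) := x.2 _
  have hyl : y.1 (G.rev T.loop) = M.star (y.1 T.loop) := y.2 _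
  have hzl : z.1 (G.rev T.loop) = M.star (z.1 T.loop) := z.2 _
  have h3 : o.first T.foot = true := by rw [foot, o.first_rev, h2]; rfl
  simp only [FusionOrder.cornerFactor, T.next_loop, T.next_rev_loop, T.next_stem, o.before_eq,
    o.after_eq, o.leg_eq, o.first_rev, h1, h2, h3, G.rev_rev, T.rev_stem, Bool.not_true,
    if_true, if_false, Bool.true_eq_false, Bool.false_eq_true, hx', hz', hy', hxl, hyl, hzl]
  generalize x.1 T.loop = l
  generalize y.1 T.loop = u
  generalize z.1 T.loop = l'
  generalize y.1 T.stem = p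
  simp only [M.F_eq, M.star_zero, M.sixj_zero₁, M.sixj_zero₃, M.sixj_zero₆, M.star_star,
    true_and, M.allowed_zero_right, M.v_star, M.v_zero]
  by_cases hu : u = l
  · by_cases hp : p = M.star i
    · subst hu hp
      have e : M.allowed i l' (M.star u) ↔ M.allowed (M.star u) i l' := by
        rw [M.allowed_rotate_iff, M.allowed_rotate_iff]
      simp only [M.star_star, true_and, e, M.v_star, if_true]
      split_ifs
      · have := hv u
        have := hv l'
        have := hv i
        rw [M.d_eq]
        field_simp
      · ring
    · have hp' : ¬ M.star p = i := fun h => hp (by rw [← h, M.star_star])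
      simp [hp, hp']
  · simp [hu]

open scoped Classical in
-- With an empty stem initially and finally, these corners only keep `e₃` and `e₄` equal in between
-- and repeat admissibility conditions that the corners at the far ends of these edges impose
-- anyway.
theorem cornerFactors_foot (h1 : o.first T.foot = true) (h2 : o.first T.left = !o.first T.right)
    (i j : L) (x y z : G.Config M) (hx : x.1 T.stem = M.zero) (hz : z.1 T.stem = M.zero)
    (hx2 : x.1 (G.rev T.left) = x.1 T.right) (hz2 : z.1 (G.rev T.left) = z.1 T.right) :
    o.cornerFactor i x y z T.foot * o.cornerFactor j x y z T.left *
        o.cornerFactor i x y z T.right =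
      if y.1 (G.rev T.left) = y.1 T.right ∧ y.1 T.stem = M.star i ∧
        M.allowed ((o.before x y (G.rev T.left)).1 (G.rev T.left)) i
          (M.star ((o.after y z (G.rev T.left)).1 (G.rev T.left))) ∧
        M.allowed ((o.before x y (G.rev T.right)).1 (G.rev T.right)) j
          (M.star ((o.after y z (G.rev T.right)).1 (G.rev T.right))) then 1 else 0 := by
  have hv := M.v_ne_zero
  have hxr : x.1 (G.rev T.right) = M.star (x.1 T.right) := x.2 _
  have hyr : y.1 (G.rev T.right) = M.star (y.1 T.right) := y.2 _
  have hzr : z.1 (G.rev T.right) = M.star (z.1 T.right) := z.2 _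
  have h3 : o.first T.stem = false := by rw [← T.rev_foot, o.first_rev, h1]; rfl
  simp only [FusionOrder.cornerFactor, T.next_foot, T.next_left, T.next_right, o.before_eq,
    o.after_eq, o.leg_eq, o.first_rev, h1, h2, h3, T.rev_foot, hx, hz, hx2, hz2, hxr, hyr, hzr]
  generalize x.1 T.right = l
  generalize y.1 T.right = u
  generalize y.1 (G.rev T.left) = u'
  generalize z.1 T.right = l'
  generalize y.1 T.stem = p
  have hm : ∀ (A : Prop) (i j : L), (if A then (M.v i * M.v j)⁻¹ else 0) * (M.v i * M.v j) =
      if A then 1 else 0 := fun A i j => by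
    split_ifs
    · exact inv_mul_cancel₀ (mul_ne_zero (hv i) (hv j))
    · rw [zero_mul]
  by_cases hu : u' = u
  · by_cases hp : p = M.star i
    · subst hu hp
      cases o.first T.right <;>
        simp only [Bool.not_true, Bool.not_false, if_true, if_false, Bool.true_eq_false,
          Bool.false_eq_true, M.F_eq, M.sixj_zero₁, M.sixj_zero₂, M.sixj_zero₅, M.star_star,
          true_and, M.v_star]
      · have e1 : M.allowed (M.star u') (M.star i) l' ↔ M.allowed u' i (M.star l') := by
          rw [← M.allowed_star_iff, M.star_star, M.star_star]
        have e2 : M.allowed (M.star i) l' (M.star u') ↔ M.allowed u' i (M.star l') := by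
          rw [M.allowed_rotate_iff, M.allowed_rotate_iff, e1]
        have e3 : M.allowed l (M.star u') (M.star j) ↔ M.allowed (M.star l) j u' := by
          rw [M.allowed_swap_right, ← M.allowed_star_iff, M.star_star, M.star_star]
        simp only [e1, e2, e3, hm]
        by_cases hA : M.allowed u' i (M.star l') <;> by_cases hB : M.allowed (M.star l) j u' <;>
          simp [hA, hB]
      · have e1 : M.allowed (M.star l) (M.star i) u' ↔ M.allowed l i (M.star u') := by
          rw [← M.allowed_star_iff, M.star_star, M.star_star]
        have e2 : M.allowed (M.star i) u' (M.star l) ↔ M.allowed l i (M.star u') := by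
          rw [M.allowed_rotate_iff, M.allowed_rotate_iff, e1]
        have e3 : M.allowed u' (M.star l') (M.star j) ↔ M.allowed (M.star u') j l' := by
          rw [M.allowed_swap_right, ← M.allowed_star_iff, M.star_star, M.star_star]
        simp only [e1, e2, e3, hm]
        by_cases hA : M.allowed l i (M.star u') <;> by_cases hB : M.allowed (M.star u') j l' <;>
          simp [hA, hB]
    · cases o.first T.right <;>
        simp [hp, Ne.symm hp, M.F_eq, M.sixj_zero₁, M.sixj_zero₂, M.sixj_zero₅]
  · cases o.first T.right <;>
      simp [hu, Ne.symm hu, M.F_eq, M.sixj_zero₁, M.sixj_zero₂, M.sixj_zero₅]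

end Corners

theorem _root_.TrivalentMap.FusionOrder.allowed_of_localFactor_ne_zero {o : G.FusionOrder}
    {S : D → Prop} {ι : D → L} (hι : ∀ a, ¬ S a → ι a = M.zero) {x y z : G.Config M} {s : D}
    (h : o.localFactor S ι x y z s ≠ 0) :
    M.allowed ((o.before x y s).1 s) (ι s) (M.star ((o.after y z s).1 s)) := by
  rw [FusionOrder.localFactor] at h
  split_ifs at h with h1 h2
  · obtain ⟨-, -, h3⟩ := M.physicality _ _ _ _ _ _ h
    rw [← M.allowed_star_iff, M.star_star, (o.before x y s).2, (o.after y z s).2, M.star_star] at h3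
    simpa only [M.star_star] using h3
  · rw [hι s h1, h2.1, M.allowed_zero_mid]
  · exact absurd rfl h

variable (o' : T.removed.FusionOrder) {S : D → Prop}
  {S' : {a : D // T.Survives a} → Prop} {ι : D → L} {ι' : {a : D // T.Survives a} → L}

theorem localFactor_extend (hS : ∀ a, S a.1 ↔ S' a) (hι : ∀ a, ι a.1 = ι' a)
    (x' y' z' : T.removed.Config M) (lx px ly py lz pz : L) (s : {a : D // T.Survives a}) :
    (T.extendOrder o').localFactor S ι (T.extend x' lx px) (T.extend y' ly py) (T.extend z' lz pz)
        s.1 = o'.localFactor S' ι' x' y' z' s := by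
  classical
  have hf : ∀ a : {a // T.Survives a}, (T.extendOrder o').first a.1 = o'.first a :=
    T.extendFirst_val o'
  have hx := T.extend_val x' lx px
  have hy := T.extend_val y' ly py
  have hz := T.extend_val z' lz pz
  have hn := T.removed_next_val
  have hr : ∀ x : G.Config M, ∀ a, x.1 (G.rev a) = M.star (x.1 a) := fun x => x.2
  have hr' : ∀ x : T.removed.Config M, ∀ a, x.1 (T.removed.rev a) = M.star (x.1 a) := fun x => x.2
  simp only [FusionOrder.localFactor, FusionOrder.cornerFactor, FusionOrder.before_eq,
    FusionOrder.after_eq, FusionOrder.leg_eq, FusionOrder.first_rev, hr, hr', ← hn, hf, hx, hy, hz,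
    hS, hι]

open scoped Classical in
theorem multiLoop_extend [Fintype D] (hS : ∀ a, S a.1 ↔ S' a) (hSl : S T.loop)
    (hSr : S (G.rev T.loop))
    (hSs : S T.stem) (hSf : S T.foot) (hSl' : S T.left) (hSr' : S T.right)
    (hι' : ∀ a, ¬ S' a → ι' a = M.zero)
    (h0 : ι T.loop = M.zero) (hι : ∀ a, a ≠ T.loop → ι a = ι' (T.shadow a))
    (x' z' : T.removed.Config M) (l l' : L) :
    (T.extendOrder o').multiLoop M S ι (T.extend z' l' M.zero) (T.extend x' l M.zero) =
      (if M.allowed (M.star l) (ι' T.newDart) l' then (M.d (ι' T.newDart))⁻¹ else 0) *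
        o'.multiLoop M S' ι' z' x' := by
  set i := ι' T.newDart with hi
  set j := ι' (T.removed.rev T.newDart) with hj
  have ιl : ι T.left = j := by rw [hι _ T.left_ne_loop, T.shadow_left]
  have ιi : ∀ a, ¬ T.Survives a → a ≠ T.loop → a ≠ T.left → ι a = i := fun a h1 h2 h3 => by
    rw [hι a h2, T.shadow_of_not_survives h1 h3]
  have hιs : ∀ a, ι a.1 = ι' a := fun a => by
    rw [hι _ fun h => T.not_survives_loop (h ▸ a.2), T.shadow_of_survives]
  have hf1 := T.extendFirst_loop o'
  have hf2 := T.extendFirst_stem o'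
  have hf3 := T.extendFirst_foot o'
  have hf4 : T.extendFirst o' T.left = !T.extendFirst o' T.right := by
    rw [extendFirst_left, extendFirst_right]
  have e (y : G.Config M) : ∏ s, (T.extendOrder o').localFactor S ι (T.extend x' l M.zero) y
      (T.extend z' l' M.zero) s =
      (∏ s : {a // T.Survives a}, (T.extendOrder o').localFactor S ι (T.extend x' l M.zero) y
        (T.extend z' l' M.zero) s) *
      ((if y.1 T.loop = l ∧ y.1 T.stem = M.star i ∧ M.allowed (M.star l) i l'
          then (M.d i)⁻¹ else 0) *
        if y.1 (G.rev T.left) = y.1 T.right ∧ y.1 T.stem = M.star i ∧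
          M.allowed (((T.extendOrder o').before (T.extend x' l M.zero) y
              (G.rev T.left)).1 (G.rev T.left)) i
            (M.star (((T.extendOrder o').after y (T.extend z' l' M.zero)
              (G.rev T.left)).1 (G.rev T.left))) ∧
          M.allowed (((T.extendOrder o').before (T.extend x' l M.zero) y
              (G.rev T.right)).1 (G.rev T.right)) j
            (M.star (((T.extendOrder o').after y (T.extend z' l' M.zero)
              (G.rev T.right)).1 (G.rev T.right))) then 1 else 0) := by
    rw [T.prod_darts]
    simp only [FusionOrder.localFactor, hSl, hSr, hSs, hSf, hSl', hSr', if_true, h0,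
      ιi _ T.not_survives_rev_loop T.rev_loop_ne_loop T.left_ne_rev_loop.symm,
      ιi _ T.not_survives_stem T.stem_ne_loop T.left_ne_stem.symm,
      ιi _ T.not_survives_foot T.foot_ne_loop T.left_ne_foot.symm,
      ιi _ T.not_survives_right T.right_ne_loop T.right_ne_left, ιl]
    rw [T.cornerFactors_loop (T.extendOrder o') hf1 hf2 i _ y _ (T.extend_stem _ _ _)
      (T.extend_stem _ _ _), T.cornerFactors_foot (T.extendOrder o') hf3 hf4 i j _ y _
      (T.extend_stem _ _ _) (T.extend_stem _ _ _) (by rw [extend_rev_left, extend_right])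
      (by rw [extend_rev_left, extend_right]), extend_loop, extend_loop]
  rw [FusionOrder.multiLoop, FusionOrder.multiLoop,
    T.sum_extend (l := l) (p := M.star i), Finset.mul_sum]
  · refine Finset.sum_congr rfl fun y' _ => ?_
    rw [e]
    simp only [T.localFactor_extend o' hS hιs]
    by_cases h : ∏ s, o'.localFactor S' ι' x' y' z' s = 0
    · rw [h, zero_mul, mul_zero]
    -- The surviving corners at the two ends of `e'` supply the admissibility conditions from `v`.
    · have hn := fun s => FusionOrder.allowed_of_localFactor_ne_zero hι'
        (Finset.prod_ne_zero_iff.1 h s (Finset.mem_univ s))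
      have h1 := hn T.newDart
      have h2 := hn (T.removed.rev T.newDart)
      have f1 : (T.extendOrder o').first (G.rev T.left) = o'.first T.newDart :=
        T.extendFirst_rev_left o'
      have f2 : (T.extendOrder o').first (G.rev T.right) = o'.first (T.removed.rev T.newDart) := by
        rw [o'.first_rev]
        exact T.extendFirst_rev_right o'
      simp only [FusionOrder.before_eq, FusionOrder.after_eq, ← hi, ← hj] at h1 h2
      simp only [FusionOrder.before_eq, FusionOrder.after_eq, f1, f2, extend_rev_right,
        extend_rev_left, extend_right, extend_loop, extend_stem, h1, h2, and_true, true_and,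
        if_true, mul_one]
      rw [mul_comm]
  · intro y hy
    rw [e] at hy
    have h1 := right_ne_zero_of_mul hy
    have h2 := (ite_ne_right_iff.1 (left_ne_zero_of_mul h1)).1
    have h3 := (ite_ne_right_iff.1 (right_ne_zero_of_mul h1)).1
    exact ⟨h3.1, h2.1, h3.2.1⟩

end Tadpole

end TrivalentMap

namespace TrivalentMap

/-! ### The operator `Z` intertwines the plaquette operators. -/

namespace Tadpole

variable {D : Type*} {G : TrivalentMap D} {L : Type*} [Fintype L] {M : StringNetData L}
  (T : G.Tadpole)

theorem allowedAt_extend (x' : T.removed.Config M) (l : L) {a : D} (h : ¬ T.Survives a) :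
    (T.extend x' l M.zero).AllowedAt a := by
  have hl : (T.extend x' l M.zero).AllowedAt T.loop := by
    rw [Config.AllowedAt, T.next_loop, T.next_rev_loop, G.rev_rev, (T.extend x' l M.zero).2,
      (T.extend x' l M.zero).2 T.stem, extend_loop, extend_stem, M.star_zero,
      M.allowed_zero_right, M.star_star]
  have hf : (T.extend x' l M.zero).AllowedAt T.foot := by
    rw [Config.AllowedAt, T.next_foot, T.next_left, T.rev_foot, extend_stem, extend_rev_left,
      (T.extend x' l M.zero).2 T.right, extend_right, M.allowed_zero_left]
  have h1 : (T.extend x' l M.zero).AllowedAt (G.rev T.loop) := by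
    rw [← T.next_loop]
    exact (Config.allowedAt_next _ _).2 hl
  have h2 : (T.extend x' l M.zero).AllowedAt T.left := (Config.allowedAt_next _ _).2 hf
  rcases T.dart_cases a with h' | rfl | rfl | rfl | rfl | rfl | rfl
  · exact absurd h' h
  · exact hl
  · exact h1
  · exact (Config.allowedAt_next _ _).2 h1
  · exact hf
  · exact h2
  · exact (Config.allowedAt_next _ _).2 h2

theorem touches_liftFace {q : T.removed.Face} {a : {a : D // T.Survives a}}
    (h : T.removed.Touches q a) : G.Touches (T.liftFace q) a.1 := by
  obtain ⟨b, hb, rfl⟩ := h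
  refine ⟨b.1, ?_, rfl⟩
  rcases T.removed.eq_of_vertex_eq hb with rfl | rfl | rfl
  · rfl
  · exact (G.vertex_next _).symm
  · rw [removed_next_val, removed_next_val, G.vertex_next, G.vertex_next]

open scoped Classical in
theorem Z_conjTranspose_apply (x : G.Config M) (x' : T.removed.Config M) :
    (T.Z M)ᴴ x x' = if T.Matches M x' x then M.Phi (x.1 T.loop) else 0 := by
  rw [Matrix.conjTranspose_apply, Z, ← starRingEnd_apply]
  split_ifs <;> simp

variable [Fintype D]

open scoped Classical in
theorem loopOp_extend (o : G.FusionOrder) (o' : T.removed.FusionOrder) (q : T.removed.Face) (i : L)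
    (x' z' : T.removed.Config M) (l l' : L) :
    o.loopOp M (T.liftFace q) i (T.extend z' l' M.zero) (T.extend x' l M.zero) =
      (if M.allowed (M.star l) (T.removed.loopType M q i T.newDart) l'
        then (M.d (T.removed.loopType M q i T.newDart))⁻¹ else 0) * o'.loopOp M q i z' x' := by
  -- The condition is vacuous at the two vertices of the tadpole, so both always belong to `S`. If
  -- no loop passes there, this is harmless because extended configurations are allowed at them.
  let S : D → Prop := fun a => ∀ h : T.Survives a, T.removed.Touches q ⟨a, h⟩
  have hS : ∀ a, S (G.next a) ↔ S a := fun a => by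
    constructor
    · intro h h'
      exact T.removed.touches_next.1 (h (T.survives_next.2 h'))
    · intro h h'
      exact T.removed.touches_next (a := ⟨a, T.survives_next.1 h'⟩).2 (h _)
  obtain ⟨hloop, hshadow⟩ := T.loopType_liftFace (M := M) q i
  have hsides : ∀ a, G.face a = T.liftFace q → S a := fun a ha h => by
    have h0 : a ≠ T.loop := fun h' => T.not_survives_loop (h' ▸ h)
    refine ⟨⟨a, h⟩, rfl, ?_⟩
    rw [← (T.removed_face_shadow_eq_iff h0 q).2 ha, T.shadow_of_survives ⟨a, h⟩]
  have hzero : ∀ a, ¬ S a → G.loopType M (T.liftFace q) i a = M.zero := fun a h =>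
    if_neg fun h' => h (hsides a h')
  have e : o.loopOp M (T.liftFace q) i (T.extend z' l' M.zero) (T.extend x' l M.zero) =
      o.multiLoop M S (G.loopType M (T.liftFace q) i) (T.extend z' l' M.zero)
        (T.extend x' l M.zero) := by
    rw [o.multiLoop_mono (S := fun a => G.face a = T.liftFace q)
      (ι := G.loopType M (T.liftFace q) i) hsides (fun a h => if_neg h) hS, ← o.loopOp_eq_sides]
    split_ifs with h
    · rfl
    · by_contra h'
      rw [o.loopOp_eq] at h'
      refine h fun a ha => ?_
      by_cases hs : T.Survives a
      · obtain ⟨b, hb, hb'⟩ := T.touches_liftFace (ha hs)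
        exact (o.allowedAt_of_multiLoop_ne_zero h' hb ⟨b, rfl, hb'⟩).1
      · exact T.allowedAt_extend x' l hs
  rw [e, o.multiLoop_order (T.extendOrder o') hS hzero loopType_facePerm, o'.loopOp_eq]
  exact T.multiLoop_extend (S := S) (S' := T.removed.Touches q)
    (ι := G.loopType M (T.liftFace q) i) (ι' := T.removed.loopType M q i) o'
    (fun a => ⟨fun h => h a.2, fun h _ => h⟩)
    (fun h => absurd h T.not_survives_loop) (fun h => absurd h T.not_survives_rev_loop)
    (fun h => absurd h T.not_survives_stem) (fun h => absurd h T.not_survives_foot)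
    (fun h => absurd h T.not_survives_left) (fun h => absurd h T.not_survives_right)
    (fun a h => loopType_of_not_touches h) hloop hshadow x' z' l l'

theorem Z_mul_mul_apply (A : Matrix (G.Config M) (G.Config M) ℂ) (z' x' : T.removed.Config M) :
    (T.Z M * A * (T.Z M)ᴴ) z' x' = ∑ l, ∑ l', M.Phi l * starRingEnd ℂ (M.Phi l') *
      A (T.extend z' l' M.zero) (T.extend x' l M.zero) := by
  classical
  have e (x : G.Config M) : (T.Z M * A) z' x =
      ∑ l', starRingEnd ℂ (M.Phi l') * A (T.extend z' l' M.zero) x := by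
    rw [Matrix.mul_apply]
    simp only [Z, ite_mul, zero_mul]
    rw [T.sum_matches z' fun z => starRingEnd ℂ (M.Phi (z.1 T.loop)) * A z x]
    simp only [extend_loop]
  rw [Matrix.mul_apply]
  simp only [Z_conjTranspose_apply, mul_ite, mul_zero]
  rw [T.sum_matches x' fun x => (T.Z M * A) z' x * M.Phi (x.1 T.loop)]
  simp only [extend_loop, e, Finset.sum_mul]
  exact Finset.sum_congr rfl fun l _ => Finset.sum_congr rfl fun l' _ => by ring

theorem Z_mul_loopOp_mul (o : G.FusionOrder) (o' : T.removed.FusionOrder) (q : T.removed.Face)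
    (i : L) : T.Z M * o.loopOp M (T.liftFace q) i * (T.Z M)ᴴ = o'.loopOp M q i := by
  classical
  ext z' x'
  rw [Z_mul_mul_apply]
  simp only [T.loopOp_extend o o' q i x' z', ← mul_assoc, ← Finset.sum_mul]
  set k := T.removed.loopType M q i T.newDart
  have h0 : ∑ i, M.d i ^ 2 ≠ 0 := M.totalDim_ne_zero
  have hk := M.d_ne_zero k
  -- The sum over `l'` gives `d l * d k`, which cancels `1 / d k`; the sum over `l` then cancels the
  -- normalization of `Φ`.
  have h : ∑ l, ∑ l', M.Phi l * starRingEnd ℂ (M.Phi l') *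
      (if M.allowed (M.star l) k l' then (M.d k)⁻¹ else 0) = 1 := by
    have e (l l' : L) : M.Phi l * starRingEnd ℂ (M.Phi l') *
        (if M.allowed (M.star l) k l' then (M.d k)⁻¹ else 0) =
        ((∑ k, M.d k ^ 2)⁻¹ * (M.d k)⁻¹ * M.d l) *
          (M.d l' * if M.allowed (M.star l) k l' then 1 else 0) := by
      rw [M.Phi_mul_conj_Phi]
      split_ifs <;> ring
    simp only [e, ← Finset.mul_sum, M.sum_d_allowed, M.d_star]
    have e2 (l : L) : (∑ k, M.d k ^ 2)⁻¹ * (M.d k)⁻¹ * M.d l * (M.d l * M.d k) =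
        (∑ k, M.d k ^ 2)⁻¹ * M.d l ^ 2 := by
      field_simp
    simp only [e2, ← Finset.mul_sum]
    exact inv_mul_cancel₀ h0
  rw [h, one_mul]

theorem Z_mul_plaquetteOp_mul (o : G.FusionOrder) (o' : T.removed.FusionOrder)
    (q : T.removed.Face) :
    T.Z M * o.plaquetteOp M (T.liftFace q) * (T.Z M)ᴴ = o'.plaquetteOp M q := by
  rw [FusionOrder.plaquetteOp, FusionOrder.plaquetteOp, Matrix.mul_smul, Matrix.smul_mul,
    Matrix.mul_sum, Matrix.sum_mul]
  congr 1
  refine Finset.sum_congr rfl fun i _ => ?_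
  rw [Matrix.mul_smul, Matrix.smul_mul, T.Z_mul_loopOp_mul o o']

theorem Z_mul_conjTranspose [DecidableEq (T.removed.Config M)] :
    T.Z M * (T.Z M)ᴴ = 1 := by
  classical
  ext z' x'
  have h := T.Z_mul_mul_apply (M := M) 1 z' x'
  rw [Matrix.mul_one] at h
  rw [h]
  have e (l l' : L) : M.Phi l * starRingEnd ℂ (M.Phi l') *
      (1 : Matrix (G.Config M) (G.Config M) ℂ) (T.extend z' l' M.zero) (T.extend x' l M.zero) =
      if l' = l then (if z' = x' then M.Phi l * starRingEnd ℂ (M.Phi l) else 0) else 0 := by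
    rw [Matrix.one_apply]
    by_cases hl : l' = l
    · by_cases hx : z' = x'
      · simp [hl, hx]
      · rw [if_neg, if_pos hl, if_neg hx, mul_zero]
        intro h
        apply hx
        apply Subtype.ext
        funext a
        rw [← T.extend_val z' l' M.zero, h, extend_val]
    · rw [if_neg, if_neg hl, mul_zero]
      intro h
      apply hl
      rw [← T.extend_loop z' l' M.zero, h, extend_loop]
  simp only [e, Finset.sum_ite_eq', Finset.mem_univ, if_true]
  rw [Matrix.one_apply]
  split_ifs
  · have := M.sum_normSq_Phi
    simp only [Complex.mul_conj']
    exact_mod_cast this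
  · simp

/-- With an empty stem the branching rule at `v` says that `e₃` and `e₄` carry the same string. Then
exactly one configuration of `G'` matches, the restriction. -/
theorem conjTranspose_mul_Z :
    (T.Z M)ᴴ * T.Z M = G.vertexOp M (G.vertex T.foot) * T.projector M := by
  classical
  ext z x
  rw [Matrix.mul_apply, vertexOp, Matrix.diagonal_mul]
  simp only [Z_conjTranspose_apply, Z]
  have hall : (∀ a, G.vertex a = G.vertex T.foot → M.allowed (z.1 (G.rev a))
      (z.1 (G.rev (G.next a))) (z.1 (G.rev (G.next (G.next a))))) ↔ z.AllowedAt T.foot := by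
    constructor
    · exact fun h => h T.foot rfl
    · intro h a ha
      change z.AllowedAt a
      rcases T.eq_of_vertex_foot ha with rfl | rfl | rfl
      · exact h
      · exact (Config.allowedAt_next _ _).2 h
      · exact (Config.allowedAt_next _ _).2 ((Config.allowedAt_next _ _).2 h)
  have hfoot (h : z.1 T.stem = M.zero) : z.AllowedAt T.foot ↔ z.1 (G.rev T.left) = z.1 T.right := by
    rw [Config.AllowedAt, T.next_foot, T.next_left, T.rev_foot, h, z.2 T.right,
      M.allowed_zero_left, M.star_inj]
    exact eq_comm
  have hxf : x.1 T.foot = M.star (x.1 T.stem) := x.2 _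
  have hzf : z.1 T.foot = M.star (z.1 T.stem) := z.2 _
  by_cases hz : z.1 T.stem = M.zero ∧ z.1 (G.rev T.left) = z.1 T.right
  · obtain ⟨hz1, hz2⟩ := hz
    rw [if_pos (hall.2 ((hfoot hz1).2 hz2)), one_mul, Finset.sum_eq_single (T.restrict z hz2),
      if_pos ⟨hz1, hz2, fun _ => rfl⟩, projector]
    · have h : T.Matches M (T.restrict z hz2) x ↔ (z.1 T.stem = M.zero ∧ x.1 T.stem = M.zero ∧
          ∀ a, a ≠ T.loop → a ≠ G.rev T.loop → a ≠ T.stem → a ≠ T.foot → z.1 a = x.1 a) := by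
        constructor
        · rintro ⟨h1, h2, h3⟩
          have h4 : ∀ a, T.Survives a → z.1 a = x.1 a := fun a ha => h3 ⟨a, ha⟩
          have h5 := h4 _ T.survives_rev_left
          refine ⟨hz1, h1, fun a n1 n2 n3 n4 => ?_⟩
          rcases T.dart_cases a with h | h | h | h | h | h | h
          · exact h4 a h
          · exact absurd h n1
          · exact absurd h n2
          · exact absurd h n3
          · exact absurd h n4
          · rw [h]
            apply M.star_injective
            rw [← z.2, ← x.2, h5]
          · rw [h, ← hz2, ← h2, h5]
        · rintro ⟨-, h1, h3⟩
          have h4 : ∀ a, T.Survives a → z.1 a = x.1 a := fun a ha =>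
            h3 a (fun h => T.not_survives_loop (h ▸ ha))
              (fun h => T.not_survives_rev_loop (h ▸ ha))
              (fun h => T.not_survives_stem (h ▸ ha)) (fun h => T.not_survives_foot (h ▸ ha))
          have h5 := h4 _ T.survives_rev_left
          have h6 := h3 T.right T.right_ne_loop T.right_ne_rev_loop T.right_ne_stem
            T.right_ne_foot
          exact ⟨h1, by rw [← h5, ← h6, hz2], fun a => h4 a.1 a.2⟩
      simp only [h]
      split_ifs <;> simp
    · intro x' _ hx'
      rw [if_neg, zero_mul]
      rintro ⟨-, -, h⟩
      exact hx' (Subtype.ext (funext h))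
    · exact fun h => absurd (Finset.mem_univ _) h
  · rw [Finset.sum_eq_zero]
    · rw [projector]
      by_cases hz1 : z.1 T.stem = M.zero
      · have hz2 : ¬ z.AllowedAt T.foot := fun h => hz ⟨hz1, (hfoot hz1).1 h⟩
        rw [if_neg fun h => hz2 (hall.1 h), zero_mul]
      · simp only [hz1, false_and, if_false, mul_zero]
    · intro x' _
      rw [if_neg fun h => hz ⟨h.1, h.2.1⟩, zero_mul]

open scoped ComplexOrder in
-- Only the compression `Z B Z† = B'` is computed from corners. In the product of `B Z† - Z† B'`
-- with its adjoint each of the four terms is `B'` up to sign, and the signs cancel; so the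
-- difference is zero.
theorem plaquetteOp_mul_Z (o : G.FusionOrder) (o' : T.removed.FusionOrder) (q : T.removed.Face) :
    o.plaquetteOp M (T.liftFace q) * (T.Z M)ᴴ = (T.Z M)ᴴ * o'.plaquetteOp M q := by
  classical
  set B := o.plaquetteOp M (T.liftFace q) with hB
  set B' := o'.plaquetteOp M q
  have hZ := T.Z_mul_conjTranspose (M := M)
  have h1 : T.Z M * B * (T.Z M)ᴴ = B' := T.Z_mul_plaquetteOp_mul o o' q
  have hBh : Bᴴ = B := o.plaquetteOp_isHermitian _
  have hBh' : B'ᴴ = B' := o'.plaquetteOp_isHermitian _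
  have hBB : B * B = B := o.plaquetteOp_mul_self _
  have hBB' : B' * B' = B' := o'.plaquetteOp_mul_self _
  rw [← sub_eq_zero, ← Matrix.conjTranspose_mul_self_eq_zero, Matrix.conjTranspose_sub,
    Matrix.conjTranspose_mul, Matrix.conjTranspose_mul, Matrix.conjTranspose_conjTranspose, hBh,
    hBh', Matrix.sub_mul, Matrix.mul_sub, Matrix.mul_sub]
  have e1 : T.Z M * B * (B * (T.Z M)ᴴ) = B' := by
    rw [Matrix.mul_assoc, ← Matrix.mul_assoc B, hBB, ← Matrix.mul_assoc, h1]
  have e2 : T.Z M * B * ((T.Z M)ᴴ * B') = B' := by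
    rw [← Matrix.mul_assoc, h1, hBB']
  have e3 : B' * T.Z M * (B * (T.Z M)ᴴ) = B' := by
    rw [Matrix.mul_assoc, ← Matrix.mul_assoc (T.Z M), h1, hBB']
  have e4 : B' * T.Z M * ((T.Z M)ᴴ * B') = B' := by
    rw [Matrix.mul_assoc, ← Matrix.mul_assoc (T.Z M), hZ, Matrix.one_mul, hBB']
  rw [e1, e2, e3, e4]
  simp

end Tadpole

end TrivalentMap

/-! ### Ground states and the final theorem. -/

namespace TrivalentMap

variable {D : Type*} {G : TrivalentMap D} {L : Type*} [Fintype L] {M : StringNetData L}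

theorem allowedAt_of_vertexOp_mulVec [Fintype D] {ψ : G.Config M → ℂ}
    (h : ∀ w, G.vertexOp M w *ᵥ ψ = ψ) {x : G.Config M} (hx : ψ x ≠ 0) (a : D) :
    x.AllowedAt a := by
  classical
  by_contra ha
  apply hx
  rw [← h (G.vertex a), vertexOp, Matrix.mulVec_diagonal, if_neg fun h' => ha (h' a rfl), zero_mul]

theorem vertexOp_mulVec_of_allowedAt [Fintype D] {ψ : G.Config M → ℂ}
    (h : ∀ x, ψ x ≠ 0 → ∀ a, x.AllowedAt a) (w : G.Vertex) : G.vertexOp M w *ᵥ ψ = ψ := by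
  classical
  ext x
  rw [vertexOp, Matrix.mulVec_diagonal]
  by_cases hx : ψ x = 0
  · rw [hx, mul_zero]
  · exact (congrArg (· * ψ x) (if_pos fun a _ => h x hx a)).trans (one_mul _)

namespace Tadpole

variable (T : G.Tadpole)

theorem Matches.allowedAt {x' : T.removed.Config M} {x : G.Config M} (h : T.Matches M x' x)
    {a : {a : D // T.Survives a}} (ha : x.AllowedAt a.1) : x'.AllowedAt a := by
  have e (b : {b : D // T.Survives b}) : x'.1 (T.removed.rev b) = x.1 (G.rev b.1) := by
    rw [x'.2, x.2, h.2.2]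
  rw [Config.AllowedAt, e, e, e]
  exact ha

variable [Fintype D]

theorem Z_mulVec_isGroundState (o : G.FusionOrder) (o' : T.removed.FusionOrder)
    {ψ : G.Config M → ℂ} (h : IsGroundState (o.hamiltonian M) ψ) :
    IsGroundState (o'.hamiltonian M) (T.Z M *ᵥ ψ) ∧ (T.Z M)ᴴ *ᵥ (T.Z M *ᵥ ψ) = ψ := by
  classical
  rw [isGroundState_hamiltonian_iff] at h ⊢
  obtain ⟨hψ, hQ, hB⟩ := h
  -- `Z† Z` is the product of `Q_v` and `B_p`, both of which fix `ψ`.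
  have hZ : (T.Z M)ᴴ *ᵥ (T.Z M *ᵥ ψ) = ψ := by
    rw [Matrix.mulVec_mulVec, conjTranspose_mul_Z, ← T.plaquetteOp_head o, ← Matrix.mulVec_mulVec,
      hB, hQ]
  refine ⟨⟨fun h0 => hψ ?_, ?_, fun q => ?_⟩, hZ⟩
  · rw [← hZ, h0, Matrix.mulVec_zero]
  · refine vertexOp_mulVec_of_allowedAt fun x' hx' a => ?_
    -- A configuration in the support of `Z ψ` is matched by one in the support of `ψ`, and the
    -- surviving vertices see the same labels in both.
    obtain ⟨x, -, hx⟩ := Finset.exists_ne_zero_of_sum_ne_zero (s := Finset.univ)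
      (f := fun x => T.Z M x' x * ψ x) hx'
    have hm : T.Matches M x' x := by
      by_contra hm
      exact left_ne_zero_of_mul hx (if_neg hm)
    exact hm.allowedAt T (allowedAt_of_vertexOp_mulVec hQ (right_ne_zero_of_mul hx) a.1)
  -- The adjoint relation `Z B = B' Z` carries invariance of `ψ` over to `Z ψ`.
  · have e := congrArg Matrix.conjTranspose (T.plaquetteOp_mul_Z (M := M) o o' q)
    rw [Matrix.conjTranspose_mul, Matrix.conjTranspose_mul, Matrix.conjTranspose_conjTranspose,
      (o.plaquetteOp_isHermitian _).eq, (o'.plaquetteOp_isHermitian _).eq] at e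
    rw [Matrix.mulVec_mulVec, ← e, ← Matrix.mulVec_mulVec, hB]

end Tadpole

end TrivalentMap

theorem lemma2 {L : Type*} [Fintype L] (M : StringNetData L)
    {D : Type*} [Fintype D] (G : TrivalentMap D) (T : G.Tadpole)
    (o : G.FusionOrder) (o' : T.removed.FusionOrder) :
    (∑ i, ‖M.Phi i‖ ^ 2 = 1 ∧ o.plaquetteOp M T.head = T.projector M) ∧
    (o.plaquetteOp M T.outer * G.vertexOp M (G.vertex T.foot) * o.plaquetteOp M T.head
      = (T.Z M)ᴴ * o'.plaquetteOp M T.outerRemoved * T.Z M) ∧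
    ∀ ψ : G.Config M → ℂ, IsGroundState (o.hamiltonian M) ψ →
      ∃ ψ' : T.removed.Config M → ℂ, IsGroundState (o'.hamiltonian M) ψ' ∧
        ψ = (T.Z M)ᴴ *ᵥ ψ' ∧
        (∀ x' x, T.Matches M x' x → ψ x = M.Phi (x.1 T.loop) * ψ' x') ∧
        (∀ x, ¬ (x.1 T.stem = M.zero ∧ x.1 (G.rev T.left) = x.1 T.right) → ψ x = 0) := by
  classical
  refine ⟨⟨M.sum_normSq_Phi, T.plaquetteOp_head o⟩, ?_, fun ψ hψ => ?_⟩
  · rw [T.plaquetteOp_head, Matrix.mul_assoc, ← T.conjTranspose_mul_Z, ← Matrix.mul_assoc,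
      ← T.liftFace_outerRemoved, T.plaquetteOp_mul_Z o o']
  · obtain ⟨h, hZ⟩ := T.Z_mulVec_isGroundState o o' hψ
    have e (x : G.Config M) : ψ x = ∑ x', (T.Z M)ᴴ x x' * (T.Z M *ᵥ ψ) x' := (congrFun hZ x).symm
    refine ⟨T.Z M *ᵥ ψ, h, hZ.symm, fun x' x hx => ?_, fun x hx => ?_⟩
    · rw [e, Finset.sum_eq_single x', TrivalentMap.Tadpole.Z_conjTranspose_apply, if_pos hx]
      · intro y _ hy
        rw [TrivalentMap.Tadpole.Z_conjTranspose_apply, if_neg, zero_mul]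
        exact fun h' => hy (Subtype.ext (funext fun a => (h'.2.2 a).trans (hx.2.2 a).symm))
      · exact fun h' => absurd (Finset.mem_univ _) h'
    · rw [e]
      refine Finset.sum_eq_zero fun y _ => ?_
      rw [TrivalentMap.Tadpole.Z_conjTranspose_apply, if_neg fun h' => hx ⟨h'.1, h'.2.1⟩, zero_mul]
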